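/- Let $\mathbb{K}$ be the C*-algebra of compact operators on a separable, infinite-dimensional Hilbert space. For a C*-algebra $A$ (not assumed unital or separable), let $\mathrm{Cu}(A)$ be its Cuntz semigroup: the set of classes $[a]$ of positive elements $a\in A\otimes\mathbb{K}$ modulo Cuntz equivalence, where $a\precsim b$ if there is a sequence $(r_n)_n$ in $A\otimes\mathbb{K}$ with $\lim_n\|a-r_n b r_n^*\|=0$, and $a\sim b$ if $a\precsim b$ and $b\precsim a$; it is ordered by $[a]\le[b]$ if $a\precsim b$, and $[a]+[b]=\left[\begin{pmatrix}a&0\\0&b\end{pmatrix}\right]$ using an identification $A\otimes\mathbb{K}\otimes M_2\cong A\otimes\mathbb{K}$ induced by an isomorphism $\mathbb{K}\otimes M_2\cong\mathbb{K}$ (the result does not depend on the choice). In a partially ordered set, write $a\ll b$ if for every increasing sequence $(s_n)_n$ that has a supremum with $b\le\sup_n s_n$ there is $N$ with $a\le s_N$. A partially ordered set $S$ with an addition satisfies (O6+) (strengthened almost Riesz decomposition) if for all $a,b,c,x',x,y',y\in S$ with $$a\le b+c,\qquad x'\ll x\le a,b,\qquad y'\ll y\le a,c,$$ there exist $e,f\in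 S$ with $$a\le e+f,\qquad x'\ll e\le a,b,\qquad y'\ll f\le a,c.$$ A unital C*-algebra has stable rank one if its invertible elements are dense; a nonunital C*-algebra has stable rank one if its minimal unitization does. **Theorem.** If $A$ is a C*-algebra with stable rank one, then $\mathrm{Cu}(A)$ satisfies (O6+). On the other hand, $\mathrm{Cu}(C(S^2))$, for $C(S^2)$ the C*-algebra of continuous complex-valued functions on the $2$-sphere, does not satisfy (O6+). -/

import Mathlib

noncomputable section

open Filter Topology UniformSpace

/-! ### Completion of a normed *-algebra satisfying the C*-identity -/

/-- The completion of a (not necessarily complete) complex normed *-algebra `E` satisfying the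
C*-identity; it is a C*-algebra. -/
def CStarCompletion (E : Type*) [NonUnitalNormedRing E] : Type _ := Completion E

namespace CStarCompletion

section Normed

variable {E : Type*} [NonUnitalNormedRing E]

instance : NormedAddCommGroup (CStarCompletion E) :=
  inferInstanceAs (NormedAddCommGroup (Completion E))

instance : CompleteSpace (CStarCompletion E) := inferInstanceAs (CompleteSpace (Completion E))

/-- The canonical embedding of `E` into its completion. -/
def of (x : E) : CStarCompletion E := (x : Completion E)

theorem continuous_of : Continuous (of : E → CStarCompletion E) := Completion.continuous_coe E

theorem isDenseInducing_of : IsDenseInducing (of : E → CStarCompletion E) :=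
  Completion.isDenseInducing_coe

theorem of_injective : Function.Injective (of : E → CStarCompletion E) := Completion.coe_injective E

@[simp] theorem of_add (x y : E) : of (x + y) = of x + of y := Completion.coe_add x y

@[simp] theorem of_zero : of (0 : E) = 0 := Completion.coe_zero

@[simp] theorem norm_of (x : E) : ‖of x‖ = ‖x‖ := Completion.norm_coe x

/-- `of` as an additive homomorphism. -/
def ofHom : E →+ CStarCompletion E where
  toFun := of
  map_zero' := of_zero
  map_add' := of_add

theorem induction_on {p : CStarCompletion E → Prop} (a : CStarCompletion E)
    (hp : IsClosed {a | p a}) (ih : ∀ a, p (of a)) : p a :=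
  Completion.induction_on a hp ih

theorem induction_on₂ {p : CStarCompletion E → CStarCompletion E → Prop}
    (a b : CStarCompletion E)
    (hp : IsClosed {x : CStarCompletion E × CStarCompletion E | p x.1 x.2})
    (ih : ∀ a b, p (of a) (of b)) : p a b :=
  Completion.induction_on₂ a b hp ih

theorem induction_on₃ {p : CStarCompletion E → CStarCompletion E → CStarCompletion E → Prop}
    (a b c : CStarCompletion E)
    (hp : IsClosed {x : CStarCompletion E × CStarCompletion E × CStarCompletion E |
      p x.1 x.2.1 x.2.2})
    (ih : ∀ a b c, p (of a) (of b) (of c)) : p a b c :=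
  Completion.induction_on₃ a b c hp ih

/-- The product on the completion: the continuous extension of the product of `E`. -/
instance : Mul (CStarCompletion E) :=
  ⟨fun x y => (isDenseInducing_of.prodMap isDenseInducing_of).extend
    (fun p : E × E => of (p.1 * p.2)) (x, y)⟩

@[simp] theorem of_mul (x y : E) : of (x * y) = of x * of y :=
  ((isDenseInducing_of.prodMap isDenseInducing_of).extend_eq
    (continuous_of.comp (continuous_mul (M := E))) (x, y)).symm

instance : ContinuousMul (CStarCompletion E) where
  continuous_mul := by
    let m := (AddMonoidHom.mul : E →+ E →+ E).compr₂ (ofHom : E →+ CStarCompletion E)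
    have hm : Continuous fun p : E × E => m p.1 p.2 := continuous_of.comp continuous_mul
    have di : IsDenseInducing (ofHom : E →+ CStarCompletion E) := isDenseInducing_of
    exact (di.extend_Z_bilin di hm :)

instance : NonUnitalNormedRing (CStarCompletion E) where
  __ : NormedAddCommGroup (CStarCompletion E) := inferInstance
  left_distrib a b c := by
    induction a, b, c using induction_on₃ with
    | hp => exact isClosed_eq (by fun_prop) (by fun_prop)
    | ih a b c => rw [← of_add, ← of_mul, ← of_mul, ← of_mul, ← of_add, mul_add]
  right_distrib a b c := by
    induction a, b, c using induction_on₃ with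
    | hp => exact isClosed_eq (by fun_prop) (by fun_prop)
    | ih a b c => rw [← of_add, ← of_mul, ← of_mul, ← of_mul, ← of_add, add_mul]
  zero_mul a := by
    induction a using induction_on with
    | hp => exact isClosed_eq (by fun_prop) (by fun_prop)
    | ih a => rw [← of_zero, ← of_mul, zero_mul]
  mul_zero a := by
    induction a using induction_on with
    | hp => exact isClosed_eq (by fun_prop) (by fun_prop)
    | ih a => rw [← of_zero, ← of_mul, mul_zero]
  mul_assoc a b c := by
    induction a, b, c using induction_on₃ with
    | hp => exact isClosed_eq (by fun_prop) (by fun_prop)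
    | ih a b c => rw [← of_mul, ← of_mul, ← of_mul, ← of_mul, mul_assoc]
  norm_mul_le a b := by
    induction a, b using induction_on₂ with
    | hp => exact isClosed_le (by fun_prop) (by fun_prop)
    | ih a b => rw [← of_mul, norm_of, norm_of, norm_of]; exact norm_mul_le a b

instance [NormedSpace ℂ E] : NormedSpace ℂ (CStarCompletion E) :=
  inferInstanceAs (NormedSpace ℂ (Completion E))

@[simp] theorem of_smul [NormedSpace ℂ E] (c : ℂ) (x : E) : of (c • x) = c • of x :=
  Completion.coe_smul c x

theorem continuous_smul' [NormedSpace ℂ E] (c : ℂ) :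
    Continuous fun a : CStarCompletion E => c • a := continuous_const_smul c

instance [NormedSpace ℂ E] [IsScalarTower ℂ E E] :
    IsScalarTower ℂ (CStarCompletion E) (CStarCompletion E) where
  smul_assoc c a b := by
    change (c • a) * b = c • (a * b)
    induction a, b using induction_on₂ with
    | hp =>
      exact isClosed_eq (((continuous_smul' c).comp continuous_fst).mul continuous_snd)
        ((continuous_smul' c).comp continuous_mul)
    | ih a b => rw [← of_smul, ← of_mul, ← of_mul, ← of_smul, smul_mul_assoc]

instance [NormedSpace ℂ E] [SMulCommClass ℂ E E] :
    SMulCommClass ℂ (CStarCompletion E) (CStarCompletion E) where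
  smul_comm c a b := by
    change c • (a * b) = a * (c • b)
    induction a, b using induction_on₂ with
    | hp =>
      exact isClosed_eq ((continuous_smul' c).comp continuous_mul)
        (continuous_fst.mul ((continuous_smul' c).comp continuous_snd))
    | ih a b => rw [← of_smul, ← of_mul, ← of_mul, ← of_smul, mul_smul_comm]

end Normed

section Star

variable {E : Type*} [NonUnitalNormedRing E] [StarRing E] [CStarRing E]

theorem uniformContinuous_star' : UniformContinuous (star : E → E) :=
  (starNormedAddGroupHom : NormedAddGroupHom E E).uniformContinuous

/-- The involution on the completion: the continuous extension of the involution of `E`. -/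
instance : Star (CStarCompletion E) := ⟨Completion.map (star : E → E)⟩

@[simp] theorem of_star (x : E) : of (star x) = star (of x) :=
  (Completion.map_coe uniformContinuous_star' x).symm

instance : ContinuousStar (CStarCompletion E) := ⟨Completion.continuous_map⟩

instance : StarRing (CStarCompletion E) where
  star_involutive a := by
    induction a using induction_on with
    | hp => exact isClosed_eq (by fun_prop) (by fun_prop)
    | ih a => rw [← of_star, ← of_star, star_star]
  star_mul a b := by
    induction a, b using induction_on₂ with
    | hp => exact isClosed_eq (by fun_prop) (by fun_prop)
    | ih a b => rw [← of_mul, ← of_star, ← of_star, ← of_star, ← of_mul, star_mul]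
  star_add a b := by
    induction a, b using induction_on₂ with
    | hp => exact isClosed_eq (by fun_prop) (by fun_prop)
    | ih a b => rw [← of_add, ← of_star, ← of_star, ← of_star, ← of_add, star_add]

instance : CStarRing (CStarCompletion E) where
  norm_mul_self_le a := by
    induction a using induction_on with
    | hp => exact isClosed_le (by fun_prop) (by fun_prop)
    | ih a => rw [← of_star, ← of_mul, norm_of, norm_of, CStarRing.norm_star_mul_self]

instance [NormedSpace ℂ E] [StarModule ℂ E] : StarModule ℂ (CStarCompletion E) where
  star_smul c a := by
    induction a using induction_on with
    | hp =>
      exact isClosed_eq (continuous_star.comp (continuous_smul' c))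
        ((continuous_smul' (star c)).comp continuous_star)
    | ih a => rw [← of_smul, ← of_star, ← of_star, ← of_smul, star_smul]

instance [NormedSpace ℂ E] [IsScalarTower ℂ E E] [SMulCommClass ℂ E E] [StarModule ℂ E] :
    NonUnitalCStarAlgebra (CStarCompletion E) where

end Star

end CStarCompletion

/-! ### The algebra of finite matrices over a C*-algebra -/

/-- The `ℕ × ℕ` matrices over `A` that are supported in the upper left `n × n` corner for some
`n`. -/
def finMatSubmodule (A : Type*) [NonUnitalCStarAlgebra A] : Submodule ℂ (Matrix ℕ ℕ A) where
  carrier := {x | ∃ n, ∀ i j, n ≤ i ∨ n ≤ j → x i j = 0}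
  zero_mem' := ⟨0, fun _ _ _ => rfl⟩
  add_mem' := by
    rintro x y ⟨n, hn⟩ ⟨m, hm⟩
    refine ⟨max n m, fun i j h => ?_⟩
    rw [Matrix.add_apply, hn i j (by omega), hm i j (by omega), add_zero]
  smul_mem' := by
    rintro c x ⟨n, hn⟩
    exact ⟨n, fun i j h => by rw [Matrix.smul_apply, hn i j h, smul_zero]⟩

/-- The *-algebra `⋃ₙ Mₙ(A)` of finite matrices over `A`, where `Mₙ(A)` sits in `Mₙ₊₁(A)` as the
upper left corner. -/
def FinMat (A : Type*) [NonUnitalCStarAlgebra A] : Type _ := finMatSubmodule A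

namespace FinMat

section Algebra

variable {A : Type*} [NonUnitalCStarAlgebra A]

instance : AddCommGroup (FinMat A) := inferInstanceAs (AddCommGroup (finMatSubmodule A))

instance : Module ℂ (FinMat A) := inferInstanceAs (Module ℂ (finMatSubmodule A))

/-- The entries of a finite matrix. -/
def entry (x : FinMat A) (i j : ℕ) : A := x.1 i j

/-- The finite matrix `x` is supported in the upper left `n × n` corner. -/
def SuppIn (n : ℕ) (x : FinMat A) : Prop := ∀ i j, n ≤ i ∨ n ≤ j → x.entry i j = 0

/-- Build a finite matrix from its entries. -/
def mk (f : ℕ → ℕ → A) (h : ∃ n, ∀ i j, n ≤ i ∨ n ≤ j → f i j = 0) : FinMat A := ⟨f, h⟩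

@[simp] theorem entry_mk (f : ℕ → ℕ → A) (h) (i j : ℕ) : (mk f h).entry i j = f i j := rfl

@[ext] theorem ext {x y : FinMat A} (h : ∀ i j, x.entry i j = y.entry i j) : x = y :=
  Subtype.ext (funext fun i => funext fun j => h i j)

theorem exists_suppIn (x : FinMat A) : ∃ n, SuppIn n x := x.2

theorem SuppIn.mono {n m : ℕ} {x : FinMat A} (hx : SuppIn n x) (h : n ≤ m) : SuppIn m x :=
  fun i j hij => hx i j (by omega)

theorem exists_suppIn₂ (x y : FinMat A) : ∃ n, SuppIn n x ∧ SuppIn n y := by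
  obtain ⟨n, hn⟩ := x.exists_suppIn
  obtain ⟨m, hm⟩ := y.exists_suppIn
  exact ⟨max n m, hn.mono (le_max_left _ _), hm.mono (le_max_right _ _)⟩

@[simp] theorem entry_add (x y : FinMat A) (i j : ℕ) :
    (x + y).entry i j = x.entry i j + y.entry i j := rfl

@[simp] theorem entry_zero (i j : ℕ) : (0 : FinMat A).entry i j = 0 := rfl

@[simp] theorem entry_smul (c : ℂ) (x : FinMat A) (i j : ℕ) :
    (c • x).entry i j = c • x.entry i j := rfl

theorem finsum_eq {n : ℕ} {x : FinMat A} (hx : SuppIn n x) (y : FinMat A) (i j : ℕ) :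
    ∑ᶠ k, x.entry i k * y.entry k j = ∑ k ∈ Finset.range n, x.entry i k * y.entry k j := by
  refine finsum_eq_sum_of_support_subset _ fun k hk => ?_
  by_contra h
  refine hk ?_
  simp only [Finset.coe_range, Set.mem_Iio, not_lt] at h
  simp only [hx i k (Or.inr h), zero_mul]

/-- Matrix multiplication. -/
instance : Mul (FinMat A) :=
  ⟨fun x y => mk (fun i j => ∑ᶠ k, x.entry i k * y.entry k j) (by
    obtain ⟨n, hx, hy⟩ := exists_suppIn₂ x y
    refine ⟨n, fun i j h => ?_⟩
    rw [finsum_eq hx]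
    refine Finset.sum_eq_zero fun k _ => ?_
    rcases h with h | h
    · rw [hx i k (Or.inl h), zero_mul]
    · rw [hy k j (Or.inr h), mul_zero])⟩

theorem entry_mul (x y : FinMat A) (i j : ℕ) :
    (x * y).entry i j = ∑ᶠ k, x.entry i k * y.entry k j := rfl

theorem entry_mul_of_suppIn {n : ℕ} {x : FinMat A} (hx : SuppIn n x) (y : FinMat A) (i j : ℕ) :
    (x * y).entry i j = ∑ k ∈ Finset.range n, x.entry i k * y.entry k j := finsum_eq hx y i j

theorem SuppIn.add {n : ℕ} {x y : FinMat A} (hx : SuppIn n x) (hy : SuppIn n y) :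
    SuppIn n (x + y) := fun i j h => by rw [entry_add, hx i j h, hy i j h, add_zero]

theorem SuppIn.smul {n : ℕ} {x : FinMat A} (c : ℂ) (hx : SuppIn n x) :
    SuppIn n (c • x) := fun i j h => by rw [entry_smul, hx i j h, smul_zero]

theorem SuppIn.mul {n : ℕ} {x y : FinMat A} (hx : SuppIn n x) (hy : SuppIn n y) :
    SuppIn n (x * y) := fun i j h => by
  rw [entry_mul_of_suppIn hx]
  refine Finset.sum_eq_zero fun k _ => ?_
  rcases h with h | h
  · rw [hx i k (Or.inl h), zero_mul]
  · rw [hy k j (Or.inr h), mul_zero]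

/-- The adjoint of a matrix. -/
instance : Star (FinMat A) :=
  ⟨fun x => mk (fun i j => star (x.entry j i)) (by
    obtain ⟨n, hx⟩ := x.exists_suppIn
    exact ⟨n, fun i j h => by rw [hx j i h.symm, star_zero]⟩)⟩

@[simp] theorem entry_star (x : FinMat A) (i j : ℕ) : (star x).entry i j = star (x.entry j i) := rfl

theorem SuppIn.star {n : ℕ} {x : FinMat A} (hx : SuppIn n x) : SuppIn n (star x) :=
  fun i j h => by rw [entry_star, hx j i h.symm, star_zero]

instance : NonUnitalRing (FinMat A) where
  __ : AddCommGroup (FinMat A) := inferInstance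
  left_distrib x y z := by
    obtain ⟨n, hx⟩ := x.exists_suppIn
    ext i j
    simp only [entry_mul_of_suppIn hx, entry_add, mul_add, Finset.sum_add_distrib]
  right_distrib x y z := by
    obtain ⟨n, hx, hy⟩ := exists_suppIn₂ x y
    ext i j
    simp only [entry_mul_of_suppIn hx, entry_mul_of_suppIn hy, entry_mul_of_suppIn (hx.add hy),
      entry_add, add_mul, Finset.sum_add_distrib]
  zero_mul x := by
    have h0 : SuppIn 0 (0 : FinMat A) := fun _ _ _ => rfl
    ext i j
    simp only [entry_mul_of_suppIn h0, Finset.range_zero, Finset.sum_empty, entry_zero]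
  mul_zero x := by
    obtain ⟨n, hx⟩ := x.exists_suppIn
    ext i j
    simp only [entry_mul_of_suppIn hx, entry_zero, mul_zero, Finset.sum_const_zero]
  mul_assoc x y z := by
    obtain ⟨n, hx, hy⟩ := exists_suppIn₂ x y
    ext i j
    simp only [entry_mul_of_suppIn hx, entry_mul_of_suppIn hy, entry_mul_of_suppIn (hx.mul hy),
      Finset.sum_mul, Finset.mul_sum, mul_assoc]
    exact Finset.sum_comm

instance : StarRing (FinMat A) where
  star_involutive x := by ext i j; simp
  star_mul x y := by
    obtain ⟨n, hx, hy⟩ := exists_suppIn₂ x y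
    ext i j
    simp only [entry_star, entry_mul_of_suppIn hx, entry_mul_of_suppIn hy.star, star_sum, star_mul]
  star_add x y := by ext i j; simp

instance : IsScalarTower ℂ (FinMat A) (FinMat A) where
  smul_assoc c x y := by
    obtain ⟨n, hx⟩ := x.exists_suppIn
    ext i j
    simp only [smul_eq_mul, entry_smul, entry_mul_of_suppIn hx, entry_mul_of_suppIn (hx.smul c),
      Finset.smul_sum, smul_mul_assoc]

instance : SMulCommClass ℂ (FinMat A) (FinMat A) where
  smul_comm c x y := by
    obtain ⟨n, hx⟩ := x.exists_suppIn
    ext i j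
    simp only [smul_eq_mul, entry_smul, entry_mul_of_suppIn hx,
      Finset.smul_sum, mul_smul_comm]

instance : StarModule ℂ (FinMat A) where
  star_smul c x := by ext i j; simp

end Algebra

/-! #### The C*-norm of finite matrices -/

section Norm

attribute [local instance] CStarAlgebra.spectralOrder CStarAlgebra.spectralOrderedRing

variable {A : Type*} [NonUnitalCStarAlgebra A]

/-- The upper left `n × n` corner of a finite matrix, as an element of the C*-algebra `Mₙ(A)`. -/
def corner (n : ℕ) (x : FinMat A) : CStarMatrix (Fin n) (Fin n) A :=
  CStarMatrix.ofMatrix (Matrix.of fun i j => x.entry i j)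

@[simp] theorem corner_apply (n : ℕ) (x : FinMat A) (i j : Fin n) :
    corner n x i j = x.entry i j := rfl

/-- An `n × n` matrix, extended by zero. -/
def lift (n : ℕ) (p : CStarMatrix (Fin n) (Fin n) A) : FinMat A :=
  mk (fun i j => if h : i < n ∧ j < n then p ⟨i, h.1⟩ ⟨j, h.2⟩ else 0)
    ⟨n, fun i j h => dif_neg (by omega)⟩

theorem entry_lift (n : ℕ) (p : CStarMatrix (Fin n) (Fin n) A) (i j : ℕ) :
    (lift n p).entry i j = if h : i < n ∧ j < n then p ⟨i, h.1⟩ ⟨j, h.2⟩ else 0 := rfl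

theorem suppIn_lift (n : ℕ) (p : CStarMatrix (Fin n) (Fin n) A) : SuppIn n (lift n p) :=
  fun _ _ h => dif_neg (by omega)

@[simp] theorem corner_lift (n : ℕ) (p : CStarMatrix (Fin n) (Fin n) A) :
    corner n (lift n p) = p := by
  ext i j
  simp [entry_lift]

theorem lift_corner {n : ℕ} {x : FinMat A} (hx : SuppIn n x) : lift n (corner n x) = x := by
  ext i j
  rw [entry_lift]
  split_ifs with h
  · rfl
  · exact (hx i j (by omega)).symm

theorem corner_mul {n : ℕ} {x : FinMat A} (hx : SuppIn n x) (y : FinMat A) :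
    corner n (x * y) = corner n x * corner n y := by
  ext i j
  rw [corner_apply, entry_mul_of_suppIn hx, CStarMatrix.mul_apply, Finset.sum_range]
  rfl

theorem corner_add (n : ℕ) (x y : FinMat A) : corner n (x + y) = corner n x + corner n y := rfl

theorem corner_smul (n : ℕ) (c : ℂ) (x : FinMat A) : corner n (c • x) = c • corner n x := rfl

theorem corner_star (n : ℕ) (x : FinMat A) : corner n (star x) = star (corner n x) := rfl

theorem corner_zero (n : ℕ) : corner n (0 : FinMat A) = 0 := rfl

theorem lift_add (n : ℕ) (p q : CStarMatrix (Fin n) (Fin n) A) :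
    lift n (p + q) = lift n p + lift n q := by
  ext i j
  simp only [entry_add, entry_lift]
  split_ifs <;> simp

theorem lift_smul (n : ℕ) (c : ℂ) (p : CStarMatrix (Fin n) (Fin n) A) :
    lift n (c • p) = c • lift n p := by
  ext i j
  simp only [entry_smul, entry_lift]
  split_ifs <;> simp

theorem lift_mul (n : ℕ) (p q : CStarMatrix (Fin n) (Fin n) A) :
    lift n (p * q) = lift n p * lift n q := by
  rw [← lift_corner ((suppIn_lift n p).mul (suppIn_lift n q)), corner_mul (suppIn_lift n p),
    corner_lift, corner_lift]

theorem lift_star (n : ℕ) (p : CStarMatrix (Fin n) (Fin n) A) :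
    lift n (star p) = star (lift n p) := by
  rw [← lift_corner (suppIn_lift n p).star, corner_star, corner_lift]

/-- The embedding of `Mₙ(A)` into `Mₘ(A)`, for `n ≤ m`. -/
def embed {n m : ℕ} (h : n ≤ m) :
    CStarMatrix (Fin n) (Fin n) A →⋆ₙₐ[ℂ] CStarMatrix (Fin m) (Fin m) A where
  toFun p := corner m (lift n p)
  map_smul' c p := by rw [lift_smul, corner_smul]; rfl
  map_zero' := by rw [← corner_zero n, lift_corner (fun _ _ _ => rfl), corner_zero]
  map_add' p q := by rw [lift_add, corner_add]
  map_mul' p q := by rw [lift_mul, corner_mul ((suppIn_lift n p).mono h)]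
  map_star' p := by rw [lift_star, corner_star]

theorem norm_corner_lift {n m : ℕ} (h : n ≤ m) (p : CStarMatrix (Fin n) (Fin n) A) :
    ‖corner m (lift n p)‖ = ‖p‖ := by
  refine NonUnitalStarAlgHom.norm_map (embed h) (fun p q hpq => ?_) p
  have h2 := congrArg (lift m) hpq
  change lift m (corner m (lift n p)) = lift m (corner m (lift n q)) at h2
  rw [lift_corner ((suppIn_lift n p).mono h), lift_corner ((suppIn_lift n q).mono h)] at h2
  rw [← corner_lift n p, h2, corner_lift]

/-- The norm of a finite matrix `x` is the norm of `x` in the C*-algebra `Mₙ(A)`, for any `n` such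
that `x` is supported in the upper left `n × n` corner. -/
instance : Norm (FinMat A) := ⟨fun x => ‖corner x.exists_suppIn.choose x‖⟩

theorem norm_eq {n : ℕ} {x : FinMat A} (hx : SuppIn n x) : ‖x‖ = ‖corner n x‖ := by
  have key : ∀ {n m : ℕ}, n ≤ m → SuppIn n x → ‖corner m x‖ = ‖corner n x‖ := by
    intro n m h hx
    have := norm_corner_lift h (corner n x)
    rwa [lift_corner hx] at this
  have h0 := x.exists_suppIn.choose_spec
  change ‖corner x.exists_suppIn.choose x‖ = _
  rcases le_total n x.exists_suppIn.choose with h | h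
  · exact key h hx
  · exact (key h h0).symm

theorem normCore : NormedSpace.Core ℂ (FinMat A) where
  norm_nonneg x := norm_nonneg (corner x.exists_suppIn.choose x)
  norm_smul c x := by
    obtain ⟨n, hx⟩ := x.exists_suppIn
    rw [norm_eq hx, norm_eq (hx.smul c), corner_smul, norm_smul]
  norm_triangle x y := by
    obtain ⟨n, hx, hy⟩ := exists_suppIn₂ x y
    rw [norm_eq hx, norm_eq hy, norm_eq (hx.add hy), corner_add]
    exact norm_add_le _ _
  norm_eq_zero_iff x := by
    obtain ⟨n, hx⟩ := x.exists_suppIn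
    rw [norm_eq hx, norm_eq_zero]
    constructor
    · intro h
      rw [← lift_corner hx, h, ← corner_zero n, lift_corner (fun _ _ _ => rfl)]
    · rintro rfl
      rfl

instance : NormedAddCommGroup (FinMat A) := NormedAddCommGroup.ofCore normCore

instance : NormedSpace ℂ (FinMat A) := NormedSpace.ofCore normCore

instance : NonUnitalNormedRing (FinMat A) where
  __ : NormedAddCommGroup (FinMat A) := inferInstance
  __ : NonUnitalRing (FinMat A) := inferInstance
  norm_mul_le x y := by
    obtain ⟨n, hx, hy⟩ := exists_suppIn₂ x y
    rw [norm_eq hx, norm_eq hy, norm_eq (hx.mul hy), corner_mul hx]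
    exact norm_mul_le _ _

instance : CStarRing (FinMat A) where
  norm_mul_self_le x := by
    obtain ⟨n, hx⟩ := x.exists_suppIn
    rw [norm_eq hx, norm_eq (hx.star.mul hx), corner_mul hx.star, corner_star,
      CStarRing.norm_star_mul_self]

/-! #### Direct sums of finite matrices -/

/-- The direct sum `diag(x, y)`, a matrix indexed by `ℕ ⊕ ℕ`, regarded as a matrix indexed by `ℕ`
via the bijection `ℕ ⊕ ℕ ≃ ℕ` that sends the two copies of `ℕ` onto the even and the odd
numbers. -/
def diag (x y : FinMat A) : FinMat A :=
  mk (Matrix.reindex Equiv.natSumNatEquivNat Equiv.natSumNatEquivNat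
    (Matrix.fromBlocks (Matrix.of x.entry) 0 0 (Matrix.of y.entry))) (by
    obtain ⟨n, hx, hy⟩ := exists_suppIn₂ x y
    refine ⟨2 * n, fun i j h => ?_⟩
    obtain ⟨i, rfl⟩ := Equiv.natSumNatEquivNat.surjective i
    obtain ⟨j, rfl⟩ := Equiv.natSumNatEquivNat.surjective j
    rw [Matrix.reindex_apply, Matrix.submatrix_apply, Equiv.symm_apply_apply,
      Equiv.symm_apply_apply]
    rcases i with i | i <;> rcases j with j | j <;>
      simp only [Equiv.natSumNatEquivNat_apply, Sum.elim_inl, Sum.elim_inr] at h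
    · exact hx i j (by omega)
    · rfl
    · rfl
    · exact hy i j (by omega))

theorem entry_diag (x y : FinMat A) (s t : ℕ ⊕ ℕ) :
    (diag x y).entry (Equiv.natSumNatEquivNat s) (Equiv.natSumNatEquivNat t) =
      Matrix.fromBlocks (Matrix.of x.entry) 0 0 (Matrix.of y.entry) s t := by
  change Matrix.reindex Equiv.natSumNatEquivNat Equiv.natSumNatEquivNat _ _ _ = _
  rw [Matrix.reindex_apply, Matrix.submatrix_apply, Equiv.symm_apply_apply, Equiv.symm_apply_apply]

theorem ext_sum {x y : FinMat A} (h : ∀ s t : ℕ ⊕ ℕ,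
    x.entry (Equiv.natSumNatEquivNat s) (Equiv.natSumNatEquivNat t) =
    y.entry (Equiv.natSumNatEquivNat s) (Equiv.natSumNatEquivNat t)) : x = y := by
  ext i j
  obtain ⟨i, rfl⟩ := Equiv.natSumNatEquivNat.surjective i
  obtain ⟨j, rfl⟩ := Equiv.natSumNatEquivNat.surjective j
  exact h i j

theorem suppIn_diag {n : ℕ} {x y : FinMat A} (hx : SuppIn n x) (hy : SuppIn n y) :
    SuppIn (2 * n) (diag x y) := by
  intro i j h
  obtain ⟨i, rfl⟩ := Equiv.natSumNatEquivNat.surjective i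
  obtain ⟨j, rfl⟩ := Equiv.natSumNatEquivNat.surjective j
  rw [entry_diag]
  rcases i with i | i <;> rcases j with j | j <;>
    simp only [Equiv.natSumNatEquivNat_apply, Sum.elim_inl, Sum.elim_inr] at h
  · exact hx i j (by omega)
  · rfl
  · rfl
  · exact hy i j (by omega)

theorem diag_add (x y x' y' : FinMat A) :
    diag (x + x') (y + y') = diag x y + diag x' y' := by
  refine ext_sum fun s t => ?_
  rw [entry_add, entry_diag, entry_diag, entry_diag]
  rcases s with s | s <;> rcases t with t | t <;> simp

theorem diag_smul (c : ℂ) (x y : FinMat A) : diag (c • x) (c • y) = c • diag x y := by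
  refine ext_sum fun s t => ?_
  rw [entry_smul, entry_diag, entry_diag]
  rcases s with s | s <;> rcases t with t | t <;> simp

theorem diag_star (x y : FinMat A) : diag (star x) (star y) = star (diag x y) := by
  refine ext_sum fun s t => ?_
  rw [entry_star, entry_diag, entry_diag]
  rcases s with s | s <;> rcases t with t | t <;> simp

theorem diag_zero : diag (0 : FinMat A) 0 = 0 := by
  refine ext_sum fun s t => ?_
  rw [entry_diag]
  rcases s with s | s <;> rcases t with t | t <;> simp

theorem sum_range_two_mul (n : ℕ) (f : ℕ → A) : ∑ k ∈ Finset.range (2 * n), f k =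
    ∑ k ∈ Finset.range n, f (Equiv.natSumNatEquivNat (Sum.inl k)) +
      ∑ k ∈ Finset.range n, f (Equiv.natSumNatEquivNat (Sum.inr k)) := by
  induction n with
  | zero => simp
  | succ n ih =>
    rw [show 2 * (n + 1) = 2 * n + 1 + 1 by ring, Finset.sum_range_succ, Finset.sum_range_succ,
      Finset.sum_range_succ, Finset.sum_range_succ, ih]
    simp only [Equiv.natSumNatEquivNat_apply, Sum.elim_inl, Sum.elim_inr]
    abel

theorem diag_mul (x y x' y' : FinMat A) :
    diag (x * x') (y * y') = diag x y * diag x' y' := by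
  obtain ⟨n, hx, hy⟩ := exists_suppIn₂ x y
  refine ext_sum fun s t => ?_
  rw [entry_mul_of_suppIn (suppIn_diag hx hy), sum_range_two_mul]
  simp only [entry_diag]
  rcases s with s | s <;> rcases t with t | t <;>
    simp [entry_mul_of_suppIn hx, entry_mul_of_suppIn hy]

/-- The direct sum `Mₙ(A) × Mₙ(A) → M₂ₙ(A)` as a *-homomorphism. -/
def diagHom (n : ℕ) :
    CStarMatrix (Fin n) (Fin n) A × CStarMatrix (Fin n) (Fin n) A →⋆ₙₐ[ℂ]
      CStarMatrix (Fin (2 * n)) (Fin (2 * n)) A where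
  toFun p := corner (2 * n) (diag (lift n p.1) (lift n p.2))
  map_smul' c p := by
    simp only [Prod.smul_fst, Prod.smul_snd, lift_smul, diag_smul, corner_smul]; rfl
  map_zero' := by
    have : lift n (0 : CStarMatrix (Fin n) (Fin n) A) = 0 := by
      rw [← corner_zero n, lift_corner (fun _ _ _ => rfl)]
    simp only [Prod.fst_zero, Prod.snd_zero, this, diag_zero, corner_zero]
  map_add' p q := by simp only [Prod.fst_add, Prod.snd_add, lift_add, diag_add, corner_add]
  map_mul' p q := by
    simp only [Prod.fst_mul, Prod.snd_mul, lift_mul, diag_mul]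
    rw [corner_mul (suppIn_diag (suppIn_lift n _) (suppIn_lift n _))]
  map_star' p := by simp only [Prod.fst_star, Prod.snd_star, lift_star, diag_star, corner_star]

theorem norm_diag_le (x y : FinMat A) : ‖diag x y‖ ≤ ‖(x, y)‖ := by
  obtain ⟨n, hx, hy⟩ := exists_suppIn₂ x y
  have h := NonUnitalStarAlgHom.norm_apply_le (diagHom (A := A) n) (corner n x, corner n y)
  change ‖corner (2 * n) (diag (lift n (corner n x)) (lift n (corner n y)))‖ ≤ _ at h
  rw [lift_corner hx, lift_corner hy, ← norm_eq (suppIn_diag hx hy), Prod.norm_mk,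
    ← norm_eq hx, ← norm_eq hy] at h
  exact h

theorem uniformContinuous₂_diag : UniformContinuous₂ (diag : FinMat A → FinMat A → FinMat A) := by
  let f : FinMat A × FinMat A →+ FinMat A :=
    { toFun := fun p => diag p.1 p.2
      map_zero' := diag_zero
      map_add' := fun p q => diag_add p.1 p.2 q.1 q.2 }
  exact AddMonoidHomClass.uniformContinuous_of_bound f 1
    (fun p => by rw [one_mul]; exact norm_diag_le p.1 p.2)

end Norm

end FinMat

/-! ### The stabilization of a C*-algebra -/

/-- The stabilization `A ⊗ 𝕂` of a C*-algebra `A`, where `𝕂` is the C*-algebra of compact operators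
on a separable, infinite-dimensional Hilbert space: the completion of `⋃ₙ Mₙ(A)`. -/
abbrev Stabilization (A : Type*) [NonUnitalCStarAlgebra A] : Type _ := CStarCompletion (FinMat A)

namespace Stabilization

variable {A : Type*} [NonUnitalCStarAlgebra A]

open CStarCompletion

instance : NonUnitalCStarAlgebra (Stabilization A) := inferInstance

/-- The usual order of the C*-algebra `A ⊗ 𝕂`: `a ≤ b` if and only if `b - a` is positive. -/
instance : PartialOrder (Stabilization A) := CStarAlgebra.spectralOrder _

instance : StarOrderedRing (Stabilization A) := CStarAlgebra.spectralOrderedRing _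

/-- The direct sum `diag(a, b)` in `(A ⊗ 𝕂) ⊗ M₂ ≅ A ⊗ 𝕂`, the continuous extension of the direct
sum of finite matrices. -/
def diag (a b : Stabilization A) : Stabilization A := Completion.map₂ FinMat.diag a b

theorem continuous_diag :
    Continuous fun p : Stabilization A × Stabilization A => diag p.1 p.2 :=
  Completion.continuous_map₂ continuous_fst continuous_snd

@[simp] theorem diag_of (x y : FinMat A) : diag (of x) (of y) = of (FinMat.diag x y) :=
  Completion.map₂_coe_coe x y _ FinMat.uniformContinuous₂_diag

theorem diag_mul (a b a' b' : Stabilization A) :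
    diag (a * a') (b * b') = diag a b * diag a' b' := by
  have hc : ∀ {f g : (Stabilization A × Stabilization A) × (Stabilization A × Stabilization A) →
      Stabilization A}, Continuous f → Continuous g → Continuous fun p => diag (f p) (g p) :=
    fun hf hg => continuous_diag.comp (hf.prodMk hg)
  have h : IsClosed {p : (Stabilization A × Stabilization A) × (Stabilization A × Stabilization A) |
      diag (p.1.1 * p.2.1) (p.1.2 * p.2.2) = diag p.1.1 p.1.2 * diag p.2.1 p.2.2} :=
    isClosed_eq (hc (by fun_prop) (by fun_prop))
      ((hc (by fun_prop) (by fun_prop)).mul (hc (by fun_prop) (by fun_prop)))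
  have hd : DenseRange (fun p : (FinMat A × FinMat A) × (FinMat A × FinMat A) =>
      (((of p.1.1, of p.1.2), (of p.2.1, of p.2.2)) :
        (Stabilization A × Stabilization A) × (Stabilization A × Stabilization A))) := by
    have h1 : DenseRange (of : FinMat A → Stabilization A) := isDenseInducing_of.dense
    exact (h1.prodMap h1).prodMap (h1.prodMap h1)
  refine hd.induction_on (p := fun p => diag (p.1.1 * p.2.1) (p.1.2 * p.2.2) =
    diag p.1.1 p.1.2 * diag p.2.1 p.2.2) ((a, b), (a', b')) h ?_
  rintro ⟨⟨x, y⟩, ⟨x', y'⟩⟩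
  simp only [diag_of, ← of_mul, FinMat.diag_mul]

theorem diag_star (a b : Stabilization A) : diag (star a) (star b) = star (diag a b) := by
  induction a, b using induction_on₂ with
  | hp =>
    exact isClosed_eq (continuous_diag.comp ((continuous_fst.star).prodMk continuous_snd.star))
      continuous_diag.star
  | ih a b => simp only [diag_of, ← of_star, FinMat.diag_star]

theorem diag_nonneg {a b : Stabilization A} (ha : 0 ≤ a) (hb : 0 ≤ b) : 0 ≤ diag a b := by
  obtain ⟨x, rfl⟩ := CStarAlgebra.nonneg_iff_eq_star_mul_self.mp ha
  obtain ⟨y, rfl⟩ := CStarAlgebra.nonneg_iff_eq_star_mul_self.mp hb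
  rw [diag_mul, diag_star]
  exact star_mul_self_nonneg _

end Stabilization

/-! ### Cuntz comparison and the Cuntz semigroup -/

/-- Cuntz subequivalence `a ≾ b`: there is a sequence `(rₙ)` with `rₙ b rₙ* → a`. -/
def CuntzLE {B : Type*} [NonUnitalCStarAlgebra B] (a b : B) : Prop :=
  ∃ r : ℕ → B, Tendsto (fun n => r n * b * star (r n)) atTop (𝓝 a)

theorem cuntzLE_iff {B : Type*} [NonUnitalCStarAlgebra B] {a b : B} :
    CuntzLE a b ↔ ∀ ε > 0, ∃ r : B, dist (r * b * star r) a < ε := by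
  constructor
  · rintro ⟨r, hr⟩ ε hε
    obtain ⟨n, hn⟩ := (Metric.tendsto_nhds.mp hr ε hε).exists
    exact ⟨r n, hn⟩
  · intro h
    choose r hr using fun n : ℕ => h (1 / ((n : ℝ) + 1)) Nat.one_div_pos_of_nat
    refine ⟨r, tendsto_iff_dist_tendsto_zero.mpr ?_⟩
    exact squeeze_zero (fun _ => dist_nonneg) (fun n => (hr n).le)
      tendsto_one_div_add_atTop_nhds_zero_nat

theorem CuntzLE.refl {B : Type*} [NonUnitalCStarAlgebra B] (a : B) : CuntzLE a a := by
  let _ := CStarAlgebra.spectralOrder B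
  let _ := CStarAlgebra.spectralOrderedRing B
  have hu := CStarAlgebra.increasingApproximateUnit B
  have := hu.neBot
  rw [cuntzLE_iff]
  intro ε hε
  have h1 := Metric.tendsto_nhds.mp (hu.tendsto_mul_right a) (ε / 2) (half_pos hε)
  have h2 := Metric.tendsto_nhds.mp (hu.tendsto_mul_left a) (ε / 2) (half_pos hε)
  obtain ⟨e, h1, h2, h3, h4⟩ :=
    (h1.and (h2.and (hu.eventually_norm.and hu.eventually_nonneg))).exists
  refine ⟨e, ?_⟩
  rw [dist_eq_norm] at h1 h2 ⊢
  rw [(IsSelfAdjoint.of_nonneg h4).star_eq]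
  calc ‖e * a * e - a‖ = ‖e * (a * e - a) + (e * a - a)‖ := by
        congr 1; rw [mul_sub, mul_assoc]; abel
    _ ≤ ‖e‖ * ‖a * e - a‖ + ‖e * a - a‖ :=
        (norm_add_le _ _).trans (add_le_add (norm_mul_le _ _) le_rfl)
    _ ≤ 1 * ‖a * e - a‖ + ‖e * a - a‖ := by gcongr
    _ < ε := by linarith

theorem CuntzLE.trans {B : Type*} [NonUnitalCStarAlgebra B] {a b c : B}
    (hab : CuntzLE a b) (hbc : CuntzLE b c) : CuntzLE a c := by
  rw [cuntzLE_iff] at hab ⊢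
  obtain ⟨s, hs⟩ := hbc
  intro ε hε
  obtain ⟨r, hr⟩ := hab (ε / 2) (half_pos hε)
  have h : Tendsto (fun n => (r * s n) * c * star (r * s n)) atTop (𝓝 (r * b * star r)) := by
    have := (hs.const_mul r).mul_const (star r)
    simpa only [star_mul, mul_assoc] using this
  obtain ⟨n, hn⟩ := (Metric.tendsto_nhds.mp h (ε / 2) (half_pos hε)).exists
  refine ⟨r * s n, (dist_triangle _ (r * b * star r) _).trans_lt ?_⟩
  linarith

theorem CuntzLE.diag {A : Type*} [NonUnitalCStarAlgebra A] {a b a' b' : Stabilization A}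
    (ha : CuntzLE a a') (hb : CuntzLE b b') :
    CuntzLE (Stabilization.diag a b) (Stabilization.diag a' b') := by
  obtain ⟨r, hr⟩ := ha
  obtain ⟨s, hs⟩ := hb
  refine ⟨fun n => Stabilization.diag (r n) (s n), ?_⟩
  have h := (Stabilization.continuous_diag.tendsto (a, b)).comp (hr.prodMk_nhds hs)
  refine h.congr fun n => ?_
  simp only [Function.comp, Stabilization.diag_mul, Stabilization.diag_star]

/-- The positive cone `(A ⊗ 𝕂)₊`. -/
def StablePos (A : Type*) [NonUnitalCStarAlgebra A] : Type _ := {a : Stabilization A // 0 ≤ a}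

/-- The positive elements of `A ⊗ 𝕂`, preordered by Cuntz subequivalence. -/
instance (A : Type*) [NonUnitalCStarAlgebra A] : Preorder (StablePos A) where
  le a b := CuntzLE a.1 b.1
  le_refl a := CuntzLE.refl a.1
  le_trans _ _ _ := CuntzLE.trans

/-- The Cuntz semigroup `Cu(A)`: the positive elements of `A ⊗ 𝕂` modulo Cuntz equivalence (`a ≾ b`
and `b ≾ a`), partially ordered by Cuntz subequivalence. -/
def Cu (A : Type*) [NonUnitalCStarAlgebra A] : Type _ :=
  Antisymmetrization (StablePos A) (· ≤ ·)

namespace Cu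

variable {A : Type*} [NonUnitalCStarAlgebra A]

instance : PartialOrder (Cu A) :=
  inferInstanceAs (PartialOrder (Antisymmetrization (StablePos A) (· ≤ ·)))

/-- The class `[a]` in `Cu(A)` of a positive element `a` of `A ⊗ 𝕂`. -/
def mk (a : Stabilization A) (ha : 0 ≤ a) : Cu A :=
  toAntisymmetrization (· ≤ ·) (⟨a, ha⟩ : StablePos A)

/-- Addition in `Cu(A)`: `[a] + [b] = [diag(a, b)]`. -/
instance : Add (Cu A) :=
  ⟨Quotient.map₂ (fun a b : StablePos A =>
      (⟨Stabilization.diag a.1 b.1, Stabilization.diag_nonneg a.2 b.2⟩ : StablePos A))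
    (fun _ _ h₁ _ _ h₂ => ⟨CuntzLE.diag h₁.1 h₂.1, CuntzLE.diag h₁.2 h₂.2⟩)⟩

theorem mk_le_mk {a b : Stabilization A} {ha : 0 ≤ a} {hb : 0 ≤ b} :
    mk a ha ≤ mk b hb ↔ CuntzLE a b := Iff.rfl

theorem mk_add_mk {a b : Stabilization A} (ha : 0 ≤ a) (hb : 0 ≤ b) :
    mk a ha + mk b hb = mk (Stabilization.diag a b) (Stabilization.diag_nonneg ha hb) := rfl

end Cu

/-! ### Strengthened almost Riesz decomposition, and stable rank one -/

/-- The (sequential) way-below relation `a ≪ b` in a partially ordered set: whenever an increasing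
sequence `(sₙ)` has a supremum and `b ≤ sup sₙ`, then `a ≤ s_N` for some `N`. -/
def WayBelow {S : Type*} [PartialOrder S] (a b : S) : Prop :=
  ∀ (s : ℕ → S) (t : S), Monotone s → IsLUB (Set.range s) t → b ≤ t → ∃ N, a ≤ s N

/-- Strengthened almost Riesz decomposition: if `a ≤ b + c`, `x' ≪ x ≤ a, b` and `y' ≪ y ≤ a, c`,
then there are `e`, `f` with `a ≤ e + f`, `x' ≪ e ≤ a, b` and `y' ≪ f ≤ a, c`. -/
def StrengthenedAlmostRiesz (S : Type*) [PartialOrder S] [Add S] : Prop :=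
  ∀ a b c x' x y' y : S, a ≤ b + c →
    WayBelow x' x → x ≤ a → x ≤ b →
    WayBelow y' y → y ≤ a → y ≤ c →
    ∃ e f : S, a ≤ e + f ∧
      (WayBelow x' e ∧ e ≤ a ∧ e ≤ b) ∧
      (WayBelow y' f ∧ f ≤ a ∧ f ≤ c)

/-- The element `e` is a multiplicative unit of `A`. -/
def IsUnitElement {A : Type*} [NonUnitalCStarAlgebra A] (e : A) : Prop :=
  ∀ a : A, e * a = a ∧ a * e = a

/-- Stable rank one: if `A` has a unit, then the invertible elements of `A` are dense in `A`; if `A`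
has no unit, then the invertible elements of the minimal unitization of `A` are dense in it. -/
structure HasStableRankOne (A : Type*) [NonUnitalCStarAlgebra A] : Prop where
  unital : ∀ e : A, IsUnitElement e → Dense {x : A | ∃ y : A, x * y = e ∧ y * x = e}
  nonunital : (¬ ∃ e : A, IsUnitElement e) → Dense {x : Unitization ℂ A | IsUnit x}

end

/-! Write B for A ⊗ 𝕂. Stable rank one enters through `DenseQuasiregular`, the density of the y for
which 1 + y is invertible in the unitization. Schur complements pass this property from A to B. It
implies a rigidity statement, `DenseQuasiregular.exists_unitary_near`: if z, z' lie in the closed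
right ideal of d ≥ 0 and z*z ≈ z'*z', then z ≈ wz' for a unitary w of the unitization that preserves
the ideal. Such a w is the unitary part of an invertible element near zz'*.

Rigidity is used twice. Correcting successive approximations by unitaries turns a ≾ d into an exact
equation a = z*z with z in the closed right ideal of d
(`DenseQuasiregular.exists_star_mul_self_eq`). For d = diag(b, c) the rows of z split into a b-part
u and a c-part v, so a = u*u + v*v, and e = u*u lies below a and below b. Moreover, if x ≾ a, b,
then z can first be rotated by a unitary so that the part of z that carries x falls into the b-rows.
Then v is small on that part, and e lies almost above x (`exists_cuntzLE_diag`). Applying this to b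
and afterwards to c gives (O6+).

For C(S²), let p be the Bott projection, 1 the trivial rank one projection, x the function (1 - z)/2
(z being the height) and c = x' = ((1 - z)/2 - 1/2)₊³. Then p ≾ 1 ⊕ c, because p has positive trace
against diag(1, c) at each point; also x ≾ p, 1 and x' ≪ x. With y = y' = 0, (O6+) would yield e ≾
p, 1 and f ≾ c ≾ e with p ≾ e ⊕ f ≾ e ⊕ e. The last relation prevents e from vanishing at any point.
As e ≾ 1 and e ≾ p, one obtains a nowhere vanishing section of the Bott bundle. Its clutching
function over the equator is the identity of the circle, which would then extend to a nowhere
vanishing function on the disc, contradicting the winding number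
(`exists_circle_ne_of_forall_ne_zero`). -/

noncomputable section

open Filter Topology UniformSpace

/-! ### Multiplication of elements of B by elements of its unitization. -/

namespace Unitization

variable {B : Type*} [NonUnitalCStarAlgebra B]

/-- The action of the unitization on `B` by left multiplication. -/
def lmul (m : Unitization ℂ B) (x : B) : B := m.fst • x + m.snd * x

theorem inr_lmul (m : Unitization ℂ B) (x : B) : ((lmul m x : B) : Unitization ℂ B) = m * x := by
  induction m with
  | inl_add_inr c y =>
    simp [lmul, add_mul, Unitization.inl_mul_inr]

end Unitization

open Unitization (lmul inr_lmul)

/-! ### Cuntz comparison in a C*-algebra -/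

section Cuntz

variable {B : Type*} [NonUnitalCStarAlgebra B]

theorem CuntzLE.of_forall_dist {a b : B}
    (h : ∀ ε > 0, ∃ a' : B, dist a' a < ε ∧ CuntzLE a' b) : CuntzLE a b := by
  rw [cuntzLE_iff]
  intro ε hε
  obtain ⟨a', h1, h2⟩ := h (ε / 2) (half_pos hε)
  obtain ⟨r, hr⟩ := cuntzLE_iff.mp h2 (ε / 2) (half_pos hε)
  exact ⟨r, (dist_triangle _ a' _).trans_lt (by linarith)⟩

theorem CuntzLE.conj (r b : B) : CuntzLE (r * b * star r) b :=
  ⟨fun _ => r, tendsto_const_nhds⟩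

theorem CuntzLE.conj' (r b : B) : CuntzLE (star r * b * r) b := by
  simpa using CuntzLE.conj (star r) b

/-- Coefficients from the unitization are harmless: if e b e* ≈ b with e in B, then r e lies in B
because B is an ideal, and (re) b (re)* ≈ r b r*. -/
theorem CuntzLE.unitization_conj {a b : B} (r : Unitization ℂ B)
    (h : (a : Unitization ℂ B) = r * b * star r) : CuntzLE a b := by
  rw [cuntzLE_iff]
  intro ε hε
  obtain ⟨e, he⟩ := cuntzLE_iff.mp (CuntzLE.refl b) (ε / (‖r‖ ^ 2 + 1)) (by positivity)
  refine ⟨lmul r e, ?_⟩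
  rw [dist_eq_norm] at he ⊢
  rw [← Unitization.norm_inr (𝕜 := ℂ)]
  have : (((lmul r e * b * star (lmul r e) - a : B)) : Unitization ℂ B) =
      r * ((e * b * star e - b : B) : Unitization ℂ B) * star r := by
    rw [Unitization.inr_sub, h, Unitization.inr_sub]
    simp only [Unitization.inr_mul, Unitization.inr_star, inr_lmul, star_mul, mul_sub, sub_mul,
      mul_assoc]
  rw [this]
  calc _ ≤ ‖r‖ * ‖e * b * star e - b‖ * ‖r‖ := by
        refine (norm_mul_le _ _).trans ?_
        rw [norm_star]
        gcongr
        refine (norm_mul_le _ _).trans ?_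
        rw [Unitization.norm_inr]
    _ ≤ ‖r‖ * (ε / (‖r‖ ^ 2 + 1)) * ‖r‖ := by gcongr
    _ = ε * (‖r‖ ^ 2 / (‖r‖ ^ 2 + 1)) := by ring
    _ < ε * 1 := by
        gcongr
        rw [div_lt_one (by positivity)]
        linarith
    _ = ε := mul_one ε

theorem CuntzLE.of_eq_smul {a b : B} {c : ℝ} (hc : 0 ≤ c) (h : a = (c : ℂ) • b) :
    CuntzLE a b := by
  refine CuntzLE.unitization_conj (algebraMap ℂ _ (Real.sqrt c : ℂ)) ?_
  rw [h, ← algebraMap_star_comm, mul_assoc, ← Algebra.commutes, ← mul_assoc, ← map_mul,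
    ← Algebra.smul_def, Unitization.inr_smul]
  congr 1
  rw [Complex.star_def, Complex.conj_ofReal, ← Complex.ofReal_mul, Real.mul_self_sqrt hc]

variable [PartialOrder B] [StarOrderedRing B]

/-- Put X = x (v + κ)^(-1/2). Conjugating x*x ≤ v + κ gives ‖X‖ ≤ 1, and X v X* = xx* - κ XX* is
within κ of xx*. Both the monotonicity of ≾ and the equivalence of xx* with x*x follow from this. -/
theorem CuntzLE.mul_star_of_star_mul_le {x v : B} (h : star x * x ≤ v) :
    CuntzLE (x * star x) v := by
  have hv0 : 0 ≤ v := (star_mul_self_nonneg x).trans h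
  refine CuntzLE.of_forall_dist fun ε hε => ?_
  obtain ⟨κ, hκ, hκε⟩ := exists_between hε
  let V : Unitization ℂ B := v + algebraMap ℝ _ κ
  have hv : (0 : Unitization ℂ B) ≤ v := Unitization.inr_nonneg_iff.mpr hv0
  have hV : IsStrictlyPositive V :=
    IsStrictlyPositive.nonneg_add hv (isStrictlyPositive_algebraMap hκ)
  let P : Unitization ℂ B := V ^ (-(1 / 2) : ℝ)
  have hP0 : IsSelfAdjoint P := IsSelfAdjoint.of_nonneg CFC.rpow_nonneg
  have hP : star P = P := hP0.star_eq
  have hPVP : P * V * P = 1 := CFC.conjugate_rpow_neg_one_half V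
  let X : Unitization ℂ B := x * P
  have hX1 : ‖X‖ * ‖X‖ ≤ 1 := by
    rw [← CStarRing.norm_star_mul_self]
    have h1 : star X * X = P * (star x * x : B) * P := by
      simp only [X, star_mul, hP, Unitization.inr_mul, Unitization.inr_star, mul_assoc]
    have h2 : star X * X ≤ 1 := by
      rw [h1, ← hPVP]
      refine hP0.conjugate_le_conjugate ?_
      calc ((star x * x : B) : Unitization ℂ B) ≤ v :=
            (Unitization.inr_le_iff _ _ (.star_mul_self x) (.of_nonneg hv0)).mpr h
        _ ≤ V := le_add_of_nonneg_right (isStrictlyPositive_algebraMap hκ).nonneg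
    exact (CStarAlgebra.norm_le_one_iff_of_nonneg _ (star_mul_self_nonneg X)).mpr h2
  have key : X * v * star X = (x * star x : B) - algebraMap ℝ _ κ * (X * star X) := by
    have : (v : Unitization ℂ B) = V - algebraMap ℝ _ κ := by simp [V]
    rw [this, mul_sub, sub_mul]
    congr 1
    · calc X * V * star X = x * (P * V * P) * star (x : Unitization ℂ B) := by
            simp only [X, star_mul, hP, mul_assoc]
        _ = _ := by rw [hPVP]; simp
    · rw [← Algebra.commutes, mul_assoc]
  have hXv : ((lmul X (star (lmul X v)) : B) : Unitization ℂ B) = X * v * star X := by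
    rw [inr_lmul, Unitization.inr_star, inr_lmul, star_mul,
      (IsSelfAdjoint.of_nonneg hv).star_eq]
    simp only [mul_assoc]
  refine ⟨lmul X (star (lmul X v)), ?_, CuntzLE.unitization_conj X hXv⟩
  rw [← Unitization.dist_inr (𝕜 := ℂ), hXv, key, dist_eq_norm, sub_sub_cancel_left, norm_neg,
    ← Algebra.smul_def, norm_smul, Real.norm_of_nonneg hκ.le, CStarRing.norm_self_mul_star]
  nlinarith

theorem CuntzLE.of_le {u v : B} (hu : 0 ≤ u) (h : u ≤ v) : CuntzLE u v := by
  obtain ⟨x, rfl⟩ := CStarAlgebra.nonneg_iff_eq_mul_star_self.mp hu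
  have hs : star (CFC.sqrt (x * star x)) = CFC.sqrt (x * star x) :=
    (IsSelfAdjoint.of_nonneg (CFC.sqrt_nonneg _)).star_eq
  have h1 : CFC.sqrt (x * star x) * CFC.sqrt (x * star x) = x * star x :=
    CFC.sqrt_mul_sqrt_self _ hu
  have := CuntzLE.mul_star_of_star_mul_le (x := CFC.sqrt (x * star x)) (v := v)
    (by rwa [hs, h1])
  rwa [hs, h1] at this

theorem CuntzLE.mul_star_self (x : B) : CuntzLE (x * star x) (star x * x) :=
  CuntzLE.mul_star_of_star_mul_le le_rfl

theorem CuntzLE.star_mul_self (x : B) : CuntzLE (star x * x) (x * star x) := by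
  simpa using CuntzLE.mul_star_self (star x)

theorem CuntzLE.of_le_smul {u v : B} (hu : 0 ≤ u) (c : ℝ) (hc : 0 ≤ c) (h : u ≤ c • v) :
    CuntzLE u v :=
  (CuntzLE.of_le hu h).trans (CuntzLE.of_eq_smul hc (by simp))

/-- If `‖b - x‖ ≤ ε`, then elements of the form `f x f* - ε f f*` lie below `b`. -/
theorem CuntzLE.of_norm_sub_le {x b y f : B} {ε : ℝ} (hx : IsSelfAdjoint x) (hb : IsSelfAdjoint b)
    (hy : 0 ≤ y) (hyf : y = f * x * star f - ε • (f * star f)) (h : ‖b - x‖ ≤ ε) :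
    CuntzLE y b := by
  refine (CuntzLE.of_le hy ?_).trans (CuntzLE.conj f b)
  have hfb : IsSelfAdjoint (f * b * star f) := hb.conjugate f
  rw [← Unitization.inr_le_iff _ _ (.of_nonneg hy) hfb, hyf]
  -- In the unitization x - b ≤ ε, hence f x f* - ε f f* ≤ f b f*.
  have h1 : ((x - b : B) : Unitization ℂ B) ≤ algebraMap ℝ _ ε := by
    refine (IsSelfAdjoint.le_algebraMap_norm_self ?_).trans ?_
    · exact (hx.sub hb).inr ℂ
    · rw [Unitization.norm_inr, norm_sub_rev]
      exact algebraMap_mono _ h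
  have h2 := star_right_conjugate_le_conjugate h1 (f : Unitization ℂ B)
  rw [← sub_nonneg] at h2 ⊢
  refine h2.trans_eq ?_
  rw [← Algebra.commutes, mul_assoc (algebraMap ℝ _ ε), ← Algebra.smul_def]
  simp only [Unitization.inr_sub, Unitization.inr_mul, Unitization.inr_star, Unitization.inr_smul,
    mul_sub, sub_mul]
  abel

end Cuntz

theorem CStarCompletion.of_sub {E : Type*} [NonUnitalNormedRing E] (x y : E) :
    (of (x - y) : CStarCompletion E) = of x - of y := Completion.coe_sub x y

/-! ### Row operations on infinite matrices -/

namespace FinMat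

variable {A : Type*} [NonUnitalCStarAlgebra A]

theorem exists_suppIn_rowMap (f : ℕ ≃. ℕ) (x : FinMat A) :
    ∃ n, ∀ i j, n ≤ i ∨ n ≤ j → (f i).elim 0 (fun k => x.entry k j) = 0 := by
  obtain ⟨n, hn⟩ := x.exists_suppIn
  -- Only the rows k < n of `x` are nonzero, and such a row can occur only at the place `f.symm k`.
  -- The sum of the numbers `f.symm k + 1` exceeds all these places.
  refine ⟨n + ∑ k ∈ Finset.range n, ((f.symm k).elim 0 (· + 1)), fun i j h => ?_⟩
  rcases hi : f i with _ | k
  · rfl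
  · refine hn k j ?_
    rcases h with h | h
    · left
      by_contra! hk
      have h1 : (f.symm k).elim 0 (· + 1) ≤ ∑ k ∈ Finset.range n, ((f.symm k).elim 0 (· + 1)) :=
        Finset.single_le_sum (f := fun k => (f.symm k).elim 0 (· + 1)) (fun _ _ => Nat.zero_le _)
          (Finset.mem_range.mpr hk)
      rw [(PEquiv.eq_some_iff f).mpr hi] at h1
      simp only [Option.elim_some] at h1
      omega
    · right; omega

/-- The matrix whose `i`-th row is the row `f i` of `x`, or zero where `f` is not defined. -/
def rowMap (f : ℕ ≃. ℕ) (x : FinMat A) : FinMat A :=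
  mk (fun i j => (f i).elim 0 (fun k => x.entry k j)) (exists_suppIn_rowMap f x)

theorem entry_rowMap (f : ℕ ≃. ℕ) (x : FinMat A) (i j : ℕ) :
    (rowMap f x).entry i j = (f i).elim 0 (fun k => x.entry k j) := rfl

theorem rowMap_add (f : ℕ ≃. ℕ) (x y : FinMat A) : rowMap f (x + y) = rowMap f x + rowMap f y := by
  ext i j
  rw [entry_add, entry_rowMap, entry_rowMap, entry_rowMap]
  cases f i <;> simp

theorem rowMap_smul (f : ℕ ≃. ℕ) (c : ℂ) (x : FinMat A) : rowMap f (c • x) = c • rowMap f x := by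
  ext i j
  rw [entry_smul, entry_rowMap, entry_rowMap]
  cases f i <;> simp

theorem rowMap_mul (f : ℕ ≃. ℕ) (x y : FinMat A) : rowMap f (x * y) = rowMap f x * y := by
  ext i j
  rw [entry_rowMap, entry_mul]
  simp only [entry_rowMap]
  cases f i <;> simp [entry_mul]

theorem rowMap_rowMap (f g : ℕ ≃. ℕ) (x : FinMat A) :
    rowMap f (rowMap g x) = rowMap (f.trans g) x := by
  ext i j
  simp only [entry_rowMap]
  change _ = ((f i).bind g).elim 0 _
  cases f i <;> rfl

@[simp] theorem rowMap_refl (x : FinMat A) : rowMap (PEquiv.refl ℕ) x = x := rfl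

@[simp] theorem rowMap_bot (x : FinMat A) : rowMap ⊥ x = 0 := rfl

/-- `rowMap f` is left multiplication by the partial permutation matrix with ones at the places (i,
f i), and its adjoint is the matrix of `f.symm`. The two sums correspond under the bijection from
the domain of `f` to its range. -/
theorem star_rowMap_mul (f : ℕ ≃. ℕ) (x y : FinMat A) :
    star (rowMap f x) * y = star x * rowMap f.symm y := by
  ext a b
  rw [entry_mul, entry_mul]
  simp only [entry_star, entry_rowMap]
  let s : Set ℕ := {i | (f i).isSome}
  let t : Set ℕ := {k | (f.symm k).isSome}
  have h1 : ∀ i, i ∉ s → f i = none := fun i hi => by simpa [s] using hi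
  have h2 : ∀ i, i ∉ t → f.symm i = none := fun i hi => by simpa [t] using hi
  have key : ∀ (u : Set ℕ) (F : ℕ → A), (∀ i, i ∉ u → F i = 0) → ∑ᶠ i, F i = ∑ᶠ i ∈ u, F i := by
    intro u F hF
    refine finsum_congr fun i => ?_
    by_cases hi : i ∈ u
    · simp [hi]
    · simp [hi, hF i hi]
  rw [key s (fun i => star ((f i).elim 0 fun k => x.entry k a) * y.entry i b)
      fun i hi => by simp [h1 i hi],
    key t (fun k => star (x.entry k a) * (f.symm k).elim 0 fun k => y.entry k b)
      fun i hi => by simp [h2 i hi]]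
  refine finsum_mem_eq_of_bijOn (fun i => (f i).getD 0) ⟨?_, ?_, ?_⟩ ?_
  · intro i hi
    obtain ⟨k, hk⟩ := Option.isSome_iff_exists.mp hi
    simp [t, hk, (PEquiv.eq_some_iff f).mpr hk]
  · intro i hi i' hi' h
    obtain ⟨k, hk⟩ := Option.isSome_iff_exists.mp hi
    obtain ⟨k', hk'⟩ := Option.isSome_iff_exists.mp hi'
    simp only [hk, hk', Option.getD_some] at h
    subst h
    exact f.inj hk hk'
  · intro k hk
    obtain ⟨i, hi⟩ := Option.isSome_iff_exists.mp hk
    exact ⟨i, by simp [s, (PEquiv.eq_some_iff f).mp hi], by simp [(PEquiv.eq_some_iff f).mp hi]⟩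
  · intro i hi
    obtain ⟨k, hk⟩ := Option.isSome_iff_exists.mp hi
    simp [hk, (PEquiv.eq_some_iff f).mpr hk]

theorem norm_rowMap_le (f : ℕ ≃. ℕ) (x : FinMat A) : ‖rowMap f x‖ ≤ ‖x‖ := by
  -- The condition says that `g` is a coordinate projection, for which ‖gx‖² = ‖x* g x‖ ≤ ‖x‖ ‖gx‖.
  -- The general case reduces to this one because `f.symm.trans f` is a coordinate projection.
  have aux : ∀ (g : ℕ ≃. ℕ), g.symm.trans g = g → ∀ x : FinMat A, ‖rowMap g x‖ ≤ ‖x‖ := by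
    intro g hg x
    have h : ‖rowMap g x‖ * ‖rowMap g x‖ ≤ ‖x‖ * ‖rowMap g x‖ := by
      rw [← CStarRing.norm_star_mul_self, star_rowMap_mul, rowMap_rowMap, hg]
      exact (norm_mul_le _ _).trans_eq (by rw [norm_star])
    rcases (norm_nonneg (rowMap g x)).eq_or_lt with h0 | h0
    · rw [← h0]; exact norm_nonneg x
    · exact le_of_mul_le_mul_right h h0
  have h : ‖rowMap f x‖ * ‖rowMap f x‖ ≤ ‖x‖ * ‖x‖ := by
    rw [← CStarRing.norm_star_mul_self, star_rowMap_mul, rowMap_rowMap]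
    refine (norm_mul_le _ _).trans ?_
    rw [norm_star]
    gcongr
    refine aux _ ?_ x
    rw [PEquiv.symm_trans_rev, PEquiv.symm_symm, PEquiv.symm_trans_self]
    ext i j
    simp only [PEquiv.trans_eq_some, PEquiv.ofSet_eq_some_iff]
    grind
  nlinarith [norm_nonneg (rowMap f x), norm_nonneg x]

theorem norm_entry_le (x : FinMat A) (i j : ℕ) : ‖x.entry i j‖ ≤ ‖x‖ := by
  let _ := CStarAlgebra.spectralOrder A
  let _ := CStarAlgebra.spectralOrderedRing A
  obtain ⟨n, hn⟩ := x.exists_suppIn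
  have h := CStarMatrix.norm_entry_le_norm (M := corner (n + i + j + 1) x)
    (i := ⟨i, by omega⟩) (j := ⟨j, by omega⟩)
  rw [norm_eq (hn.mono (m := n + i + j + 1) (by omega))]
  exact h

/-- The matrix with single nonzero entry `a` at `(n, m)`. -/
def single (n m : ℕ) (a : A) : FinMat A :=
  mk (fun i j => if i = n ∧ j = m then a else 0)
    ⟨n + m + 1, fun i j h => if_neg (by omega)⟩

theorem entry_single (n m : ℕ) (a : A) (i j : ℕ) :
    (single n m a).entry i j = if i = n ∧ j = m then a else 0 := rfl

theorem suppIn_single {n m N : ℕ} (hn : n < N) (hm : m < N) (a : A) : SuppIn N (single n m a) :=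
  fun _ _ h => if_neg (by omega)

theorem star_single (n m : ℕ) (a : A) : star (single n m a) = single m n (star a) := by
  ext i j
  simp only [entry_star, entry_single, and_comm, apply_ite star, star_zero]

theorem single_mul_single (n m k : ℕ) (a b : A) :
    single n m a * single m k b = single n k (a * b) := by
  ext i j
  rw [entry_mul, finsum_eq_single _ m fun l hl => by simp [entry_single, hl]]
  by_cases hi : i = n <;> by_cases hj : j = k <;> simp [entry_single, hi, hj]

theorem single_add (n m : ℕ) (a b : A) : single n m (a + b) = single n m a + single n m b := by
  ext i j
  simp only [entry_add, entry_single]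
  split_ifs <;> simp

theorem single_smul (n m : ℕ) (c : ℂ) (a : A) : single n m (c • a) = c • single n m a := by
  ext i j
  simp only [entry_smul, entry_single]
  split_ifs <;> simp

/-- The embedding of `A` into its stabilization as the `n`-th diagonal entry. -/
def singleHom (n : ℕ) : A →⋆ₙₐ[ℂ] CStarCompletion (FinMat A) where
  toFun a := CStarCompletion.of (single n n a)
  map_smul' c x := by rw [single_smul, CStarCompletion.of_smul]; rfl
  map_zero' := by
    rw [← CStarCompletion.of_zero]
    congr 1
    ext i j
    simp [entry_single]
  map_add' x y := by rw [single_add, CStarCompletion.of_add]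
  map_mul' x y := by rw [← single_mul_single n n n, CStarCompletion.of_mul]
  map_star' x := by rw [← star_single, CStarCompletion.of_star]

theorem norm_single (n m : ℕ) (a : A) : ‖single n m a‖ = ‖a‖ := by
  refine le_antisymm ?_ ?_
  · have aux : ∀ b : A, ‖single n n b‖ ≤ ‖b‖ := fun b => by
      rw [← CStarCompletion.norm_of]
      exact NonUnitalStarAlgHom.norm_apply_le (singleHom n) b
    have h : ‖single n m a‖ * ‖single n m a‖ ≤ ‖a‖ * ‖a‖ := by
      rw [← CStarRing.norm_self_mul_star, star_single, single_mul_single]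
      refine (aux _).trans ?_
      rw [CStarRing.norm_self_mul_star]
    nlinarith [norm_nonneg (single n m a), norm_nonneg a]
  · simpa [entry_single] using norm_entry_le (single n m a) n m

end FinMat

namespace Stabilization

variable {A : Type*} [NonUnitalCStarAlgebra A]

open CStarCompletion

/-- The extension of `FinMat.rowMap` to the stabilization. -/
def rowMap (f : ℕ ≃. ℕ) : Stabilization A → Stabilization A := Completion.map (FinMat.rowMap f)

theorem uniformContinuous_finMat_rowMap (f : ℕ ≃. ℕ) :
    UniformContinuous (FinMat.rowMap f : FinMat A → FinMat A) :=
  AddMonoidHomClass.uniformContinuous_of_bound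
    (⟨⟨FinMat.rowMap f, by ext i j; rw [FinMat.entry_rowMap]; cases f i <;> rfl⟩,
      FinMat.rowMap_add f⟩ : FinMat A →+ FinMat A) 1
    (fun x => by rw [one_mul]; exact FinMat.norm_rowMap_le f x)

@[simp] theorem rowMap_of (f : ℕ ≃. ℕ) (x : FinMat A) :
    rowMap f (of x) = of (FinMat.rowMap f x) :=
  Completion.map_coe (uniformContinuous_finMat_rowMap f) x

@[fun_prop]
theorem continuous_rowMap (f : ℕ ≃. ℕ) : Continuous (rowMap f : Stabilization A → _) :=
  Completion.continuous_map

theorem rowMap_add (f : ℕ ≃. ℕ) (x y : Stabilization A) :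
    rowMap f (x + y) = rowMap f x + rowMap f y := by
  induction x, y using induction_on₂ with
  | hp => exact isClosed_eq (by fun_prop) (by fun_prop)
  | ih x y => simp only [← of_add, rowMap_of, FinMat.rowMap_add]

theorem rowMap_mul (f : ℕ ≃. ℕ) (x y : Stabilization A) : rowMap f (x * y) = rowMap f x * y := by
  induction x, y using induction_on₂ with
  | hp => exact isClosed_eq (by fun_prop) (by fun_prop)
  | ih x y => simp only [← of_mul, rowMap_of, FinMat.rowMap_mul]

theorem rowMap_smul (f : ℕ ≃. ℕ) (c : ℂ) (x : Stabilization A) :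
    rowMap f (c • x) = c • rowMap f x := by
  induction x using induction_on with
  | hp =>
    exact isClosed_eq ((continuous_rowMap f).comp (continuous_smul' c))
      ((continuous_smul' c).comp (continuous_rowMap f))
  | ih x => simp only [← of_smul, rowMap_of, FinMat.rowMap_smul]

theorem rowMap_rowMap (f g : ℕ ≃. ℕ) (x : Stabilization A) :
    rowMap f (rowMap g x) = rowMap (f.trans g) x := by
  induction x using induction_on with
  | hp => exact isClosed_eq (by fun_prop) (by fun_prop)
  | ih x => simp only [rowMap_of, FinMat.rowMap_rowMap]

@[simp] theorem rowMap_refl (x : Stabilization A) : rowMap (PEquiv.refl ℕ) x = x := by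
  induction x using induction_on with
  | hp => exact isClosed_eq (by fun_prop) (by fun_prop)
  | ih x => simp only [rowMap_of, FinMat.rowMap_refl]

@[simp] theorem rowMap_bot (x : Stabilization A) : rowMap ⊥ x = 0 := by
  induction x using induction_on with
  | hp => exact isClosed_eq (by fun_prop) (by fun_prop)
  | ih x => simp only [rowMap_of, FinMat.rowMap_bot, of_zero]

theorem star_rowMap_mul (f : ℕ ≃. ℕ) (x y : Stabilization A) :
    star (rowMap f x) * y = star x * rowMap f.symm y := by
  induction x, y using induction_on₂ with
  | hp => exact isClosed_eq (by fun_prop) (by fun_prop)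
  | ih x y =>
    simp only [← of_mul, rowMap_of, ← of_star, FinMat.star_rowMap_mul]

theorem norm_rowMap_le (f : ℕ ≃. ℕ) (x : Stabilization A) : ‖rowMap f x‖ ≤ ‖x‖ := by
  induction x using induction_on with
  | hp => exact isClosed_le (by fun_prop) (by fun_prop)
  | ih x => simpa only [rowMap_of, norm_of] using FinMat.norm_rowMap_le f x

theorem rowMap_zero (f : ℕ ≃. ℕ) : rowMap f (0 : Stabilization A) = 0 := by
  simpa using rowMap_smul f 0 (0 : Stabilization A)

theorem rowMap_neg (f : ℕ ≃. ℕ) (x : Stabilization A) : rowMap f (-x) = -rowMap f x := by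
  simpa using rowMap_smul f (-1) x

theorem rowMap_sub (f : ℕ ≃. ℕ) (x y : Stabilization A) :
    rowMap f (x - y) = rowMap f x - rowMap f y := by
  rw [sub_eq_add_neg, rowMap_add, rowMap_neg, ← sub_eq_add_neg]

/-- Row maps act as partial isometries: with g = f*f, the difference of the two sides is ((1 -
g)x)*((1 - g)x). -/
theorem star_rowMap_mul_rowMap_le (f : ℕ ≃. ℕ) (x : Stabilization A) :
    star (rowMap f x) * rowMap f x ≤ star x * x := by
  let g : ℕ ≃. ℕ := PEquiv.ofSet {i | (f.symm i).isSome}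
  have hg : f.symm.trans f = g := PEquiv.symm_trans_self f
  have h1 : star (rowMap f x) * rowMap f x = star x * rowMap g x := by
    rw [star_rowMap_mul, rowMap_rowMap, hg]
  have hgs : g.symm = g := PEquiv.ofSet_symm _
  have hgg : g.trans g = g := by
    ext i j
    simp only [g, PEquiv.trans_eq_some, PEquiv.ofSet_eq_some_iff]
    grind
  have h2 : star (x - rowMap g x) * (x - rowMap g x) = star x * x - star x * rowMap g x := by
    rw [star_sub, sub_mul, star_rowMap_mul, hgs, rowMap_sub, rowMap_rowMap, hgg, sub_self,
      mul_zero, sub_zero, mul_sub]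
  rw [h1, ← sub_nonneg, ← h2]
  exact star_mul_self_nonneg _

/-- The coordinate projection onto the first `k` rows. -/
def rowTrunc (k : ℕ) : ℕ ≃. ℕ := PEquiv.ofSet (Set.Iio k)

theorem exists_norm_rowTrunc_sub_lt (x : Stabilization A) {ε : ℝ} (hε : 0 < ε) :
    ∃ k, ‖rowMap (rowTrunc k) x - x‖ < ε := by
  obtain ⟨y, hy⟩ := (isDenseInducing_of (E := FinMat A)).dense.exists_dist_lt x (half_pos hε)
  obtain ⟨k, hk⟩ := y.exists_suppIn
  have h : rowMap (rowTrunc k) (of y) = of y := by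
    rw [rowMap_of]
    congr 1
    ext i j
    rw [FinMat.entry_rowMap]
    by_cases hi : i < k
    · have : rowTrunc k i = some i := PEquiv.ofSet_eq_some_self_iff.mpr hi
      rw [this]; rfl
    · have : rowTrunc k i = none := by simp [rowTrunc, PEquiv.ofSet, hi]
      rw [this, hk i j (Or.inl (not_lt.mp hi))]; rfl
  refine ⟨k, ?_⟩
  calc ‖rowMap (rowTrunc k) x - x‖
      = ‖rowMap (rowTrunc k) (x - of y) - (x - of y)‖ := by rw [rowMap_sub, h]; congr 1; abel
    _ ≤ ‖x - of y‖ + ‖x - of y‖ :=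
        (norm_sub_le _ _).trans (add_le_add (norm_rowMap_le _ _) le_rfl)
    _ < ε := by rw [dist_eq_norm] at hy; linarith

/-- The partial bijection of `ℕ` corresponding to a shift by `k` rows. -/
def rowShift (k : ℕ) : ℕ ≃. ℕ where
  toFun i := if k ≤ i then some (i - k) else none
  invFun i := some (i + k)
  inv i j := by
    split_ifs <;> simp <;> omega

theorem rowShift_apply (k i : ℕ) : rowShift k i = if k ≤ i then some (i - k) else none := rfl

theorem rowShift_symm_apply (k i : ℕ) : (rowShift k).symm i = some (i + k) := rfl

theorem rowShift_symm_trans (k : ℕ) : (rowShift k).symm.trans (rowShift k) = PEquiv.refl ℕ := by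
  ext i j
  simp [PEquiv.trans_eq_some, rowShift_apply, rowShift_symm_apply]

/-- The truncation keeps the first `k` rows and the shift leaves exactly these rows empty, so the
two operators have orthogonal ranges. -/
theorem rowTrunc_symm_trans_rowShift (k : ℕ) :
    (rowTrunc k).symm.trans (rowShift k) = ⊥ := by
  ext i j
  simp only [PEquiv.trans_eq_some, rowTrunc, PEquiv.ofSet_symm, PEquiv.ofSet_eq_some_iff,
    rowShift_apply, Set.mem_Iio, PEquiv.bot_apply]
  grind

theorem rowShift_symm_trans_rowTrunc (k : ℕ) :
    (rowShift k).symm.trans (rowTrunc k) = ⊥ := by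
  have := congrArg PEquiv.symm (rowTrunc_symm_trans_rowShift k)
  rwa [PEquiv.symm_trans_rev, PEquiv.symm_symm, PEquiv.symm_bot] at this

/-- The partial bijection sending the `2k`-th row to the `k`-th row. -/
def rowEven : ℕ ≃. ℕ where
  toFun i := (Equiv.natSumNatEquivNat.symm i).elim some (fun _ => none)
  invFun i := some (Equiv.natSumNatEquivNat (Sum.inl i))
  inv i j := by
    obtain ⟨s, rfl⟩ := Equiv.natSumNatEquivNat.surjective i
    rcases s with s | s
    · simp only [Equiv.symm_apply_apply, Sum.elim_inl, Option.some.injEq,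
        EmbeddingLike.apply_eq_iff_eq, Sum.inl.injEq, eq_comm]
    · simp only [Equiv.symm_apply_apply, Sum.elim_inr, Option.some.injEq,
        EmbeddingLike.apply_eq_iff_eq, reduceCtorEq]

/-- The partial bijection sending the `2k+1`-st row to the `k`-th row. -/
def rowOdd : ℕ ≃. ℕ where
  toFun i := (Equiv.natSumNatEquivNat.symm i).elim (fun _ => none) some
  invFun i := some (Equiv.natSumNatEquivNat (Sum.inr i))
  inv i j := by
    obtain ⟨s, rfl⟩ := Equiv.natSumNatEquivNat.surjective i
    rcases s with s | s
    · simp only [Equiv.symm_apply_apply, Sum.elim_inl, Option.some.injEq,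
        EmbeddingLike.apply_eq_iff_eq, reduceCtorEq]
    · simp only [Equiv.symm_apply_apply, Sum.elim_inr, Option.some.injEq,
        EmbeddingLike.apply_eq_iff_eq, Sum.inr.injEq, eq_comm]

@[simp] theorem rowEven_inl (k : ℕ) :
    rowEven (Equiv.natSumNatEquivNat (Sum.inl k)) = some k := by
  change (Equiv.natSumNatEquivNat.symm _).elim _ _ = _
  rw [Equiv.symm_apply_apply]
  rfl

@[simp] theorem rowEven_inr (k : ℕ) :
    rowEven (Equiv.natSumNatEquivNat (Sum.inr k)) = none := by
  change (Equiv.natSumNatEquivNat.symm _).elim _ _ = _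
  rw [Equiv.symm_apply_apply]
  rfl

@[simp] theorem rowOdd_inl (k : ℕ) :
    rowOdd (Equiv.natSumNatEquivNat (Sum.inl k)) = none := by
  change (Equiv.natSumNatEquivNat.symm _).elim _ _ = _
  rw [Equiv.symm_apply_apply]
  rfl

@[simp] theorem rowOdd_inr (k : ℕ) :
    rowOdd (Equiv.natSumNatEquivNat (Sum.inr k)) = some k := by
  change (Equiv.natSumNatEquivNat.symm _).elim _ _ = _
  rw [Equiv.symm_apply_apply]
  rfl

@[simp] theorem rowEven_symm_apply (k : ℕ) :
    rowEven.symm k = some (Equiv.natSumNatEquivNat (Sum.inl k)) := rfl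

@[simp] theorem rowOdd_symm_apply (k : ℕ) :
    rowOdd.symm k = some (Equiv.natSumNatEquivNat (Sum.inr k)) := rfl

/-- The even and odd row maps act as isometries V₀, V₁ with orthogonal ranges and V₀V₀* + V₁V₁* = 1.
They realise the identification of B with M₂(B), under which `diag b c` is V₀ b V₀* + V₁ c V₁*. -/
theorem rowEven_symm_trans : rowEven.symm.trans rowEven = PEquiv.refl ℕ := by
  ext i j
  simp only [PEquiv.trans_eq_some, rowEven_symm_apply, Option.some.injEq, exists_eq_left',
    rowEven_inl, PEquiv.refl_apply]

theorem rowOdd_symm_trans : rowOdd.symm.trans rowOdd = PEquiv.refl ℕ := by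
  ext i j
  simp only [PEquiv.trans_eq_some, rowOdd_symm_apply, Option.some.injEq, exists_eq_left',
    rowOdd_inr, PEquiv.refl_apply]

theorem rowEven_symm_trans_rowOdd : rowEven.symm.trans rowOdd = ⊥ := by
  ext i j
  simp only [PEquiv.trans_eq_some, rowEven_symm_apply, Option.some.injEq, exists_eq_left',
    rowOdd_inl, PEquiv.bot_apply]

theorem rowOdd_symm_trans_rowEven : rowOdd.symm.trans rowEven = ⊥ := by
  ext i j
  simp only [PEquiv.trans_eq_some, rowOdd_symm_apply, Option.some.injEq, exists_eq_left',
    rowEven_inr, PEquiv.bot_apply]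

theorem rowEven_add_rowOdd (x : Stabilization A) :
    rowMap rowEven (rowMap rowEven.symm x) + rowMap rowOdd (rowMap rowOdd.symm x) = x := by
  induction x using induction_on with
  | hp => exact isClosed_eq (by fun_prop) (by fun_prop)
  | ih x =>
    simp only [rowMap_of, ← of_add]
    congr 1
    ext i j
    obtain ⟨i, rfl⟩ := Equiv.natSumNatEquivNat.surjective i
    rw [FinMat.entry_add, FinMat.entry_rowMap, FinMat.entry_rowMap]
    rcases i with i | i
    · rw [rowEven_inl, rowOdd_inl]
      simp [FinMat.entry_rowMap]
    · rw [rowEven_inr, rowOdd_inr]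
      simp [FinMat.entry_rowMap]

theorem rowMap_rowEven_symm_diag_mul (b c x : Stabilization A) :
    rowMap rowEven.symm (diag b c * x) = b * rowMap rowEven.symm x := by
  induction b, c, x using induction_on₃ with
  | hp =>
    refine isClosed_eq ((continuous_rowMap _).comp (Continuous.mul ?_ (by fun_prop))) (by fun_prop)
    exact continuous_diag.comp (by fun_prop : Continuous fun p : Stabilization A ×
      Stabilization A × Stabilization A => (p.1, p.2.1))
  | ih b c x =>
    simp only [diag_of, ← of_mul, rowMap_of]
    congr 1
    obtain ⟨n, hb, hc⟩ := FinMat.exists_suppIn₂ b c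
    ext i j
    rw [FinMat.entry_rowMap, rowEven_symm_apply, Option.elim_some,
      FinMat.entry_mul_of_suppIn (FinMat.suppIn_diag hb hc), FinMat.sum_range_two_mul,
      FinMat.entry_mul_of_suppIn hb]
    simp only [FinMat.entry_diag]
    simp [FinMat.entry_rowMap]

theorem rowMap_rowOdd_symm_diag_mul (b c x : Stabilization A) :
    rowMap rowOdd.symm (diag b c * x) = c * rowMap rowOdd.symm x := by
  induction b, c, x using induction_on₃ with
  | hp =>
    refine isClosed_eq ((continuous_rowMap _).comp (Continuous.mul ?_ (by fun_prop))) (by fun_prop)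
    exact continuous_diag.comp (by fun_prop : Continuous fun p : Stabilization A ×
      Stabilization A × Stabilization A => (p.1, p.2.1))
  | ih b c x =>
    simp only [diag_of, ← of_mul, rowMap_of]
    congr 1
    obtain ⟨n, hb, hc⟩ := FinMat.exists_suppIn₂ b c
    ext i j
    rw [FinMat.entry_rowMap, rowOdd_symm_apply, Option.elim_some,
      FinMat.entry_mul_of_suppIn (FinMat.suppIn_diag hb hc), FinMat.sum_range_two_mul,
      FinMat.entry_mul_of_suppIn hc]
    simp only [FinMat.entry_diag]
    simp [FinMat.entry_rowMap]

theorem diag_mul_rowMap_rowEven (b c x : Stabilization A) :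
    diag b c * rowMap rowEven x = rowMap rowEven (b * x) := by
  rw [← rowEven_add_rowOdd (diag b c * rowMap rowEven x), rowMap_rowEven_symm_diag_mul,
    rowMap_rowOdd_symm_diag_mul, rowMap_rowMap, rowMap_rowMap, rowEven_symm_trans,
    rowOdd_symm_trans_rowEven, rowMap_refl, rowMap_bot, mul_zero, rowMap_zero, add_zero]

theorem star_mul_eq_rowEven_add_rowOdd (x y : Stabilization A) :
    star x * y = star (rowMap rowEven.symm x) * rowMap rowEven.symm y +
      star (rowMap rowOdd.symm x) * rowMap rowOdd.symm y := by
  conv_lhs => rw [← rowEven_add_rowOdd y, mul_add]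
  rw [star_rowMap_mul, star_rowMap_mul]
  rfl

/-- `u + v ≾ u ⊕ v`. -/
theorem cuntzLE_add_diag (u v : Stabilization A) : CuntzLE (u + v) (diag u v) := by
  refine CuntzLE.of_forall_dist fun ε hε => ?_
  obtain ⟨e, he⟩ := cuntzLE_iff.mp (CuntzLE.refl (u + v)) ε hε
  refine ⟨_, he, ?_⟩
  -- Compressing by the column (e*, e*) gives e u e* + e v e*, where e comes from an approximate
  -- unit for u + v.
  have h := CuntzLE.conj' (rowMap rowEven (star e) + rowMap rowOdd (star e)) (diag u v)
  rw [mul_assoc, star_mul_eq_rowEven_add_rowOdd, rowMap_rowEven_symm_diag_mul,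
    rowMap_rowOdd_symm_diag_mul] at h
  simp only [rowMap_add, rowMap_rowMap, rowEven_symm_trans, rowOdd_symm_trans,
    rowOdd_symm_trans_rowEven, rowEven_symm_trans_rowOdd, rowMap_refl, rowMap_bot, add_zero,
    zero_add, star_star] at h
  simpa only [mul_add, add_mul, mul_assoc] using h

/-! ### Entries -/

/-- The `(i, j)`-entry of an element of `A ⊗ 𝕂`. -/
def entry (i j : ℕ) : Stabilization A → A := Completion.extension fun x : FinMat A => x.entry i j

theorem uniformContinuous_finMat_entry (i j : ℕ) :
    UniformContinuous fun x : FinMat A => x.entry i j :=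
  AddMonoidHomClass.uniformContinuous_of_bound
    (⟨⟨fun x => x.entry i j, rfl⟩, fun _ _ => rfl⟩ : FinMat A →+ A) 1
    (fun x => by rw [one_mul]; exact FinMat.norm_entry_le x i j)

@[simp] theorem entry_of (i j : ℕ) (x : FinMat A) : entry i j (of x) = x.entry i j :=
  Completion.extension_coe (uniformContinuous_finMat_entry i j) x

@[fun_prop]
theorem continuous_entry (i j : ℕ) : Continuous (entry i j : Stabilization A → A) :=
  Completion.continuous_extension

theorem entry_add (i j : ℕ) (x y : Stabilization A) :
    entry i j (x + y) = entry i j x + entry i j y := by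
  induction x, y using induction_on₂ with
  | hp => exact isClosed_eq (by fun_prop) (by fun_prop)
  | ih x y => simp only [← of_add, entry_of, FinMat.entry_add]

theorem entry_smul (i j : ℕ) (c : ℂ) (x : Stabilization A) :
    entry i j (c • x) = c • entry i j x := by
  induction x using induction_on with
  | hp =>
    exact isClosed_eq ((continuous_entry i j).comp (continuous_smul' c))
      ((continuous_const_smul c).comp (continuous_entry i j))
  | ih x => simp only [← of_smul, entry_of, FinMat.entry_smul]

theorem entry_sub (i j : ℕ) (x y : Stabilization A) :
    entry i j (x - y) = entry i j x - entry i j y := by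
  rw [eq_sub_iff_add_eq, ← entry_add, sub_add_cancel]

theorem entry_star (i j : ℕ) (x : Stabilization A) : entry i j (star x) = star (entry j i x) := by
  induction x using induction_on with
  | hp => exact isClosed_eq (by fun_prop) (by fun_prop)
  | ih x => simp only [← of_star, entry_of, FinMat.entry_star]

theorem norm_entry_le (i j : ℕ) (x : Stabilization A) : ‖entry i j x‖ ≤ ‖x‖ := by
  induction x using induction_on with
  | hp => exact isClosed_le (by fun_prop) (by fun_prop)
  | ih x => simpa only [entry_of, norm_of] using FinMat.norm_entry_le x i j

end Stabilization

/-! ### Cut-downs, upper bounds of increasing sequences, and the way-below relation. -/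

theorem exists_seq_of_step {α : Type*} {P : ℕ → α → Prop} {Q : ℕ → α → α → Prop}
    (h0 : ∃ x, P 0 x) (hs : ∀ n x, P n x → ∃ y, P (n + 1) y ∧ Q n x y) :
    ∃ f : ℕ → α, ∀ n, P n (f n) ∧ Q n (f n) (f (n + 1)) := by
  obtain ⟨x0, hx0⟩ := h0
  choose! g hg using hs
  let f : ℕ → α := fun n => Nat.rec x0 g n
  have hf : ∀ n, P n (f n) := fun n => by
    induction n with
    | zero => exact hx0
    | succ n ih => exact (hg n (f n) ih).1
  exact ⟨f, fun n => ⟨hf n, (hg n (f n) (hf n)).2⟩⟩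

/-- The elements y ε play the part of (x - ε)₊. They are φxφ - εφ² with φ(t) = min(1, (t/ε - 1)₊), a
form to which `CuntzLE.of_norm_sub_le` applies directly. The function φ vanishes for t ≤ ε, which
makes y ε positive, and equals 1 for t ≥ 2ε, which bounds the error by 2ε. -/
theorem exists_cuntz_cutdown {B : Type*} [NonUnitalCStarAlgebra B] [PartialOrder B]
    [StarOrderedRing B] {x : B} (hx : 0 ≤ x) : ∃ y : ℝ → B, (∀ ε, 0 < ε → 0 ≤ y ε) ∧
      (∀ ε, 0 < ε → ∀ b, 0 ≤ b → ‖b - x‖ < ε → CuntzLE (y ε) b) ∧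
      (∀ ε, 0 < ε → ‖y ε - x‖ ≤ 2 * ε) ∧ ∀ ε ε', 0 < ε' → ε' ≤ ε → y ε ≤ y ε' := by
  have hxs : IsSelfAdjoint x := .of_nonneg hx
  let φ : ℝ → ℝ → ℝ := fun ε t => min 1 (max (ε⁻¹ * t - 1) 0)
  let ψ : ℝ → ℝ → ℝ := fun ε t => φ ε t * t * φ ε t - ε * (φ ε t * φ ε t)
  have hφ0 : ∀ ε, φ ε 0 = 0 := fun ε => by simp [φ]
  have hφc : ∀ ε, Continuous (φ ε) := fun ε => by fun_prop
  have hφ : ∀ ε t, 0 ≤ φ ε t := fun ε t => le_min zero_le_one (le_max_right _ _)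
  have hφ1 : ∀ ε t, φ ε t ≤ 1 := fun ε t => min_le_left _ _
  have hψc : ∀ ε, Continuous (ψ ε) := fun ε => by fun_prop
  have hψ0 : ∀ ε, ψ ε 0 = 0 := fun ε => by simp [ψ, hφ0]
  have hφsmall : ∀ ε t, 0 < ε → t ≤ ε → φ ε t = 0 := fun ε t hε ht => by
    have : ε⁻¹ * t ≤ 1 := by rw [inv_mul_le_iff₀ hε]; simpa using ht
    simp [φ, this]
  have hψn : ∀ ε t, 0 < ε → 0 ≤ ψ ε t := fun ε t hε => by
    rcases le_total t ε with ht | ht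
    · simp [ψ, hφsmall ε t hε ht]
    · have : ψ ε t = φ ε t * φ ε t * (t - ε) := by simp only [ψ]; ring
      rw [this]
      exact mul_nonneg (mul_nonneg (hφ _ _) (hφ _ _)) (by linarith)
  have hσ : ∀ t ∈ quasispectrum ℝ x, 0 ≤ t := quasispectrum_nonneg_of_nonneg x hx
  let y : ℝ → B := fun ε => cfcₙ (ψ ε) x
  have hy0 : ∀ ε, 0 < ε → 0 ≤ y ε := fun ε hε => cfcₙ_nonneg fun t _ => hψn ε t hε
  have hyx : ∀ ε, 0 < ε → ∀ b, 0 ≤ b → ‖b - x‖ < ε → CuntzLE (y ε) b := by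
    intro ε hε b hb hbx
    refine CuntzLE.of_norm_sub_le (.of_nonneg hx) (.of_nonneg hb) (hy0 ε hε) (f := cfcₙ (φ ε) x)
      (ε := ε) ?_ hbx.le
    have hsa : star (cfcₙ (φ ε) x) = cfcₙ (φ ε) x := (cfcₙ_predicate (φ ε) x).star_eq
    rw [hsa]
    have e1 : cfcₙ (φ ε) x * x * cfcₙ (φ ε) x = cfcₙ (fun t => φ ε t * t * φ ε t) x := by
      rw [cfcₙ_mul (fun t => φ ε t * t) (φ ε) x (((hφc ε).mul continuous_id).continuousOn)
        (by simp) (hφc ε).continuousOn (hφ0 ε),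
        cfcₙ_mul (φ ε) (fun t => t) x (hφc ε).continuousOn (hφ0 ε)
        continuousOn_id rfl, cfcₙ_id' ℝ x hxs]
    have e2 : ε • (cfcₙ (φ ε) x * cfcₙ (φ ε) x) = cfcₙ (fun t => ε * (φ ε t * φ ε t)) x := by
      rw [cfcₙ_const_mul ε (fun t => φ ε t * φ ε t) x ((hφc ε).mul (hφc ε)).continuousOn
        (by simp [hφ0]), cfcₙ_mul (φ ε) (φ ε) x (hφc ε).continuousOn (hφ0 ε)
        (hφc ε).continuousOn (hφ0 ε)]
    rw [e1, e2]
    exact cfcₙ_sub _ _ x (((hφc ε).mul continuous_id).mul (hφc ε)).continuousOn (by simp)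
      (continuous_const.mul ((hφc ε).mul (hφc ε))).continuousOn (by simp [hφ0])
  have hyapp : ∀ ε, 0 < ε → ‖y ε - x‖ ≤ 2 * ε := by
    intro ε hε
    have : y ε - x = cfcₙ (fun t => ψ ε t - t) x := by
      rw [cfcₙ_sub (ψ ε) (fun t => t) x (hψc ε).continuousOn (hψ0 ε)
        continuousOn_id rfl, cfcₙ_id' ℝ x hxs]
    rw [this]
    refine norm_cfcₙ_le fun t ht => ?_
    have ht0 := hσ t ht
    rw [Real.norm_eq_abs, abs_le]
    rcases le_total t ε with h1 | h1
    · simp only [ψ, hφsmall ε t hε h1]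
      constructor <;> linarith
    · have h2 : ψ ε t = φ ε t * φ ε t * (t - ε) := by simp only [ψ]; ring
      have h3 : φ ε t * φ ε t ≤ 1 := mul_le_one₀ (hφ1 ε t) (hφ ε t) (hφ1 ε t)
      have h4 := hψn ε t hε
      rcases le_total t (2 * ε) with h5 | h5
      · constructor <;> nlinarith
      · have h6 : φ ε t = 1 := by
          have : 2 ≤ ε⁻¹ * t := by rw [le_inv_mul_iff₀ hε]; linarith
          exact min_eq_left (le_max_of_le_left (by linarith))
        rw [h2, h6]
        constructor <;> linarith
  have hymono : ∀ ε ε', 0 < ε' → ε' ≤ ε → y ε ≤ y ε' := by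
    intro ε ε' hε' h1
    refine cfcₙ_mono (fun t ht => ?_) (hψc ε).continuousOn (hψc ε').continuousOn
      (hψ0 ε) (hψ0 ε')
    have ht0 := hσ t ht
    have hε := hε'.trans_le h1
    rcases le_total t ε with h2 | h2
    · simpa [ψ, hφsmall ε t hε h2] using hψn ε' t hε'
    · have h3 : ∀ ε, ψ ε t = φ ε t * φ ε t * (t - ε) := fun ε => by simp only [ψ]; ring
      rw [h3, h3]
      have h4 : φ ε t ≤ φ ε' t := by
        simp only [φ]
        gcongr
      have h5 := hφ ε t
      gcongr
  exact ⟨y, hy0, hyx, hyapp, hymono⟩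

namespace Stabilization

variable {A : Type*} [NonUnitalCStarAlgebra A]

/-- If `G ≾ b`, then `G` can be approximated by elements that are Cuntz equivalent to `b`. -/
theorem exists_cuntz_equiv_near {G b : Stabilization A} (hb : 0 ≤ b)
    (h : CuntzLE G b) {ε : ℝ} (hε : 0 < ε) :
    ∃ G', 0 ≤ G' ∧ CuntzLE G' b ∧ CuntzLE b G' ∧ ‖G' - G‖ < ε := by
  obtain ⟨r, hr⟩ := cuntzLE_iff.mp h (ε / 2) (half_pos hε)
  set s := CFC.sqrt b with hs
  have hss : star s = s := (IsSelfAdjoint.of_nonneg (CFC.sqrt_nonneg _)).star_eq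
  have hsb : s * s = b := CFC.sqrt_mul_sqrt_self b hb
  let X := r * s
  have hXX : X * star X = r * b * star r := by
    simp only [X, star_mul, hss, ← hsb, mul_assoc]
  have hcont : Continuous fun y : Stabilization A => y * star y := by fun_prop
  obtain ⟨δ, hδ, hδX⟩ := Metric.continuousAt_iff.mp (hcont.continuousAt (x := X)) (ε / 2)
    (half_pos hε)
  obtain ⟨k, hk⟩ := exists_norm_rowTrunc_sub_lt X (half_pos hδ)
  obtain ⟨c, hc, hcs⟩ : ∃ c : ℝ, 0 < c ∧ c * ‖s‖ < δ / 2 := by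
    refine ⟨δ / 2 / (‖s‖ + 1), by positivity, ?_⟩
    rw [div_mul_eq_mul_div, div_lt_iff₀ (by positivity)]
    nlinarith [norm_nonneg s]
  let u := rowMap (rowTrunc k) X
  let v := rowMap (rowShift k) s
  -- The first `k` rows of y approximate X, and the remaining rows carry a small copy of √b. Hence
  -- y*y = u*u + c²b lies between c²b and a multiple of b, so that yy* is equivalent to b while
  -- staying close to XX* ≈ G.
  let y := u + (c : ℂ) • v
  have huv : star u * v = 0 := by
    rw [star_rowMap_mul, rowMap_rowMap, rowTrunc_symm_trans_rowShift, rowMap_bot, mul_zero]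
  have hvu : star v * u = 0 := by
    rw [star_rowMap_mul, rowMap_rowMap, rowShift_symm_trans_rowTrunc, rowMap_bot, mul_zero]
  have hvv : star v * v = b := by
    rw [star_rowMap_mul, rowMap_rowMap, rowShift_symm_trans, rowMap_refl, hss, hsb]
  have hyy : star y * y = star u * u + (c ^ 2 : ℝ) • b := by
    have hcc : star (c : ℂ) = c := Complex.conj_ofReal c
    simp only [y, star_add, star_smul, add_mul, mul_add, smul_mul_assoc, mul_smul_comm, huv, hvu,
      hvv, hcc, smul_zero, add_zero, zero_add, smul_smul, ← sq]
    rw [← Complex.ofReal_pow, Complex.coe_smul]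
  have h1 : star u * u ≤ (‖r‖ ^ 2) • b := by
    refine (star_rowMap_mul_rowMap_le _ _).trans ?_
    have := CStarAlgebra.star_left_conjugate_le_norm_smul (a := s) (b := star r * r)
      (.star_mul_self r)
    rw [CStarRing.norm_star_mul_self, hss, hsb, ← sq] at this
    refine le_trans (le_of_eq ?_) this
    simp only [X, star_mul, hss, mul_assoc]
  refine ⟨y * star y, mul_star_self_nonneg y, ?_, ?_, ?_⟩
  · refine (CuntzLE.mul_star_self y).trans
      (CuntzLE.of_le_smul (star_mul_self_nonneg y) (‖r‖ ^ 2 + c ^ 2) (by positivity) ?_)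
    rw [hyy, add_smul]
    gcongr
  · refine CuntzLE.trans ?_ (CuntzLE.star_mul_self y)
    refine CuntzLE.of_le_smul hb (c ^ 2)⁻¹ (by positivity) ?_
    rw [hyy, smul_add, smul_smul, inv_mul_cancel₀ (by positivity), one_smul]
    exact le_add_of_nonneg_left (smul_nonneg (by positivity) (star_mul_self_nonneg u))
  · have h2 : dist y X < δ := by
      rw [dist_eq_norm]
      calc ‖y - X‖ = ‖(u - X) + (c : ℂ) • v‖ := by congr 1; simp only [y]; abel
        _ ≤ ‖u - X‖ + c * ‖s‖ := by
            refine (norm_add_le _ _).trans ?_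
            rw [norm_smul, Complex.norm_real, Real.norm_of_nonneg hc.le]
            gcongr
            exact norm_rowMap_le _ _
        _ < δ := by linarith
    have h3 := hδX h2
    rw [hXX] at h3
    rw [← dist_eq_norm]
    exact (dist_triangle _ _ _).trans_lt (by linarith)

/-- Every `≾`-increasing sequence `aₙ` has an upper bound which is the limit of elements
`gₙ ≾ aₙ`. -/
theorem exists_cuntz_sup {a : ℕ → Stabilization A} (ha : ∀ n, 0 ≤ a n)
    (hmono : ∀ n m, n ≤ m → CuntzLE (a n) (a m)) :
    ∃ (G : Stabilization A) (g : ℕ → Stabilization A), 0 ≤ G ∧ (∀ n, CuntzLE (a n) G) ∧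
      (∀ n, 0 ≤ g n) ∧ (∀ n, CuntzLE (g n) (a n)) ∧ Tendsto g atTop (𝓝 G) := by
  -- A state is an element equivalent to `a n` together with a radius. Every G in that ball has some
  -- r G r* within 1/(n + 1) of `a n.unpair.1`. The balls are nested and shrink to a point G. Every
  -- index i is `n.unpair.1` for arbitrarily large n, so G lies above every `a i`.
  let P : ℕ → Stabilization A × ℝ → Prop := fun n p =>
    0 ≤ p.1 ∧ CuntzLE p.1 (a n) ∧ CuntzLE (a n) p.1 ∧ 0 < p.2 ∧
      ∀ G, dist G p.1 ≤ p.2 → ∃ r, dist (r * G * star r) (a n.unpair.1) < 1 / ((n : ℝ) + 1)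
  let Q : ℕ → Stabilization A × ℝ → Stabilization A × ℝ → Prop := fun _ p q =>
    dist q.1 p.1 + q.2 ≤ p.2 ∧ q.2 ≤ p.2 / 2
  have radius : ∀ n (x : Stabilization A), CuntzLE (a n) x → ∃ ρ > 0, ∀ G, dist G x ≤ ρ →
      ∃ r, dist (r * G * star r) (a n.unpair.1) < 1 / ((n : ℝ) + 1) := by
    intro n x hx
    have hx' := (hmono _ n n.unpair_left_le).trans hx
    obtain ⟨r, hr⟩ := cuntzLE_iff.mp hx' (1 / ((n : ℝ) + 1)) (by positivity)
    have hc : Continuous fun G : Stabilization A => dist (r * G * star r) (a n.unpair.1) := by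
      fun_prop
    have := hc.continuousAt.eventually_lt_const hr
    obtain ⟨ρ, hρ, h⟩ := Metric.eventually_nhds_iff.mp this
    exact ⟨ρ / 2, half_pos hρ, fun G hG => ⟨r, h (hG.trans_lt (half_lt_self hρ))⟩⟩
  obtain ⟨f, hf⟩ := exists_seq_of_step (P := P) (Q := Q) (by
      obtain ⟨ρ, hρ, h⟩ := radius 0 (a 0) (CuntzLE.refl _)
      exact ⟨(a 0, ρ), ha 0, CuntzLE.refl _, CuntzLE.refl _, hρ, h⟩) (by
      rintro n ⟨x, ρ⟩ ⟨hx0, hxa, hax, hρ, -⟩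
      obtain ⟨y, hy0, hya, hay, hyx⟩ := exists_cuntz_equiv_near (ha (n + 1))
        (hxa.trans (hmono n (n + 1) n.le_succ)) (half_pos hρ)
      obtain ⟨σ, hσ, h⟩ := radius (n + 1) y hay
      refine ⟨(y, min σ (ρ / 2)), ⟨hy0, hya, hay, lt_min hσ (half_pos hρ),
        fun G hG => h G (hG.trans (min_le_left _ _))⟩, ?_, min_le_right _ _⟩
      rw [← dist_eq_norm] at hyx
      have := min_le_right σ (ρ / 2)
      dsimp only
      linarith)
  have hρ : ∀ n, 0 < (f n).2 := fun n => (hf n).1.2.2.2.1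
  have hball : ∀ n m, dist (f (n + m)).1 (f n).1 + (f (n + m)).2 ≤ (f n).2 := by
    intro n m
    induction m with
    | zero => simp
    | succ m ih =>
      have h1 := (hf (n + m)).2.1
      have h2 := dist_triangle (f (n + (m + 1))).1 (f (n + m)).1 (f n).1
      rw [add_assoc] at h1
      linarith
  have hgeo : ∀ n, (f n).2 ≤ (f 0).2 * (1 / 2) ^ n := by
    intro n
    induction n with
    | zero => simp
    | succ n ih =>
      rw [pow_succ]
      have := (hf n).2.2
      linarith
  have hcau : CauchySeq fun n => (f n).1 :=
    cauchySeq_of_le_geometric (1 / 2) (f 0).2 (by norm_num) fun n => by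
      rw [dist_comm]
      have := (hf n).2.1
      linarith [hρ (n + 1), hgeo n]
  obtain ⟨G, hG⟩ := cauchySeq_tendsto_of_complete hcau
  have hGn : ∀ n, dist G (f n).1 ≤ (f n).2 := by
    intro n
    refine le_of_tendsto (hG.dist tendsto_const_nhds)
      (eventually_atTop.mpr ⟨n, fun m hm => ?_⟩)
    obtain ⟨k, rfl⟩ := Nat.exists_eq_add_of_le hm
    linarith [hball n k, hρ (n + k)]
  refine ⟨G, fun n => (f n).1, ?_, ?_, fun n => (hf n).1.1, fun n => (hf n).1.2.1, hG⟩
  · exact ge_of_tendsto' hG fun n => (hf n).1.1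
  · intro i
    rw [cuntzLE_iff]
    intro ε hε
    obtain ⟨m, hm⟩ := exists_nat_one_div_lt hε
    obtain ⟨r, hr⟩ := (hf (Nat.pair i m)).1.2.2.2.2 G (hGn _)
    rw [Nat.unpair_pair] at hr
    refine ⟨r, hr.trans_le (le_trans ?_ hm.le)⟩
    have : m ≤ Nat.pair i m := Nat.right_le_pair i m
    gcongr

end Stabilization

namespace Cu

variable {A : Type*} [NonUnitalCStarAlgebra A]

theorem exists_rep (s : Cu A) : ∃ (a : Stabilization A) (ha : 0 ≤ a), s = mk a ha := by
  induction s using Quotient.inductionOn with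
  | h a => exact ⟨a.1, a.2, rfl⟩

/-- A supremum t with [x] ≤ t lies below the upper bound G = lim g n of `exists_cuntz_sup`. Some r G
r* is close to x, hence so is r (g n) r* for a large n, and y ≾ r (g n) r* ≾ g n ≾ a n. -/
theorem wayBelow_mk {x y : Stabilization A} {hy : 0 ≤ y} {hx : 0 ≤ x} {ε : ℝ} (hε : 0 < ε)
    (h : ∀ b, 0 ≤ b → ‖b - x‖ < ε → CuntzLE y b) : WayBelow (mk y hy) (mk x hx) := by
  intro s t hs ht hxt
  choose a ha hsa using fun n => exists_rep (s n)
  obtain ⟨G, g, hG0, haG, hg0, hga, hlim⟩ := Stabilization.exists_cuntz_sup ha fun n m hnm => by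
    have := hs hnm
    rwa [hsa n, hsa m] at this
  have htG : t ≤ mk G hG0 := ht.2 (by rintro _ ⟨n, rfl⟩; rw [hsa n]; exact haG n)
  have hxG : CuntzLE x G := hxt.trans htG
  obtain ⟨r, hr⟩ := cuntzLE_iff.mp hxG ε hε
  have hc : Continuous fun G : Stabilization A => dist (r * G * star r) x := by fun_prop
  obtain ⟨n, hn⟩ := ((hc.continuousAt.tendsto.comp hlim).eventually_lt_const hr).exists
  refine ⟨n, ?_⟩
  rw [hsa n]
  have h1 : CuntzLE y (r * g n * star r) := h _ (star_right_conjugate_nonneg (hg0 n) r)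
    (by rw [← dist_eq_norm]; exact hn)
  exact (h1.trans (CuntzLE.conj r (g n))).trans (hga n)

/-- The classes of the cut-downs of x at 1/(n + 1) increase to [x], because `CuntzLE` is closed in
its first argument. One of them is therefore above `x'`. -/
theorem exists_of_wayBelow {x : Stabilization A} {x' : Cu A} {hx : 0 ≤ x}
    (h : WayBelow x' (mk x hx)) : ∃ (y : Stabilization A) (hy : 0 ≤ y) (ε : ℝ), 0 < ε ∧
      x' ≤ mk y hy ∧ ∀ b, 0 ≤ b → ‖b - x‖ < ε → CuntzLE y b := by
  obtain ⟨y, hy0, hyx, hyapp, hymono⟩ := exists_cuntz_cutdown hx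
  have hn : ∀ n : ℕ, (0 : ℝ) < 1 / ((n : ℝ) + 1) := fun n => Nat.one_div_pos_of_nat
  obtain ⟨N, hN⟩ := h (fun n => mk (y (1 / ((n : ℝ) + 1))) (hy0 _ (hn n))) (mk x hx)
    (fun n m hnm => CuntzLE.of_le (hy0 _ (hn n))
      (hymono _ _ (hn m) (one_div_le_one_div_of_le (by positivity) (by gcongr)))) ⟨by
        rintro _ ⟨n, rfl⟩
        exact hyx _ (hn n) x hx (by simpa using hn n), by
        intro w hw
        obtain ⟨w, hw0, rfl⟩ := exists_rep w
        refine CuntzLE.of_forall_dist fun ε hε => ?_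
        obtain ⟨n, hn'⟩ := exists_nat_one_div_lt (half_pos hε)
        refine ⟨y (1 / ((n : ℝ) + 1)), ?_, hw ⟨n, rfl⟩⟩
        rw [dist_eq_norm]
        linarith [hyapp _ (hn n)]⟩ le_rfl
  exact ⟨y (1 / ((N : ℝ) + 1)), hy0 _ (hn N), 1 / ((N : ℝ) + 1), hn N, hN, hyx _ (hn N)⟩

end Cu

/-! ### Stable rank one of the stabilization -/

/-- The inverse is 1 - b(1 + ab)⁻¹a. The swap later moves an invertible element into a hereditary
subalgebra. -/
theorem IsUnit.one_add_mul_swap {R : Type*} [Ring R] {a b : R} (h : IsUnit (1 + a * b)) :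
    IsUnit (1 + b * a) := by
  obtain ⟨u, hu⟩ := h
  have h1 : (1 + a * b) * (↑u⁻¹ : R) = 1 := by rw [← hu]; exact u.mul_inv
  have h2 : (↑u⁻¹ : R) * (1 + a * b) = 1 := by rw [← hu]; exact u.inv_mul
  refine ⟨⟨1 + b * a, 1 - b * ↑u⁻¹ * a, ?_, ?_⟩, rfl⟩
  · calc (1 + b * a) * (1 - b * ↑u⁻¹ * a) = 1 + b * a - b * ((1 + a * b) * ↑u⁻¹) * a := by
          noncomm_ring
      _ = 1 := by rw [h1]; noncomm_ring
  · calc (1 - b * ↑u⁻¹ * a) * (1 + b * a) = 1 + b * a - b * (↑u⁻¹ * (1 + a * b)) * a := by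
          noncomm_ring
      _ = 1 := by rw [h2]; noncomm_ring

theorem isUnit_one_add_of_mul_self_eq_zero {R : Type*} [Ring R] {x : R} (h : x * x = 0) :
    IsUnit (1 + x) :=
  ⟨⟨1 + x, 1 - x, by rw [show (1 + x) * (1 - x) = 1 - x * x by noncomm_ring, h, sub_zero],
    by rw [show (1 - x) * (1 + x) = 1 - x * x by noncomm_ring, h, sub_zero]⟩, rfl⟩

/-- Invertibility of a block matrix `[[1 + a, b], [c, 1 + s + c (1 + a)⁻¹ b]]` by Schur complements. -/
theorem isUnit_one_add_schur {R : Type*} [Ring R] {a b c s q : R} (hq : q * (1 + a) = 1)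
    (hq' : (1 + a) * q = 1) (hs : IsUnit (1 + s)) (has : a * s = 0) (hsa : s * a = 0)
    (hcs : c * s = 0) (hsb : s * b = 0) (hcc : c * c = 0) (hbb : b * b = 0) (hac : a * c = 0)
    (hba : b * a = 0) : IsUnit (1 + (a + b + c + (s + c * q * b))) := by
  have hsq : s * q = s := by
    calc s * q = (s * (1 + a)) * q := by rw [mul_add, hsa, mul_one, add_zero]
      _ = s := by rw [mul_assoc, hq', mul_one]
  have hqc : q * c = c := by
    calc q * c = q * ((1 + a) * c) := by rw [add_mul, hac, one_mul, add_zero]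
      _ = c := by rw [← mul_assoc, hq, one_mul]
  have hbq : b * q = b := by
    calc b * q = (b * (1 + a)) * q := by rw [mul_add, hba, mul_one, add_zero]
      _ = b := by rw [mul_assoc, hq', mul_one]
  have h1 : IsUnit (1 + c * q) := isUnit_one_add_of_mul_self_eq_zero (by
    rw [mul_assoc, ← mul_assoc q, hqc, ← mul_assoc, hcc, zero_mul])
  have h2 : IsUnit (1 + q * b) := isUnit_one_add_of_mul_self_eq_zero (by
    rw [mul_assoc, ← mul_assoc b, hbq, hbb, mul_zero])
  have h3 : IsUnit (1 + a) := ⟨⟨1 + a, q, hq', hq⟩, rfl⟩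
  -- Lower triangular factor, the two diagonal blocks, upper triangular factor. The vanishing
  -- products among the hypotheses encode the block structure inside a single ring.
  have key : (1 + c * q) * (1 + a) * (1 + s) * (1 + q * b) =
      1 + (a + b + c + (s + c * q * b)) := by
    have e1 : (1 + c * q) * (1 + a) = 1 + a + c := by
      rw [add_mul, one_mul, mul_assoc, hq, mul_one]
    have e2 : (1 + a + c) * (1 + s) = 1 + a + c + s := by
      rw [mul_add, mul_one, add_mul, add_mul, has, hcs, one_mul]; abel
    have e3 : (1 + a + c + s) * (1 + q * b) = 1 + a + c + s + ((1 + a) * q * b + c * q * b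
        + s * q * b) := by noncomm_ring
    rw [e1, e2, e3, hq', hsq, hsb, one_mul]
    abel
  rw [← key]
  exact ((h1.mul h3).mul hs).mul h2

/-- The elements `y` of `B` such that `1 + y` is invertible in the unitization are dense. This is
the form in which stable rank one is inherited by stabilizations and hereditary subalgebras. -/
def DenseQuasiregular (B : Type*) [NonUnitalCStarAlgebra B] : Prop :=
  ∀ y : B, ∀ ε > 0, ∃ y' : B, ‖y' - y‖ < ε ∧ IsUnit (1 + (y' : Unitization ℂ B))

/-- If A has a unit e, an invertible x near e + y gives y' = x - e, and 1 + y' = (1 - e) + x is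
invertible in the unitization. Otherwise an invertible element of the unitization near 1 + y is
divided by its scalar part, which is close to 1. -/
theorem HasStableRankOne.denseQuasiregular {A : Type*} [NonUnitalCStarAlgebra A]
    (h : HasStableRankOne A) : DenseQuasiregular A := by
  intro y ε hε
  by_cases hA : ∃ e : A, IsUnitElement e
  · obtain ⟨e, he⟩ := hA
    obtain ⟨x, ⟨z, hxz, hzx⟩, hx⟩ := (h.unital e he).exists_dist_lt (e + y) hε
    refine ⟨x - e, ?_, ?_⟩
    · rw [dist_comm, dist_eq_norm] at hx
      rwa [sub_sub]
    · have mul : ∀ a b : A, a * b = e → (1 + ((a - e : A) : Unitization ℂ A)) *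
          (1 + ((b - e : A) : Unitization ℂ A)) = 1 := by
        intro a b hab
        rw [mul_add, add_mul, add_mul, one_mul, one_mul, mul_one, ← Unitization.inr_mul, sub_mul,
          mul_sub, mul_sub, hab, (he a).2, (he b).1, (he e).1, add_assoc, ← Unitization.inr_add,
          ← Unitization.inr_add]
        convert add_zero (1 : Unitization ℂ A)
        rw [← Unitization.inr_zero ℂ]
        congr 1
        abel
      exact ⟨⟨_, _, mul x z hxz, mul z x hzx⟩, rfl⟩
  · have hd := h.nonunital hA
    have hf : Continuous fun m : Unitization ℂ A => m.fst := by
      exact Unitization.continuous_fst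
    have hs : Continuous fun m : Unitization ℂ A => m.snd := Unitization.continuous_snd
    let m0 : Unitization ℂ A := 1 + (y : Unitization ℂ A)
    have h0 : m0.fst = 1 := by simp [m0]
    have h0' : m0.snd = y := by simp [m0]
    have hc : ContinuousAt (fun m : Unitization ℂ A => m.fst⁻¹ • m.snd) m0 :=
      (hf.continuousAt.inv₀ (by rw [h0]; exact one_ne_zero)).smul hs.continuousAt
    have h1 : ∀ᶠ m in 𝓝 m0, dist (m.fst⁻¹ • m.snd) y < ε := by
      have := hc.tendsto
      simp only [h0, h0', inv_one, one_smul] at this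
      exact Metric.tendsto_nhds.mp this ε hε
    have h2 : ∀ᶠ m in 𝓝 m0, m.fst ≠ 0 :=
      hf.continuousAt.eventually_ne (by rw [h0]; exact one_ne_zero)
    obtain ⟨m, ⟨hm1, hm2⟩, hm⟩ := mem_closure_iff_nhds.mp (hd m0) _ (h1.and h2)
    refine ⟨m.fst⁻¹ • m.snd, by rwa [← dist_eq_norm], ?_⟩
    have : 1 + ((m.fst⁻¹ • m.snd : A) : Unitization ℂ A) = m.fst⁻¹ • m := by
      ext
      · simp [hm2]
      · simp
    rw [this]
    rw [Algebra.smul_def]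
    exact ((isUnit_iff_ne_zero.mpr (inv_ne_zero hm2)).map (algebraMap ℂ _)).mul hm

namespace FinMat

variable {A : Type*} [NonUnitalCStarAlgebra A]

/-- The block of `x` with rows in `s` and columns in `t`. -/
def block (s t : Set ℕ) [DecidablePred (· ∈ s)] [DecidablePred (· ∈ t)] (x : FinMat A) :
    FinMat A :=
  mk (fun i j => if i ∈ s ∧ j ∈ t then x.entry i j else 0) (by
    obtain ⟨n, hn⟩ := x.exists_suppIn
    exact ⟨n, fun i j h => by rw [hn i j h, ite_self]⟩)

theorem entry_block (s t : Set ℕ) [DecidablePred (· ∈ s)] [DecidablePred (· ∈ t)] (x : FinMat A)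
    (i j : ℕ) : (block s t x).entry i j = if i ∈ s ∧ j ∈ t then x.entry i j else 0 := rfl

theorem mul_eq_zero_of_entry {x y : FinMat A} (h : ∀ k, (∀ i, x.entry i k = 0) ∨
    ∀ j, y.entry k j = 0) : x * y = 0 := by
  ext i j
  rw [entry_mul, entry_zero]
  refine finsum_eq_zero_of_forall_eq_zero fun k => ?_
  rcases h k with h | h
  · rw [h i, zero_mul]
  · rw [h j, mul_zero]

theorem mul_eq_single {x y : FinMat A} {n : ℕ} (hx : ∀ i j, i ≠ n → x.entry i j = 0)
    (hy : ∀ i j, j ≠ n → y.entry i j = 0) : x * y = single n n ((x * y).entry n n) := by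
  ext i j
  rw [entry_single]
  split_ifs with h
  · rw [h.1, h.2]
  · rw [entry_mul]
    refine finsum_eq_zero_of_forall_eq_zero fun k => ?_
    rw [not_and_or] at h
    rcases h with h | h
    · rw [hx i k h, zero_mul]
    · rw [hy k j h, mul_zero]

end FinMat

namespace DenseQuasiregular

variable {A : Type*} [NonUnitalCStarAlgebra A]

open CStarCompletion Stabilization

/-- Induction on the matrix size. The upper left block is perturbed to `a` with 1 + a invertible;
the last diagonal entry is then perturbed so that the Schur complement becomes invertible as well.
The off-diagonal blocks stay unchanged. -/
theorem exists_finMat (h : DenseQuasiregular A) (n : ℕ) : ∀ (y : FinMat A), FinMat.SuppIn n y →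
    ∀ ε > 0, ∃ y' : FinMat A, FinMat.SuppIn n y' ∧ ‖y' - y‖ < ε ∧
      IsUnit (1 + ((of y' : Stabilization A) : Unitization ℂ (Stabilization A))) := by
  induction n with
  | zero =>
    intro y hy ε hε
    have : y = 0 := FinMat.ext fun i j => hy i j (Or.inl (Nat.zero_le _))
    subst this
    exact ⟨0, hy, by simpa using hε, by simp⟩
  | succ n ih =>
    intro y hy ε hε
    have h11 : FinMat.SuppIn n (FinMat.block (Set.Iio n) (Set.Iio n) y) := fun i j hij => by
      rw [FinMat.entry_block, if_neg (by simp only [Set.mem_Iio]; omega)]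
    obtain ⟨a, ha, hay, hau⟩ := ih _ h11 (ε / 2) (half_pos hε)
    let b := FinMat.block (Set.Iio n) {n} y
    let c := FinMat.block {n} (Set.Iio n) y
    have hb1 : ∀ i j, n ≤ i → b.entry i j = 0 := fun i j hi =>
      if_neg (by simp only [Set.mem_Iio]; omega)
    have hb2 : ∀ i j, j ≠ n → b.entry i j = 0 := fun i j hi =>
      if_neg (by simp [hi])
    have hc1 : ∀ i j, n ≤ j → c.entry i j = 0 := fun i j hi =>
      if_neg (by simp only [Set.mem_Iio]; omega)
    have hc2 : ∀ i j, i ≠ n → c.entry i j = 0 := fun i j hi =>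
      if_neg (by simp [hi])
    obtain ⟨u, hu⟩ := hau
    let q : Unitization ℂ (Stabilization A) := ↑u⁻¹
    let w : Stabilization A := of c * lmul q (of b)
    -- As `c` is a single row and `b` a single column, c q b has only the entry at (n, n). This is
    -- checked separately for the scalar part of `q` and for its part in the stabilization.
    have hw : w = of (FinMat.single n n (entry n n w)) := by
      have key : ∀ x : Stabilization A, of c * x * of b =
          of (FinMat.single n n (entry n n (of c * x * of b))) := by
        intro x
        induction x using induction_on with
        | hp =>
          have hs : Continuous fun a : A => (of (FinMat.single n n a) : Stabilization A) :=
            ((AddMonoidHomClass.isometry_of_norm (FinMat.singleHom (A := A) n) fun a => by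
              change ‖of _‖ = _
              rw [norm_of, FinMat.norm_single]).continuous :)
          exact isClosed_eq (by fun_prop) (hs.comp (by fun_prop))
        | ih x =>
          rw [← of_mul, ← of_mul, entry_of]
          congr 1
          refine FinMat.mul_eq_single (fun i j hi => ?_) hb2
          rw [FinMat.entry_mul]
          exact finsum_eq_zero_of_forall_eq_zero fun k => by rw [hc2 i k hi, zero_mul]
      have key0 : of c * of b = (of (FinMat.single n n (entry n n (of c * of b))) :
          Stabilization A) := by
        rw [← of_mul, entry_of]
        congr 1
        exact FinMat.mul_eq_single hc2 hb2
      have hw' : w = q.fst • (of c * of b) + of c * q.snd * of b := by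
        simp only [w, lmul, mul_add, mul_smul_comm, mul_assoc]
      rw [hw', entry_add, entry_smul, FinMat.single_add, FinMat.single_smul, of_add, of_smul,
        ← key, ← key0]
    -- `t` approximates the corner entry minus that of c q b, so the new entry `t + entry n n w` has
    -- Schur complement 1 + t and stays close to the old one.
    obtain ⟨t, ht, htu⟩ := h (y.entry n n - entry n n w) (ε / 2) (half_pos hε)
    let s := FinMat.single n n t
    have hsu : IsUnit (1 + ((of s : Stabilization A) : Unitization ℂ (Stabilization A))) := by
      have := htu.map (Unitization.starMap (FinMat.singleHom (A := A) n))
      rwa [map_add, map_one, Unitization.starMap_inr] at this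
    have hs1 : ∀ i j, i ≠ n → s.entry i j = 0 := fun i j hi => if_neg (by simp [hi])
    have hs2 : ∀ i j, j ≠ n → s.entry i j = 0 := fun i j hi => if_neg (by simp [hi])
    refine ⟨a + b + c + FinMat.single n n (t + entry n n w), ?_, ?_, ?_⟩
    · refine (((ha.mono n.le_succ).add ?_).add ?_).add
        (FinMat.suppIn_single n.lt_succ_self n.lt_succ_self _)
      · intro i j hij
        change (if _ then _ else _) = _
        rw [hy i j hij, ite_self]
      · intro i j hij
        change (if _ then _ else _) = _
        rw [hy i j hij, ite_self]
    · have hdec : y = FinMat.block (Set.Iio n) (Set.Iio n) y + b + c +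
          FinMat.single n n (y.entry n n) := by
        ext i j
        simp only [b, c, FinMat.entry_add, FinMat.entry_block, FinMat.entry_single, Set.mem_Iio,
          Set.mem_singleton_iff]
        rcases lt_trichotomy i n with hi | rfl | hi
        · rcases lt_trichotomy j n with hj | rfl | hj
          · simp [hi, hj, hi.ne, hj.ne]
          · simp [hi, hi.ne]
          · simp [hi.ne, hj.ne', hj.not_gt, hy i j (by omega)]
        · rcases lt_trichotomy j i with hj | rfl | hj
          · simp [hj, hj.ne]
          · simp
          · simp [hj.ne', hj.not_gt, hy i j (by omega)]
        · simp [hi.ne', hi.not_gt, hy i j (by omega)]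
      have hd : a + b + c + FinMat.single n n (t + entry n n w) - y =
          (a - FinMat.block (Set.Iio n) (Set.Iio n) y) +
            FinMat.single n n (t - (y.entry n n - entry n n w)) := by
        have e : FinMat.single n n (t + entry n n w) = FinMat.single n n (y.entry n n) +
            FinMat.single n n (t - (y.entry n n - entry n n w)) := by
          rw [← FinMat.single_add]; congr 1; abel
        rw [e, sub_eq_iff_eq_add]
        calc _ = (a - FinMat.block (Set.Iio n) (Set.Iio n) y) +
              FinMat.single n n (t - (y.entry n n - entry n n w)) +
              (FinMat.block (Set.Iio n) (Set.Iio n) y + b + c +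
                FinMat.single n n (y.entry n n)) := by abel
          _ = _ := by rw [← hdec]
      rw [hd]
      refine (norm_add_le _ _).trans_lt ?_
      rw [FinMat.norm_single]
      linarith
    · have hmul : ∀ {x z : FinMat A}, x * z = 0 →
          ((of x : Stabilization A) : Unitization ℂ (Stabilization A)) * (of z : Stabilization A)
            = 0 := fun hxz => by
        rw [← Unitization.inr_mul, ← of_mul, hxz, of_zero, Unitization.inr_zero]
      have hz : ∀ {x z : FinMat A}, (∀ k, (∀ i, x.entry i k = 0) ∨ ∀ j, z.entry k j = 0) →
          ((of x : Stabilization A) : Unitization ℂ (Stabilization A)) * (of z : Stabilization A)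
            = 0 := fun hxz => hmul (FinMat.mul_eq_zero_of_entry hxz)
      have := isUnit_one_add_schur (a := ((of a : Stabilization A) : Unitization ℂ _))
        (b := ((of b : Stabilization A) : Unitization ℂ _))
        (c := ((of c : Stabilization A) : Unitization ℂ _)) (q := q)
        (by rw [← hu]; exact u.inv_mul) (by rw [← hu]; exact u.mul_inv) hsu
        (hz fun k => (eq_or_ne k n).imp (fun h i => ha _ _ (by omega)) fun h j => hs1 _ _ h)
        (hz fun k => (eq_or_ne k n).symm.imp (fun h i => hs2 _ _ h) fun h j => ha _ _ (by omega))
        (hz fun k => (eq_or_ne k n).imp (fun h i => hc1 _ _ h.ge) fun h j => hs1 _ _ h)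
        (hz fun k => (eq_or_ne k n).symm.imp (fun h i => hs2 _ _ h) fun h j => hb1 _ _ h.ge)
        (hz fun k => (eq_or_ne k n).imp (fun h i => hc1 _ _ h.ge) fun h j => hc2 _ _ h)
        (hz fun k => (eq_or_ne k n).symm.imp (fun h i => hb2 _ _ h) fun h j => hb1 _ _ h.ge)
        (hz fun k => (eq_or_ne k n).imp (fun h i => ha _ _ (by omega)) fun h j => hc2 _ _ h)
        (hz fun k => (eq_or_ne k n).symm.imp (fun h i => hb2 _ _ h) fun h j => ha _ _ (by omega))
      have hcqb : (((of c : Stabilization A) : Unitization ℂ (Stabilization A)) * q *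
          (of b : Stabilization A)) = (w : Stabilization A) := by
        rw [Unitization.inr_mul, inr_lmul, mul_assoc]
      have e : ((of (a + b + c + FinMat.single n n (t + entry n n w)) : Stabilization A) :
          Unitization ℂ (Stabilization A)) = (of a : Stabilization A) + (of b : Stabilization A) +
          (of c : Stabilization A) + ((of s : Stabilization A) + (w : Stabilization A)) := by
        rw [FinMat.single_add]
        simp only [of_add, Unitization.inr_add, ← hw]
        rfl
      rw [hcqb] at this
      rw [e]
      exact this

theorem stabilization (h : DenseQuasiregular A) : DenseQuasiregular (Stabilization A) := by
  intro y ε hε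
  obtain ⟨x, hx⟩ := (isDenseInducing_of (E := FinMat A)).dense.exists_dist_lt y (half_pos hε)
  obtain ⟨n, hn⟩ := x.exists_suppIn
  obtain ⟨x', -, hx', hu⟩ := exists_finMat h n x hn (ε / 2) (half_pos hε)
  refine ⟨of x', ?_, hu⟩
  rw [← norm_of, of_sub] at hx'
  rw [dist_eq_norm] at hx
  calc ‖of x' - y‖ = ‖(of x' - of x) + (of x - y)‖ := by congr 1; abel
    _ < ε := (norm_add_le _ _).trans_lt (by rw [norm_sub_rev y] at hx; linarith)

end DenseQuasiregular

/-! ### Polar decomposition of invertible elements -/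

section Polar

variable {C : Type*} [CStarAlgebra C] [PartialOrder C] [StarOrderedRing C]

theorem IsSelfAdjoint.norm_le_of_le_algebraMap {x : C} (hx : IsSelfAdjoint x) {s : ℝ} (hs : 0 ≤ s)
    (h1 : x ≤ algebraMap ℝ C s) (h2 : -x ≤ algebraMap ℝ C s) : ‖x‖ ≤ s := by
  rcases subsingleton_or_nontrivial C with _ | _
  · rwa [Subsingleton.elim x 0, norm_zero]
  rcases CStarAlgebra.norm_or_neg_norm_mem_spectrum hx with h | h
  · exact (le_algebraMap_iff_spectrum_le (ha := hx)).mp h1 _ h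
  · refine (le_algebraMap_iff_spectrum_le (a := -x) (ha := hx.neg)).mp h2 _ ?_
    rw [← spectrum.neg_eq]
    simpa using h

/-- With s² = ‖p² - q²‖ one has p² ≤ q² + s² ≤ (q + s)², and operator monotonicity of the square
root gives p ≤ q + s. The roles of p and q are symmetric. -/
theorem norm_sub_sq_le_norm_mul_self_sub {p q : C} (hp : 0 ≤ p) (hq : 0 ≤ q) :
    ‖p - q‖ ^ 2 ≤ ‖p * p - q * q‖ := by
  set s := Real.sqrt ‖p * p - q * q‖ with hs
  have hs0 : 0 ≤ s := Real.sqrt_nonneg _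
  have hss : s * s = ‖p * p - q * q‖ := Real.mul_self_sqrt (norm_nonneg _)
  have key : ∀ p q : C, 0 ≤ p → 0 ≤ q → s * s = ‖p * p - q * q‖ → p ≤ q + algebraMap ℝ C s := by
    intro p q hp hq h
    have h1 : p * p - q * q ≤ algebraMap ℝ C (s * s) := by
      rw [h]
      exact IsSelfAdjoint.le_algebraMap_norm_self
        ((IsSelfAdjoint.of_nonneg (hp.isSelfAdjoint.mul_self_nonneg)).sub
          (IsSelfAdjoint.of_nonneg (hq.isSelfAdjoint.mul_self_nonneg)))
    have hs' : (0 : C) ≤ algebraMap ℝ C s := algebraMap_nonneg C hs0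
    have h2 : p * p ≤ (q + algebraMap ℝ C s) * (q + algebraMap ℝ C s) := by
      have e : (q + algebraMap ℝ C s) * (q + algebraMap ℝ C s) =
          q * q + algebraMap ℝ C (s * s) + ((2 * s) • q) := by
        rw [add_mul, mul_add, mul_add, ← Algebra.commutes s q, map_mul, ← Algebra.smul_def,
          mul_smul, two_smul]
        abel
      rw [e]
      calc p * p = q * q + (p * p - q * q) := by abel
        _ ≤ q * q + algebraMap ℝ C (s * s) := by gcongr
        _ ≤ _ := le_add_of_nonneg_right (smul_nonneg (by positivity) hq)
    have h3 := CFC.sqrt_le_sqrt _ _ h2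
    rwa [CFC.sqrt_mul_self _ hp, CFC.sqrt_mul_self _ (add_nonneg hq hs')] at h3
  have h1 := key p q hp hq hss
  have h2 := key q p hq hp (by rw [hss, norm_sub_rev])
  rw [sq, ← hss]
  have : ‖p - q‖ ≤ s := IsSelfAdjoint.norm_le_of_le_algebraMap
    (hs := hs0) ((IsSelfAdjoint.of_nonneg hp).sub (IsSelfAdjoint.of_nonneg hq))
    (by rwa [sub_le_iff_le_add']) (by rwa [neg_sub, sub_le_iff_le_add'])
  gcongr

/-- The unitary part of an invertible element lies in every closed *-subalgebra containing it. -/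
theorem IsUnit.exists_unitary_mul_abs {g : C} (hg : IsUnit g) {S : StarSubalgebra ℝ C}
    (hS : IsClosed (S : Set C)) (hgS : g ∈ S) :
    ∃ w ∈ S, star w * w = 1 ∧ w * star w = 1 ∧ w * CFC.abs g = g := by
  set P : C := star g * g with hP
  have hP0 : 0 ≤ P := star_mul_self_nonneg g
  have hPu : IsUnit P := hg.star.mul hg
  have hPP : IsStrictlyPositive P := hPu.isStrictlyPositive hP0
  set k : C := P ^ (-(1 / 2) : ℝ) with hk
  have hks : star k = k := (IsSelfAdjoint.of_nonneg CFC.rpow_nonneg).star_eq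
  have hkPk : k * P * k = 1 := CFC.conjugate_rpow_neg_one_half P
  -- (g*g)^(-1/2) is a continuous function of g*g, so it lies in the closed star subalgebra
  -- generated by g*g.
  have hkS : k ∈ S := by
    refine StarAlgebra.elemental.le_of_mem hS (mul_mem (star_mem (S := StarSubalgebra ℝ C) hgS) hgS) ?_
    have := range_cfc_nnreal_subset (a := P) hP0
    exact (this ⟨fun x => x ^ (-(1 / 2) : ℝ), rfl⟩).1
  have hka : k * CFC.abs g = 1 := by
    rw [CFC.abs, CFC.sqrt_eq_rpow, ← hP, hk, ← CFC.rpow_add hPu]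
    norm_num
    exact CFC.rpow_zero P
  have hw1 : star (g * k) * (g * k) = 1 := by
    rw [star_mul, hks, ← hkPk, hP]
    simp only [mul_assoc]
  have hku : IsUnit k := hPu.cfcRpow _ hP0
  refine ⟨g * k, S.mul_mem hgS hkS, hw1, ?_, ?_⟩
  · obtain ⟨u, hu⟩ := hg.mul hku
    rw [← hu] at hw1 ⊢
    have : star (u : C) = ↑u⁻¹ := Units.eq_inv_of_mul_eq_one_right hw1
    rw [this, u.mul_inv]
  · rw [mul_assoc, hka, mul_one]
end Polar

/-! ### Module rules for the left action of the unitization. -/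

namespace Unitization

variable {B : Type*} [NonUnitalCStarAlgebra B]

theorem lmul_add_left (m n : Unitization ℂ B) (x : B) : lmul (m + n) x = lmul m x + lmul n x :=
  Unitization.inr_injective (R := ℂ) (by simp only [inr_lmul, Unitization.inr_add, add_mul])

theorem lmul_mul_left (m n : Unitization ℂ B) (x : B) : lmul (m * n) x = lmul m (lmul n x) :=
  Unitization.inr_injective (R := ℂ) (by simp only [inr_lmul, mul_assoc])

theorem lmul_mul (m : Unitization ℂ B) (x y : B) : lmul m (x * y) = lmul m x * y :=
  Unitization.inr_injective (R := ℂ) (by simp only [inr_lmul, Unitization.inr_mul, mul_assoc])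

theorem lmul_algebraMap (c : ℂ) (x : B) : lmul (algebraMap ℂ _ c) x = c • x :=
  Unitization.inr_injective (R := ℂ)
    (by rw [inr_lmul, ← Algebra.smul_def, Unitization.inr_smul])

theorem lmul_inr (y x : B) : lmul (y : Unitization ℂ B) x = y * x := by simp [lmul]

theorem continuous_lmul_left (x : B) : Continuous fun m : Unitization ℂ B => lmul m x :=
  ((Unitization.continuous_fst (𝕜 := ℂ) (A := B)).smul continuous_const).add
    ((Unitization.continuous_snd (𝕜 := ℂ) (A := B)).mul continuous_const)

end Unitization

open Unitization

/-! ### Closed principal right ideals -/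

section RightIdeal

variable {B : Type*} [NonUnitalCStarAlgebra B]

/-- The closed right ideal of `B` generated by the elements `d k`. -/
def closedRightIdeal (d : B) : Submodule ℂ B :=
  (LinearMap.range (LinearMap.mulLeft ℂ d)).topologicalClosure

theorem mem_closedRightIdeal {d z : B} :
    z ∈ closedRightIdeal d ↔ ∀ ε > 0, ∃ k, ‖d * k - z‖ < ε := by
  change z ∈ closure (Set.range fun k => d * k) ↔ _
  simp only [Metric.mem_closure_range_iff, dist_comm z, dist_eq_norm]

theorem isClosed_closedRightIdeal (d : B) : IsClosed (closedRightIdeal d : Set B) :=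
  Submodule.isClosed_topologicalClosure _

theorem mul_mem_closedRightIdeal_self (d k : B) : d * k ∈ closedRightIdeal d :=
  Submodule.le_topologicalClosure _ ⟨k, rfl⟩

theorem mul_mem_closedRightIdeal {d z : B} (hz : z ∈ closedRightIdeal d) (x : B) :
    z * x ∈ closedRightIdeal d := by
  have hc : Continuous fun z : B => z * x := by fun_prop
  change z * x ∈ closure (Set.range fun k => d * k)
  refine map_mem_closure (f := fun z => z * x) hc hz ?_
  rintro _ ⟨k, rfl⟩
  exact ⟨k * x, (mul_assoc d k x).symm⟩

/-- The elements `m` of the unitization such that multiplication by `m` and `m*` from the left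
leaves the closed right ideal generated by `d` invariant. -/
def leftMultipliers (d : B) : StarSubalgebra ℝ (Unitization ℂ B) where
  carrier := {m | ∀ z ∈ closedRightIdeal d,
    lmul m z ∈ closedRightIdeal d ∧ lmul (star m) z ∈ closedRightIdeal d}
  mul_mem' := by
    intro m n hm hn z hz
    rw [star_mul, lmul_mul_left, lmul_mul_left]
    exact ⟨(hm _ (hn _ hz).1).1, (hn _ (hm _ hz).2).2⟩
  add_mem' := by
    intro m n hm hn z hz
    rw [star_add, lmul_add_left, lmul_add_left]
    exact ⟨add_mem (hm _ hz).1 (hn _ hz).1, add_mem (hm _ hz).2 (hn _ hz).2⟩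
  algebraMap_mem' := by
    intro c z hz
    rw [← algebraMap_star_comm, star_trivial,
      IsScalarTower.algebraMap_apply ℝ ℂ (Unitization ℂ B), lmul_algebraMap]
    exact ⟨Submodule.smul_mem _ _ hz, Submodule.smul_mem _ _ hz⟩
  star_mem' := by
    intro m hm z hz
    rw [star_star]
    exact ⟨(hm z hz).2, (hm z hz).1⟩

theorem isClosed_leftMultipliers (d : B) : IsClosed (leftMultipliers d : Set (Unitization ℂ B)) := by
  have : (leftMultipliers d : Set (Unitization ℂ B)) = ⋂ z ∈ closedRightIdeal d,
      {m | lmul m z ∈ closedRightIdeal d} ∩ {m | lmul (star m) z ∈ closedRightIdeal d} := by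
    ext m
    simp only [Set.mem_iInter]
    rfl
  rw [this]
  refine isClosed_biInter fun z _ => IsClosed.inter ?_ ?_
  · exact (isClosed_closedRightIdeal d).preimage (continuous_lmul_left z)
  · exact (isClosed_closedRightIdeal d).preimage ((continuous_lmul_left z).comp continuous_star)

theorem inr_mem_leftMultipliers {d y : B} (hy : y ∈ closedRightIdeal d)
    (hys : star y ∈ closedRightIdeal d) : (y : Unitization ℂ B) ∈ leftMultipliers d := fun z _ => by
  rw [← Unitization.inr_star, lmul_inr, lmul_inr]
  exact ⟨mul_mem_closedRightIdeal hy z, mul_mem_closedRightIdeal hys z⟩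

variable [PartialOrder B] [StarOrderedRing B]

/-- Take k = d(d² + κ²)⁻¹. Then dk = d²(d² + κ²)⁻¹ is a contraction, and dkd - d is given by the
function -tκ²/(t² + κ²), which is bounded by κ because 2|t|κ ≤ t² + κ². -/
theorem exists_approx_left_unit {d : B} (hd : 0 ≤ d) {κ : ℝ} (hκ : 0 < κ) :
    ∃ k : B, IsSelfAdjoint (d * k) ∧ ‖d * k‖ ≤ 1 ∧ ‖d * k * d - d‖ ≤ κ := by
  have hc : Continuous fun t : ℝ => t / (t ^ 2 + κ ^ 2) :=
    continuous_id.div (by fun_prop) fun t => by positivity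
  have h0 : (0 : ℝ) / (0 ^ 2 + κ ^ 2) = 0 := zero_div _
  have e1 : d * cfcₙ (fun t : ℝ => t / (t ^ 2 + κ ^ 2)) d =
      cfcₙ (fun t : ℝ => t * (t / (t ^ 2 + κ ^ 2))) d := by
    conv_lhs => enter [1]; rw [← cfcₙ_id ℝ d]
    rw [← cfcₙ_mul _ _ d (by fun_prop) rfl hc.continuousOn h0]
    rfl
  have hc1 : Continuous fun t : ℝ => t * (t / (t ^ 2 + κ ^ 2)) := continuous_id.mul hc
  refine ⟨cfcₙ (fun t : ℝ => t / (t ^ 2 + κ ^ 2)) d, ?_, ?_, ?_⟩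
  · rw [e1]; exact cfcₙ_predicate _ _
  · rw [e1]
    refine norm_cfcₙ_le fun t _ => ?_
    rw [Real.norm_eq_abs, abs_le]
    have : t * (t / (t ^ 2 + κ ^ 2)) = t ^ 2 / (t ^ 2 + κ ^ 2) := by ring
    rw [this]
    constructor
    · have : 0 ≤ t ^ 2 / (t ^ 2 + κ ^ 2) := by positivity
      linarith
    · rw [div_le_one (by positivity)]
      nlinarith
  · have e2 : d * cfcₙ (fun t : ℝ => t / (t ^ 2 + κ ^ 2)) d * d - d =
        cfcₙ (fun t : ℝ => t * (t / (t ^ 2 + κ ^ 2)) * t - t) d := by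
      rw [e1]
      conv_lhs => enter [1, 2]; rw [← cfcₙ_id ℝ d]
      conv_lhs => enter [2]; rw [← cfcₙ_id ℝ d]
      rw [← cfcₙ_mul _ _ d hc1.continuousOn (by simp) (by fun_prop) rfl,
        ← cfcₙ_sub _ _ d (by fun_prop) (by simp) (by fun_prop) rfl]
      rfl
    rw [e2]
    refine norm_cfcₙ_le fun t _ => ?_
    have : t * (t / (t ^ 2 + κ ^ 2)) * t - t = - (t * κ ^ 2 / (t ^ 2 + κ ^ 2)) := by
      field_simp
      ring
    rw [this, norm_neg, Real.norm_eq_abs, abs_div, abs_of_pos (a := t ^ 2 + κ ^ 2) (by positivity),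
      div_le_iff₀ (by positivity), abs_mul, abs_of_pos (a := κ ^ 2) (by positivity)]
    have := sq_nonneg (|t| - κ)
    have h2 := sq_abs t
    nlinarith [abs_nonneg t]

/-- With h = dk an approximate unit for d, ‖h√d - √d‖² = ‖(hd - d)h - (hd - d)‖ ≤ 2‖hd - d‖, and h√d
= d(k√d) belongs to dB. -/
theorem sqrt_mem_closedRightIdeal {d : B} (hd : 0 ≤ d) : CFC.sqrt d ∈ closedRightIdeal d := by
  rw [mem_closedRightIdeal]
  intro ε hε
  obtain ⟨k, hk, hk1, hkd⟩ := exists_approx_left_unit hd (κ := ε ^ 2 / 4) (by positivity)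
  refine ⟨k * CFC.sqrt d, ?_⟩
  rw [← mul_assoc]
  generalize d * k = h at *
  have hs : star (CFC.sqrt d) = CFC.sqrt d := (IsSelfAdjoint.of_nonneg (CFC.sqrt_nonneg d)).star_eq
  refine lt_of_pow_lt_pow_left₀ 2 hε.le ?_
  have e : (h * CFC.sqrt d - CFC.sqrt d) * star (h * CFC.sqrt d - CFC.sqrt d) =
      (h * d - d) * h - (h * d - d) := by
    rw [star_sub, star_mul, hs, hk.star_eq]
    have h1 : CFC.sqrt d * CFC.sqrt d = d := CFC.sqrt_mul_sqrt_self d hd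
    have h2 : ∀ x, CFC.sqrt d * (CFC.sqrt d * x) = d * x := fun x => by rw [← mul_assoc, h1]
    simp only [sub_mul, mul_sub, mul_assoc, h1, h2]
  rw [sq, ← CStarRing.norm_self_mul_star, e]
  calc _ ≤ ‖h * d - d‖ * ‖h‖ + ‖h * d - d‖ :=
        (norm_sub_le _ _).trans (add_le_add_left (norm_mul_le _ _) _)
    _ ≤ ε ^ 2 / 4 * 1 + ε ^ 2 / 4 := by gcongr
    _ < ε ^ 2 := by nlinarith [sq_nonneg ε, pow_pos hε 2]

/-- Approximate left units of the closed right ideal generated by `d`. -/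
theorem exists_approx_left_unit_of_mem {d y : B} (hd : 0 ≤ d) (hy : y ∈ closedRightIdeal d) {κ : ℝ}
    (hκ : 0 < κ) : ∃ k : B, IsSelfAdjoint (d * k) ∧ ‖d * k‖ ≤ 1 ∧ ‖d * k * y - y‖ < κ := by
  obtain ⟨l, hl⟩ := mem_closedRightIdeal.mp hy (κ / 3) (by positivity)
  obtain ⟨k, hk, hk1, hkd⟩ := exists_approx_left_unit hd (κ := κ / 3 / (‖l‖ + 1)) (by positivity)
  refine ⟨k, hk, hk1, ?_⟩
  have e : d * k * y - y = (d * k * d - d) * l + (d * l - y) - d * k * (d * l - y) := by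
    noncomm_ring
  rw [e]
  calc _ ≤ ‖d * k * d - d‖ * ‖l‖ + ‖d * l - y‖ + ‖d * k‖ * ‖d * l - y‖ := by
        refine (norm_sub_le _ _).trans ?_
        gcongr
        · exact (norm_add_le _ _).trans (add_le_add_left (norm_mul_le _ _) _)
        · exact norm_mul_le _ _
    _ < κ / 3 + κ / 3 + κ / 3 := by
        have h1 : ‖d * k * d - d‖ * ‖l‖ ≤ κ / 3 := by
          calc _ ≤ κ / 3 / (‖l‖ + 1) * ‖l‖ := by gcongr
            _ ≤ κ / 3 / (‖l‖ + 1) * (‖l‖ + 1) := by gcongr; linarith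
            _ = κ / 3 := by field_simp
        have h2 : ‖d * k‖ * ‖d * l - y‖ ≤ 1 * ‖d * l - y‖ := by gcongr
        linarith
    _ = κ := by ring

/-- If `B` has stable rank one, then elements of the hereditary subalgebra generated by `d` are
limits of invertible elements that act on the closed right ideal generated by `d`. -/
theorem DenseQuasiregular.exists_isUnit_near (hB : DenseQuasiregular B) {d y : B} (hd : 0 ≤ d)
    (hy : y ∈ closedRightIdeal d) (hys : star y ∈ closedRightIdeal d) {κ : ℝ} (hκ : 0 < κ) :
    ∃ g ∈ leftMultipliers d, IsUnit g ∧ ‖g - y‖ < κ := by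
  have hκ2 : (0 : ℝ) < κ / 2 := half_pos hκ
  have hκ2' : ((κ / 2 : ℝ) : ℂ) ≠ 0 := by exact_mod_cast hκ2.ne'
  -- The invertible element will be (κ/2)(1 + Z) with Z ≈ Y. The summand κ/2, the error in t and the
  -- error in h then add up to less than κ.
  set Y : B := ((κ / 2 : ℝ) : ℂ)⁻¹ • y with hY
  have hyY : y = ((κ / 2 : ℝ) : ℂ) • Y := (smul_inv_smul₀ hκ2' y).symm
  have hYR : Y ∈ closedRightIdeal d := Submodule.smul_mem _ _ hy
  have hYR' : star Y ∈ closedRightIdeal d := by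
    rw [hY, star_smul]; exact Submodule.smul_mem _ _ hys
  obtain ⟨k, hk, hk1, hkY⟩ := exists_approx_left_unit_of_mem hd hYR' (κ := 1 / 2) (by norm_num)
  have hkR := mul_mem_closedRightIdeal_self d k
  generalize d * k = h at *
  have hYh : ‖Y * h - Y‖ < 1 / 2 := by
    rw [← norm_star, star_sub, star_mul, hk.star_eq]; exact hkY
  have hcont : ContinuousAt (fun m : Unitization ℂ B => Ring.inverse m) 1 := by
    simpa using NormedRing.inverse_continuousAt (1 : (Unitization ℂ B)ˣ)
  have hev : ∀ᶠ m : Unitization ℂ B in 𝓝 1,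
      IsUnit m ∧ ‖Ring.inverse m - 1‖ < 1 / (2 * (‖Y‖ + 1)) := by
    refine Filter.Eventually.and (Units.isOpen.mem_nhds isUnit_one) ?_
    have := Metric.tendsto_nhds.mp hcont.tendsto (1 / (2 * (‖Y‖ + 1))) (by positivity)
    simpa only [Ring.inverse_one, dist_eq_norm] using this
  obtain ⟨δ, hδ, hδm⟩ := Metric.eventually_nhds_iff.mp hev
  obtain ⟨y', hy', hyu⟩ := hB (h * Y) δ hδ
  obtain ⟨hsu, hst⟩ := hδm (y := 1 + ((y' - h * Y : B) : Unitization ℂ B)) (by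
    rwa [dist_eq_norm, add_sub_cancel_left, Unitization.norm_inr])
  set t := Ring.inverse (1 + ((y' - h * Y : B) : Unitization ℂ B)) with ht
  have htu : IsUnit t := hsu.ringInverse
  have h1 : IsUnit (1 + (t * h) * (Y : Unitization ℂ B)) := by
    -- The perturbation `y'` need not lie in the hereditary subalgebra. Multiplying 1 + y' by t = (1
    -- + y' - hY)⁻¹ turns it into 1 + (th)Y, without losing invertibility.
    have : 1 + (t * h) * (Y : Unitization ℂ B) = t * (1 + (y' : Unitization ℂ B)) := by
      have e : 1 + (y' : Unitization ℂ B) =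
          (1 + ((y' - h * Y : B) : Unitization ℂ B)) + h * Y := by
        rw [Unitization.inr_sub, Unitization.inr_mul]; abel
      rw [e, mul_add, Ring.inverse_mul_cancel _ hsu, mul_assoc]
    rw [this]
    exact htu.mul hyu
  -- After the swap, Y(th) begins with Y and its adjoint begins with h, so both lie in the closed
  -- right ideal.
  have h2 := h1.one_add_mul_swap
  have hz : (Y : Unitization ℂ B) * (t * h) = ((Y * lmul t h : B) : Unitization ℂ B) := by
    rw [Unitization.inr_mul, inr_lmul]
  rw [hz] at h2
  have hzM : ((Y * lmul t h : B) : Unitization ℂ B) ∈ leftMultipliers d := by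
    refine inr_mem_leftMultipliers (mul_mem_closedRightIdeal hYR _) ?_
    have : star (Y * lmul t h) = h * lmul (star t) (star Y) := by
      refine Unitization.inr_injective (R := ℂ) ?_
      simp only [Unitization.inr_star, Unitization.inr_mul, inr_lmul, star_mul]
      rw [← Unitization.inr_star h, hk.star_eq, mul_assoc]
    rw [this]
    exact mul_mem_closedRightIdeal hkR _
  refine ⟨(κ / 2) • (1 + ((Y * lmul t h : B) : Unitization ℂ B)), ?_, ?_, ?_⟩
  · exact (leftMultipliers d).smul_mem (add_mem (one_mem _) hzM) _
  · rw [Algebra.smul_def]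
    exact ((isUnit_iff_ne_zero.mpr hκ2.ne').map (algebraMap ℝ _)).mul h2
  · have e : (κ / 2) • (1 + ((Y * lmul t h : B) : Unitization ℂ B)) - y =
        (κ / 2) • (1 + (Y * ((t - 1) * h) + ((Y * h - Y : B) : Unitization ℂ B))) := by
      rw [hyY, Unitization.inr_smul, Complex.coe_smul, ← smul_sub, ← hz, Unitization.inr_sub,
        Unitization.inr_mul, sub_mul, one_mul, mul_sub]
      congr 1
      abel
    have h3 : ‖(Y : Unitization ℂ B) * ((t - 1) * h)‖ ≤ 1 / 2 := by
      calc _ ≤ ‖Y‖ * (‖t - 1‖ * ‖h‖) := by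
            refine (norm_mul_le _ _).trans ?_
            rw [Unitization.norm_inr]
            gcongr
            refine (norm_mul_le _ _).trans ?_
            rw [Unitization.norm_inr]
        _ ≤ (‖Y‖ + 1) * (1 / (2 * (‖Y‖ + 1)) * 1) := by gcongr; linarith
        _ = 1 / 2 := by field_simp
    rw [e, norm_smul, Real.norm_of_nonneg hκ2.le]
    have h4 : ‖1 + ((Y : Unitization ℂ B) * ((t - 1) * h) +
        ((Y * h - Y : B) : Unitization ℂ B))‖ < 2 := by
      calc _ ≤ ‖(1 : Unitization ℂ B)‖ + (‖(Y : Unitization ℂ B) * ((t - 1) * h)‖ +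
            ‖((Y * h - Y : B) : Unitization ℂ B)‖) :=
            (norm_add_le _ _).trans (add_le_add_right (norm_add_le _ _) _)
        _ < 2 := by
            rw [Unitization.norm_inr, norm_one]
            linarith
    nlinarith

/-- If g is invertible and near y, with g = w|g|, then y ≈ w|y| because the modulus is continuous.
-/
theorem DenseQuasiregular.exists_unitary_mul_abs_near (hB : DenseQuasiregular B) {d y : B}
    (hd : 0 ≤ d) (hy : y ∈ closedRightIdeal d) (hys : star y ∈ closedRightIdeal d) {κ : ℝ}
    (hκ : 0 < κ) : ∃ w ∈ leftMultipliers d, star w * w = 1 ∧ w * star w = 1 ∧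
      ‖(y : Unitization ℂ B) - w * CFC.abs (y : Unitization ℂ B)‖ < κ := by
  obtain ⟨δ, hδ, hδy⟩ := Metric.continuousAt_iff.mp
    ((CFC.continuous_abs (A := Unitization ℂ B)).continuousAt (x := (y : Unitization ℂ B)))
    (κ / 2) (half_pos hκ)
  obtain ⟨g, hg, hgu, hgy⟩ := hB.exists_isUnit_near hd hy hys (lt_min hδ (half_pos hκ))
  obtain ⟨w, hw, hw1, hw2, hwg⟩ := hgu.exists_unitary_mul_abs (isClosed_leftMultipliers d) hg
  refine ⟨w, hw, hw1, hw2, ?_⟩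
  have h1 := hδy (x := g) (by rw [dist_eq_norm]; exact hgy.trans_le (min_le_left _ _))
  rw [dist_eq_norm] at h1
  have hgy' := hgy.trans_le (min_le_right _ _)
  have e : (y : Unitization ℂ B) - w * CFC.abs (y : Unitization ℂ B) =
      w * (CFC.abs g - CFC.abs (y : Unitization ℂ B)) - (g - y) := by
    rw [mul_sub, hwg]; abel
  have hwu : w ∈ unitary (Unitization ℂ B) := ⟨hw1, hw2⟩
  rw [e]
  refine (norm_sub_le _ _).trans_lt ?_
  rw [CStarRing.norm_mem_unitary_mul _ hwu]
  linarith

/-- The square (zz*)² = z(z*z)z* is close to z(z'*z')z* = pp*, hence to (wq)(wq)* = (wqw*)². Thus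
zz* ≈ wqw* by `norm_sub_sq_le_norm_mul_self_sub`, and expanding (z - wz')(z - wz')* leaves only this
difference and errors p - wq. -/
theorem norm_sub_unitary_mul_sq_le {C : Type*} [CStarAlgebra C] [PartialOrder C] [StarOrderedRing C]
    {z z' w : C} {M δ e : ℝ} (hM : 0 ≤ M) (hz : ‖z‖ ≤ M) (hz' : ‖z'‖ ≤ M) (hw : w ∈ unitary C)
    (hzz : ‖star z * z - star z' * z'‖ ≤ δ)
    (he : ‖z * star z' - w * (z' * star z')‖ ≤ e) :
    ‖z - w * z'‖ ^ 2 ≤ Real.sqrt (M ^ 2 * δ + 2 * M ^ 2 * e) + 2 * e := by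
  have hw1 : star w * w = 1 := hw.1
  set p := z * star z' with hp
  set q := z' * star z' with hq
  have hqs : star q = q := by rw [hq, star_mul, star_star]
  have hq0 : 0 ≤ w * q * star w := by
    have := star_right_conjugate_nonneg (mul_star_self_nonneg z') w
    exact this
  have hw1' : ∀ x, star w * (w * x) = x := fun x => by rw [← mul_assoc, hw1, one_mul]
  have hnp : ‖p‖ ≤ M * M := (norm_mul_le _ _).trans (by rw [norm_star]; gcongr)
  have hnq : ‖w * q‖ ≤ M * M := by
    rw [CStarRing.norm_mem_unitary_mul _ hw]
    exact (norm_mul_le _ _).trans (by rw [norm_star]; gcongr)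
  have h1 : ‖z * star z * (z * star z) - w * q * star w * (w * q * star w)‖ ≤
      M ^ 2 * δ + 2 * M ^ 2 * e := by
    have e1 : z * star z * (z * star z) - w * q * star w * (w * q * star w) =
        z * (star z * z - star z' * z') * star z + ((p - w * q) * star p +
          w * q * star (p - w * q)) := by
      simp only [hp, star_sub, star_mul, star_star, hqs, mul_sub, sub_mul, mul_assoc, hw1']
      abel
    rw [e1]
    calc _ ≤ ‖z‖ * ‖star z * z - star z' * z'‖ * ‖star z‖ + (‖p - w * q‖ * ‖star p‖ +
          ‖w * q‖ * ‖star (p - w * q)‖) := by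
          refine (norm_add_le _ _).trans (add_le_add ?_ ?_)
          · refine (norm_mul_le _ _).trans ?_
            gcongr
            exact norm_mul_le _ _
          · exact (norm_add_le _ _).trans (add_le_add (norm_mul_le _ _) (norm_mul_le _ _))
      _ ≤ M * δ * M + (e * (M * M) + M * M * e) := by
          rw [norm_star, norm_star, norm_star]
          have he0 : 0 ≤ e := (norm_nonneg _).trans he
          have hδ0 : 0 ≤ δ := (norm_nonneg _).trans hzz
          gcongr
      _ = _ := by ring
  have h2 : ‖z * star z - w * q * star w‖ ≤ Real.sqrt (M ^ 2 * δ + 2 * M ^ 2 * e) :=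
    Real.le_sqrt_of_sq_le ((norm_sub_sq_le_norm_mul_self_sub (mul_star_self_nonneg z) hq0).trans h1)
  have e2 : (z - w * z') * star (z - w * z') = (z * star z - w * q * star w) -
      ((p - w * q) * star w + w * star (p - w * q)) := by
    simp only [hp, hq, star_sub, star_mul, star_star, mul_sub, sub_mul, mul_assoc]
    abel
  rw [sq, ← CStarRing.norm_self_mul_star, e2]
  refine (norm_sub_le _ _).trans (add_le_add h2 ((norm_add_le _ _).trans ?_))
  rw [CStarRing.norm_mul_mem_unitary _ (Unitary.star_mem hw), CStarRing.norm_mem_unitary_mul _ hw,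
    norm_star, two_mul]
  exact add_le_add he he

/-- Two elements of a closed right ideal with nearly the same modulus differ, up to a small error,
by a unitary acting on the ideal. -/
theorem DenseQuasiregular.exists_unitary_near (hB : DenseQuasiregular B) {d : B} (hd : 0 ≤ d)
    (a : B) {ε : ℝ} (hε : 0 < ε) : ∃ δ > 0, ∀ z ∈ closedRightIdeal d, ∀ z' ∈ closedRightIdeal d,
      ‖star z * z - a‖ ≤ δ → ‖star z' * z' - a‖ ≤ δ →
      ∃ w ∈ leftMultipliers d, w ∈ unitary (Unitization ℂ B) ∧ ‖lmul w z' - z‖ < ε := by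
  set M := Real.sqrt (‖a‖ + 1) with hM
  have hM0 : 0 < M := Real.sqrt_pos.mpr (by positivity)
  have hMM : M ^ 2 = ‖a‖ + 1 := Real.sq_sqrt (by positivity)
  -- F δ is the final bound for the squared distance. It is continuous with F 0 = 0, which yields δ
  -- without an explicit formula.
  let F : ℝ → ℝ := fun δ => Real.sqrt (M ^ 2 * (2 * δ) + 2 * M ^ 2 * (Real.sqrt (2 * M ^ 2 * δ) + δ))
    + 2 * (Real.sqrt (2 * M ^ 2 * δ) + δ)
  have hF : Continuous F := by fun_prop
  have hF0 : F 0 < ε ^ 2 := by simp [F]; positivity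
  have hev : ∀ᶠ δ in 𝓝[>] (0 : ℝ), F δ < ε ^ 2 ∧ δ < 1 :=
    nhdsWithin_le_nhds ((hF.continuousAt.eventually_lt continuousAt_const hF0).and
      (gt_mem_nhds one_pos))
  obtain ⟨δ, ⟨hδF, hδ1⟩, hδ0⟩ := (hev.and self_mem_nhdsWithin).exists
  replace hδ0 : 0 < δ := hδ0
  refine ⟨δ, hδ0, fun z hz z' hz' hza hza' => ?_⟩
  have hnorm : ∀ z : B, ‖star z * z - a‖ ≤ δ → ‖z‖ ≤ M := by
    intro z hz
    refine Real.le_sqrt_of_sq_le ?_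
    rw [sq, ← CStarRing.norm_star_mul_self]
    calc _ = ‖(star z * z - a) + a‖ := by rw [sub_add_cancel]
      _ ≤ δ + ‖a‖ := (norm_add_le _ _).trans (by gcongr)
      _ ≤ _ := by linarith
  have hzM := hnorm z hza
  have hzM' := hnorm z' hza'
  have hzz : ‖star z * z - star z' * z'‖ ≤ 2 * δ := by
    calc _ = ‖(star z * z - a) - (star z' * z' - a)‖ := by congr 1; abel
      _ ≤ δ + δ := (norm_sub_le _ _).trans (add_le_add hza hza')
      _ = _ := by ring
  have hyR : star (z * star z') ∈ closedRightIdeal d := by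
    rw [star_mul, star_star]; exact mul_mem_closedRightIdeal hz' _
  obtain ⟨w, hw, hw1, hw2, hwy⟩ := hB.exists_unitary_mul_abs_near hd
    (mul_mem_closedRightIdeal hz (star z')) hyR hδ0
  have hwu : w ∈ unitary (Unitization ℂ B) := ⟨hw1, hw2⟩
  refine ⟨w, hw, hwu, ?_⟩
  set Y : Unitization ℂ B := ((z * star z' : B) : Unitization ℂ B) with hY
  set q : Unitization ℂ B := (z' : Unitization ℂ B) * star (z' : Unitization ℂ B) with hq
  -- |zz'*|² = z'(z*z)z'* ≈ (z'z'*)², so the modulus in the polar decomposition of zz'* is close to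
  -- z'z'*.
  have h1 : ‖CFC.abs Y - q‖ ≤ Real.sqrt (2 * M ^ 2 * δ) := by
    refine Real.le_sqrt_of_sq_le ((norm_sub_sq_le_norm_mul_self_sub (CFC.abs_nonneg _)
      (mul_star_self_nonneg _)).trans ?_)
    have e1 : CFC.abs Y * CFC.abs Y - q * q =
        ((z' * (star z * z - star z' * z') * star z' : B) : Unitization ℂ B) := by
      rw [CFC.abs_mul_abs, hY, hq]
      simp only [Unitization.inr_mul, Unitization.inr_star, Unitization.inr_sub, star_mul,
        star_star, mul_sub, sub_mul, mul_assoc]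
    rw [e1, Unitization.norm_inr]
    calc _ ≤ ‖z'‖ * ‖star z * z - star z' * z'‖ * ‖star z'‖ := by
          refine (norm_mul_le _ _).trans ?_
          gcongr
          exact norm_mul_le _ _
      _ ≤ M * (2 * δ) * M := by rw [norm_star]; gcongr
      _ = _ := by ring
  have h2 : ‖(z : Unitization ℂ B) * star (z' : Unitization ℂ B) - w * q‖ ≤
      Real.sqrt (2 * M ^ 2 * δ) + δ := by
    have e2 : (z : Unitization ℂ B) * star (z' : Unitization ℂ B) - w * q =
        w * (CFC.abs Y - q) + (Y - w * CFC.abs Y) := by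
      rw [hY, Unitization.inr_mul, Unitization.inr_star, mul_sub]; abel
    rw [e2]
    refine (norm_add_le _ _).trans (add_le_add ?_ hwy.le)
    rwa [CStarRing.norm_mem_unitary_mul _ hwu]
  have h3 := norm_sub_unitary_mul_sq_le (z := (z : Unitization ℂ B)) (z' := (z' : Unitization ℂ B))
    (w := w) hM0.le (by rwa [Unitization.norm_inr]) (by rwa [Unitization.norm_inr]) hwu
    (δ := 2 * δ) (by
      rw [← Unitization.inr_star, ← Unitization.inr_star, ← Unitization.inr_mul,
        ← Unitization.inr_mul, ← Unitization.inr_sub, Unitization.norm_inr]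
      exact hzz) h2
  refine lt_of_pow_lt_pow_left₀ 2 hε.le ?_
  rw [norm_sub_rev, ← Unitization.norm_inr (𝕜 := ℂ), Unitization.inr_sub, inr_lmul]
  exact h3.trans_lt hδF

/-- If `B` has stable rank one and `a ≾ d`, then `a = z* z` for some `z` in the closed right ideal
generated by `d`. -/
theorem DenseQuasiregular.exists_star_mul_self_eq (hB : DenseQuasiregular B) {a d : B}
    (hd : 0 ≤ d) (h : CuntzLE a d) : ∃ z ∈ closedRightIdeal d, star z * z = a := by
  choose δ hδ0 hδ using fun n : ℕ =>
    hB.exists_unitary_near hd a (ε := (1 / 2 : ℝ) ^ n) (by positivity)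
  let δ' : ℕ → ℝ := fun n => min (δ n) ((1 / 2) ^ n)
  have hδ' : ∀ n, 0 < δ' n := fun n => lt_min (hδ0 n) (by positivity)
  have approx : ∀ η > 0, ∃ z ∈ closedRightIdeal d, ‖star z * z - a‖ ≤ η := by
    intro η hη
    obtain ⟨r, hr⟩ := cuntzLE_iff.mp h η hη
    refine ⟨CFC.sqrt d * star r, mul_mem_closedRightIdeal (sqrt_mem_closedRightIdeal hd) _, ?_⟩
    have hs : star (CFC.sqrt d) = CFC.sqrt d := (IsSelfAdjoint.of_nonneg (CFC.sqrt_nonneg d)).star_eq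
    rw [star_mul, star_star, hs, mul_assoc, ← mul_assoc (CFC.sqrt d), CFC.sqrt_mul_sqrt_self d hd,
      ← mul_assoc, ← dist_eq_norm]
    exact hr.le
  obtain ⟨f, hf⟩ := exists_seq_of_step
    (P := fun n z => z ∈ closedRightIdeal d ∧ ‖star z * z - a‖ ≤ δ' n)
    (Q := fun n z z' => ‖z' - z‖ < (1 / 2 : ℝ) ^ n) (approx _ (hδ' 0)) (by
      rintro n z ⟨hz, hza⟩
      -- The tolerance at `n` allows the comparison with the previous z, and the one at `n + 1`
      -- keeps the induction going. Replacing z' by wz' leaves z'*z' unchanged.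
      obtain ⟨z', hz', hza'⟩ := approx _ (lt_min (hδ' n) (hδ' (n + 1)))
      obtain ⟨w, hw, hwu, hwz⟩ := hδ n z hz z' hz' (hza.trans (min_le_left _ _))
        (hza'.trans ((min_le_left _ _).trans (min_le_left _ _)))
      refine ⟨lmul w z', ⟨(hw z' hz').1, ?_⟩, hwz⟩
      have : star (lmul w z') * lmul w z' = star z' * z' := by
        refine Unitization.inr_injective (R := ℂ) ?_
        simp only [Unitization.inr_mul, Unitization.inr_star, inr_lmul, star_mul]
        rw [mul_assoc, ← mul_assoc (star w), hwu.1, one_mul]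
      rw [this]
      exact hza'.trans (min_le_right _ _))
  have hcau : CauchySeq f := by
    refine cauchySeq_of_le_geometric (1 / 2) 1 (by norm_num) fun n => ?_
    rw [dist_comm, dist_eq_norm, one_mul]
    exact (hf n).2.le
  obtain ⟨z, hz⟩ := cauchySeq_tendsto_of_complete hcau
  refine ⟨z, (isClosed_closedRightIdeal d).mem_of_tendsto hz (.of_forall fun n => (hf n).1.1), ?_⟩
  have hc : Continuous fun z : B => star z * z := by fun_prop
  refine tendsto_nhds_unique ((hc.tendsto z).comp hz) ?_
  rw [tendsto_iff_norm_sub_tendsto_zero]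
  refine squeeze_zero (fun _ => norm_nonneg _)
    (fun n => ((hf n).1.2).trans (min_le_right _ _)) ?_
  exact tendsto_pow_atTop_nhds_zero_of_lt_one (by norm_num) (by norm_num)

/-- Elements `z z*` with `z` in the closed right ideal generated by `b` are Cuntz below `b`. -/
theorem cuntzLE_mul_star_of_mem_closedRightIdeal {b z : B} (hb : 0 ≤ b)
    (hz : z ∈ closedRightIdeal b) : CuntzLE (z * star z) b := by
  refine CuntzLE.of_forall_dist fun ε hε => ?_
  have hc : Continuous fun z : B => z * star z := by fun_prop
  obtain ⟨δ, hδ, h⟩ := Metric.continuousAt_iff.mp (hc.continuousAt (x := z)) ε hε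
  obtain ⟨k, hk⟩ := mem_closedRightIdeal.mp hz δ hδ
  refine ⟨_, h (x := b * k) (by rwa [dist_eq_norm]), ?_⟩
  set s := CFC.sqrt b
  have hs : star s = s := (IsSelfAdjoint.of_nonneg (CFC.sqrt_nonneg b)).star_eq
  have hsb : s * s = b := CFC.sqrt_mul_sqrt_self b hb
  refine (CuntzLE.mul_star_self _).trans ?_
  have : star (b * k) * (b * k) = (star k * s) * b * star (star k * s) := by
    rw [star_mul, (IsSelfAdjoint.of_nonneg hb).star_eq, star_mul, star_star, hs, ← hsb]
    simp only [mul_assoc]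
  rw [this]
  exact CuntzLE.conj _ _

end RightIdeal

/-! ### Almost Riesz decomposition for stable rank one -/

namespace Stabilization

variable {A : Type*} [NonUnitalCStarAlgebra A]

open CStarCompletion

theorem rowMap_rowEven_symm_rowEven (x : Stabilization A) :
    rowMap rowEven.symm (rowMap rowEven x) = x := by
  rw [rowMap_rowMap, rowEven_symm_trans, rowMap_refl]

/-- The flip unitary, exchanging even and odd rows, is a multiplier of B. It is applied to P = r*,
where r diag(u, v) r* approximates diag(u, v). -/
theorem cuntzLE_diag_swap (u v : Stabilization A) : CuntzLE (diag u v) (diag v u) := by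
  refine CuntzLE.of_forall_dist fun ε hε => ?_
  obtain ⟨r, hr⟩ := cuntzLE_iff.mp (CuntzLE.refl (diag u v)) ε hε
  refine ⟨_, hr, ?_⟩
  let P := star r
  let X := rowMap rowOdd (rowMap rowEven.symm P) + rowMap rowEven (rowMap rowOdd.symm P)
  have hE : rowMap rowEven.symm X = rowMap rowOdd.symm P := by
    simp only [X, rowMap_add, rowMap_rowMap rowEven.symm, rowEven_symm_trans,
      rowEven_symm_trans_rowOdd, rowMap_refl, rowMap_bot, zero_add]
  have hO : rowMap rowOdd.symm X = rowMap rowEven.symm P := by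
    simp only [X, rowMap_add, rowMap_rowMap rowOdd.symm, rowOdd_symm_trans,
      rowOdd_symm_trans_rowEven, rowMap_refl, rowMap_bot, add_zero]
  have : r * diag u v * star r = star X * diag v u * X := by
    rw [mul_assoc, mul_assoc, star_mul_eq_rowEven_add_rowOdd X, rowMap_rowEven_symm_diag_mul,
      rowMap_rowOdd_symm_diag_mul, hE, hO, ← rowMap_rowEven_symm_diag_mul u v,
      ← rowMap_rowOdd_symm_diag_mul u v, add_comm, ← star_mul_eq_rowEven_add_rowOdd, star_star]
  rw [this]
  exact CuntzLE.conj' _ _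

theorem rowMap_rowEven_mem_closedRightIdeal {b c y : Stabilization A}
    (hy : y ∈ closedRightIdeal b) : rowMap rowEven y ∈ closedRightIdeal (diag b c) := by
  rw [mem_closedRightIdeal] at hy ⊢
  intro ε hε
  obtain ⟨k, hk⟩ := hy ε hε
  refine ⟨rowMap rowEven k, ?_⟩
  rw [diag_mul_rowMap_rowEven, ← rowMap_sub]
  exact (norm_rowMap_le _ _).trans_lt hk

theorem rowMap_rowEven_symm_mem_closedRightIdeal {b c y : Stabilization A}
    (hy : y ∈ closedRightIdeal (diag b c)) : rowMap rowEven.symm y ∈ closedRightIdeal b := by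
  rw [mem_closedRightIdeal] at hy ⊢
  intro ε hε
  obtain ⟨k, hk⟩ := hy ε hε
  refine ⟨rowMap rowEven.symm k, ?_⟩
  rw [← rowMap_rowEven_symm_diag_mul b c, ← rowMap_sub]
  exact (norm_rowMap_le _ _).trans_lt hk

theorem rowMap_rowOdd_symm_mem_closedRightIdeal {b c y : Stabilization A}
    (hy : y ∈ closedRightIdeal (diag b c)) : rowMap rowOdd.symm y ∈ closedRightIdeal c := by
  rw [mem_closedRightIdeal] at hy ⊢
  intro ε hε
  obtain ⟨k, hk⟩ := hy ε hε
  refine ⟨rowMap rowOdd.symm k, ?_⟩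
  rw [← rowMap_rowOdd_symm_diag_mul b c, ← rowMap_sub]
  exact (norm_rowMap_le _ _).trans_lt hk

/-- One half of almost Riesz decomposition: if `a ≾ diag(b, c)` and `x ≾ a, b`, then `b` can be
replaced by some `e ≾ a, b` that lies almost above `x`. -/
theorem exists_cuntzLE_diag (hS : DenseQuasiregular (Stabilization A)) {a b c x : Stabilization A}
    (hb : 0 ≤ b) (hc : 0 ≤ c) (h : CuntzLE a (diag b c)) (hxa : CuntzLE x a)
    (hxb : CuntzLE x b) {δ : ℝ} (hδ : 0 < δ) :
    ∃ e, 0 ≤ e ∧ CuntzLE a (diag e c) ∧ CuntzLE e a ∧ CuntzLE e b ∧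
      ∃ r, ‖r * e * star r - x‖ < δ := by
  have hD := diag_nonneg hb hc
  obtain ⟨z, hz, hza⟩ := hS.exists_star_mul_self_eq hD h
  set ε := Real.sqrt (δ / 2) with hε
  have hε0 : 0 < ε := Real.sqrt_pos.mpr (half_pos hδ)
  have hεε : ε * ε = δ / 2 := Real.mul_self_sqrt (half_pos hδ).le
  obtain ⟨η, hη, hηu⟩ := hS.exists_unitary_near hD x hε0
  obtain ⟨r, hr⟩ := cuntzLE_iff.mp hxa (min η (δ / 2)) (lt_min hη (half_pos hδ))
  obtain ⟨s, hs⟩ := cuntzLE_iff.mp hxb η hη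
  rw [dist_eq_norm] at hr hs
  have hss : star (CFC.sqrt b) = CFC.sqrt b := (IsSelfAdjoint.of_nonneg (CFC.sqrt_nonneg b)).star_eq
  have hsb : CFC.sqrt b * CFC.sqrt b = b := CFC.sqrt_mul_sqrt_self b hb
  -- Y lives in the b-rows with Y*Y ≈ x, and zr* also satisfies (zr*)*(zr*) = r a r* ≈ x. Rigidity
  -- gives a unitary w with wzr* ≈ Y; replacing z by wz preserves z*z = a.
  let Y := rowMap rowEven (CFC.sqrt b * star s)
  have hY : Y ∈ closedRightIdeal (diag b c) := rowMap_rowEven_mem_closedRightIdeal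
    (mul_mem_closedRightIdeal (sqrt_mem_closedRightIdeal hb) _)
  have hYY : star Y * Y = s * b * star s := by
    rw [star_rowMap_mul, rowMap_rowEven_symm_rowEven, star_mul, star_star, hss, mul_assoc,
      ← mul_assoc (CFC.sqrt b), hsb, mul_assoc]
  have hZZ : star (z * star r) * (z * star r) = r * a * star r := by
    rw [star_mul, star_star, mul_assoc, ← mul_assoc (star z), hza, mul_assoc]
  obtain ⟨w, hw, hwu, hwY⟩ := hηu Y hY (z * star r) (mul_mem_closedRightIdeal hz _)
    (by rw [hYY]; exact hs.le) (by rw [hZZ]; exact (hr.trans_le (min_le_left _ _)).le)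
  have hz' := (hw z hz).1
  rw [Unitization.lmul_mul] at hwY
  have hza' : star (Unitization.lmul w z) * Unitization.lmul w z = a := by
    refine Unitization.inr_injective (R := ℂ) ?_
    rw [← hza]
    simp only [Unitization.inr_mul, Unitization.inr_star, Unitization.inr_lmul, star_mul]
    rw [mul_assoc, ← mul_assoc (star w), hwu.1, one_mul]
  generalize Unitization.lmul w z = z' at *
  set u := rowMap rowEven.symm z' with hu
  set v := rowMap rowOdd.symm z' with hv
  have hsum : star u * u + star v * v = a := by
    rw [← hza', star_mul_eq_rowEven_add_rowOdd z' z']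
  refine ⟨star u * u, star_mul_self_nonneg u, ?_, ?_, ?_, r, ?_⟩
  · rw [← hsum]
    exact (cuntzLE_add_diag _ _).trans (CuntzLE.diag (CuntzLE.refl _)
      ((CuntzLE.star_mul_self v).trans (cuntzLE_mul_star_of_mem_closedRightIdeal hc
        (rowMap_rowOdd_symm_mem_closedRightIdeal hz'))))
  · refine CuntzLE.of_le (star_mul_self_nonneg u) ?_
    rw [← hsum]
    exact le_add_of_nonneg_right (star_mul_self_nonneg v)
  · exact (CuntzLE.star_mul_self u).trans (cuntzLE_mul_star_of_mem_closedRightIdeal hb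
        (rowMap_rowEven_symm_mem_closedRightIdeal hz'))
  -- Y has no odd rows, so v r*, the odd part of z'r* ≈ Y, is small. Hence r e r* = r a r* - (v
  -- r*)*(v r*) is still close to x.
  · have hvr : ‖v * star r‖ < ε := by
      have : v * star r = rowMap rowOdd.symm (z' * star r - Y) := by
        rw [rowMap_sub, rowMap_mul, rowMap_rowMap]
        simp [hv, rowOdd_symm_trans_rowEven]
      rw [this]
      exact (norm_rowMap_le _ _).trans_lt hwY
    have e : r * (star u * u) * star r - x = (r * a * star r - x) -
        star (v * star r) * (v * star r) := by
      rw [← hsum, star_mul, star_star]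
      simp only [mul_add, add_mul, mul_assoc]
      abel
    rw [e]
    refine (norm_sub_le _ _).trans_lt ?_
    rw [CStarRing.norm_star_mul_self]
    have h1 := hr.trans_le (min_le_right _ _)
    have h2 : ‖v * star r‖ * ‖v * star r‖ ≤ ε * ε := by gcongr
    linarith

end Stabilization

theorem WayBelow.mono {S : Type*} [PartialOrder S] {a a' b b' : S} (h : WayBelow a b)
    (ha : a' ≤ a) (hb : b ≤ b') : WayBelow a' b' := fun s t hs ht hbt =>
  (h s t hs ht (hb.trans hbt)).imp fun _ hN => ha.trans hN

/-- The Cuntz semigroup of a C*-algebra of stable rank one satisfies (O6+). -/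
theorem HasStableRankOne.strengthenedAlmostRiesz {A : Type*} [NonUnitalCStarAlgebra A]
    (hA : HasStableRankOne A) : StrengthenedAlmostRiesz (Cu A) := by
  have hS := hA.denseQuasiregular.stabilization
  have half : ∀ a b c x' x : Cu A, a ≤ b + c → WayBelow x' x → x ≤ a → x ≤ b →
      ∃ e, a ≤ e + c ∧ WayBelow x' e ∧ e ≤ a ∧ e ≤ b := by
    intro a b c x' x h hx hxa hxb
    obtain ⟨a, ha, rfl⟩ := Cu.exists_rep a
    obtain ⟨b, hb, rfl⟩ := Cu.exists_rep b
    obtain ⟨c, hc, rfl⟩ := Cu.exists_rep c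
    obtain ⟨x, hx0, rfl⟩ := Cu.exists_rep x
    -- y lies below everything within ε of x. Since r e r* is within ε/2 of x, there is room ε/2
    -- left to obtain [y] ≪ [r e r*] ≤ [e].
    obtain ⟨y, hy, ε, hε, hxy, hyx⟩ := Cu.exists_of_wayBelow hx
    obtain ⟨e, he, hae, hea, heb, r, hr⟩ :=
      Stabilization.exists_cuntzLE_diag hS hb hc h hxa hxb (half_pos hε)
    refine ⟨Cu.mk e he, hae, ?_, hea, heb⟩
    have hre : 0 ≤ r * e * star r := star_right_conjugate_nonneg he r
    refine (Cu.wayBelow_mk (hy := hy) (hx := hre) (half_pos hε) fun b hb0 hb => ?_).mono hxy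
      (Cu.mk_le_mk.mpr (CuntzLE.conj r e))
    refine hyx b hb0 ?_
    calc ‖b - x‖ = ‖(b - r * e * star r) + (r * e * star r - x)‖ := by congr 1; abel
      _ < ε := (norm_add_le _ _).trans_lt (by linarith)
  have swap : ∀ a b : Cu A, a + b ≤ b + a := by
    intro a b
    obtain ⟨a, ha, rfl⟩ := Cu.exists_rep a
    obtain ⟨b, hb, rfl⟩ := Cu.exists_rep b
    exact Stabilization.cuntzLE_diag_swap a b
  intro a b c x' x y' y h hx hxa hxb hy hya hyc
  obtain ⟨e, he, hxe, hea, heb⟩ := half a b c x' x h hx hxa hxb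
  -- The second application starts from a ≤ e + c, where b is already replaced, and so leaves e
  -- untouched.
  obtain ⟨f, hf, hyf, hfa, hfc⟩ := half a c e y' y (he.trans (swap _ _)) hy hya hyc
  exact ⟨e, f, hf.trans (swap _ _), ⟨hxe, hea, heb⟩, hyf, hfa, hfc⟩

/-! ### The nontrivial line bundle over the sphere -/

/-- The identity map of the unit circle does not extend to a nowhere vanishing function on the
plane. -/
theorem exists_circle_ne_of_forall_ne_zero {G : ℂ → ℂ} (hG : Continuous G) (h0 : ∀ ζ, G ζ ≠ 0) :
    ∃ ζ : ℂ, ‖ζ‖ = 1 ∧ G ζ ≠ ζ := by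
  by_contra! hcirc
  have huniv : IsSimplyConnected (Set.univ : Set ℂ) := by
    have := convex_univ.contractibleSpace (E := ℂ) Set.univ_nonempty
    exact (inferInstance : SimplyConnectedSpace (Set.univ : Set ℂ))
  obtain ⟨H, hH, hHG⟩ := Complex.exists_continuousOn_eqOn_exp_comp (X := ℂ) huniv isOpen_univ
    hG.continuousOn (by rintro ⟨ζ, -, h⟩; exact h0 ζ h)
  have hHc : Continuous H := continuousOn_univ.mp hH
  -- H is a logarithm of G. If G were the identity on the circle, k would be continuous and integer
  -- valued, hence constant; but k(2π) = k(0) - 1 since H is evaluated at the same point.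
  let k : ℝ → ℝ := fun θ => (H (Complex.exp (θ * Complex.I)) - θ * Complex.I).im / (2 * Real.pi)
  have hk : Continuous k := by fun_prop
  have hkZ : ∀ θ, ∃ n : ℤ, k θ = n := by
    intro θ
    have h1 : Complex.exp (H (Complex.exp (θ * Complex.I))) = Complex.exp (θ * Complex.I) := by
      have := hHG (Set.mem_univ (Complex.exp (θ * Complex.I)))
      rw [Function.comp_apply] at this
      rw [this, hcirc _ (Complex.norm_exp_ofReal_mul_I θ)]
    obtain ⟨n, hn⟩ := Complex.exp_eq_exp_iff_exists_int.mp h1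
    refine ⟨n, ?_⟩
    have : (H (Complex.exp (θ * Complex.I)) - θ * Complex.I).im = n * (2 * Real.pi) := by
      rw [hn]; simp
    simp only [k, this]
    field_simp
  choose n hn using hkZ
  have hnc : Continuous n := by
    rw [Int.isClosedEmbedding_coe_real.isEmbedding.continuous_iff]
    exact hk.congr hn
  have hnn : n 0 = n (2 * Real.pi) := (PreconnectedSpace.constant inferInstance hnc)
  have hk0 : k 0 = k (2 * Real.pi) := by rw [hn, hn, hnn]
  have e : Complex.exp (((2 * Real.pi : ℝ) : ℂ) * Complex.I) = Complex.exp (((0 : ℝ) : ℂ) * Complex.I) := by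
    simp
  simp only [k, e] at hk0
  have := Real.pi_pos
  field_simp at hk0
  simp at hk0
  linarith

/-- The unit sphere in `ℝ³`. -/
abbrev TwoSphere : Type := Metric.sphere (0 : EuclideanSpace ℝ (Fin 3)) 1

namespace TwoSphere

theorem sq_add_sq_add_sq (s : TwoSphere) : s.1 0 ^ 2 + s.1 1 ^ 2 + s.1 2 ^ 2 = 1 := by
  have h := s.2
  rw [mem_sphere_zero_iff_norm, EuclideanSpace.norm_eq, Real.sqrt_eq_one, Fin.sum_univ_three] at h
  simpa using h

/-- The radial retraction of the plane onto the unit disc. -/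
def retract (ζ : ℂ) : ℂ := ζ / ((max 1 ‖ζ‖ : ℝ) : ℂ)

theorem continuous_retract : Continuous retract :=
  continuous_id.div (by fun_prop) fun ζ => by
    exact_mod_cast (lt_of_lt_of_le one_pos (le_max_left 1 ‖ζ‖)).ne'

theorem normSq_retract_le (ζ : ℂ) : (retract ζ).re ^ 2 + (retract ζ).im ^ 2 ≤ 1 := by
  have h : ‖retract ζ‖ ≤ 1 := by
    have h0 : 0 < max 1 ‖ζ‖ := lt_of_lt_of_le one_pos (le_max_left 1 ‖ζ‖)
    rw [retract, norm_div, Complex.norm_real, Real.norm_of_nonneg h0.le, div_le_one h0]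
    exact le_max_right _ _
  have h1 := Complex.sq_norm (retract ζ)
  rw [Complex.normSq_apply] at h1
  nlinarith [norm_nonneg (retract ζ)]

/-- The point of the sphere of height `c √(1 - |ζ|²)`, for `c = ±1`, above a point of the disc. -/
def overDisc (c : ℝ) (hc : c ^ 2 = 1) (ζ : ℂ) : TwoSphere :=
  ⟨!₂[(retract ζ).re, (retract ζ).im,
    c * Real.sqrt (1 - ((retract ζ).re ^ 2 + (retract ζ).im ^ 2))], by
    rw [mem_sphere_zero_iff_norm, EuclideanSpace.norm_eq, Real.sqrt_eq_one, Fin.sum_univ_three]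
    have := Real.sq_sqrt (sub_nonneg.mpr (normSq_retract_le ζ))
    simp [mul_pow, hc, this]⟩

theorem continuous_overDisc (c : ℝ) (hc : c ^ 2 = 1) : Continuous (overDisc c hc) := by
  refine Continuous.subtype_mk ?_ _
  have := continuous_retract
  refine (PiLp.continuous_toLp 2 _).comp (continuous_pi fun i => ?_)
  fin_cases i <;> simp <;> fun_prop

/-- The range of the Bott projection is a line bundle without nowhere vanishing sections. -/
theorem exists_eq_zero_of_section {η₁ η₂ : TwoSphere → ℂ} (hη₁ : Continuous η₁)
    (hη₂ : Continuous η₂)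
    (h1 : ∀ s : TwoSphere, (1 - s.1 2) * η₁ s = (s.1 0 - s.1 1 * Complex.I) * η₂ s)
    (h2 : ∀ s : TwoSphere, (1 + s.1 2) * η₂ s = (s.1 0 + s.1 1 * Complex.I) * η₁ s) :
    ∃ s, η₁ s = 0 ∧ η₂ s = 0 := by
  by_contra! hne
  -- At heights ≥ 0 the factor 1 + z is nonzero, so the first coordinate determines the second one
  -- and cannot vanish; at heights ≤ 0 the roles are exchanged.
  have hN : ∀ s : TwoSphere, 0 ≤ s.1 2 → η₁ s ≠ 0 := by
    intro s hs h
    have h3 := h2 s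
    rw [h, mul_zero, mul_eq_zero] at h3
    rcases h3 with h3 | h3
    · have : (1 + s.1 2 : ℝ) = 0 := Complex.ofReal_injective (by push_cast; exact h3)
      linarith
    · exact hne s h h3
  have hS : ∀ s : TwoSphere, s.1 2 ≤ 0 → η₂ s ≠ 0 := by
    intro s hs h
    have h3 := h1 s
    rw [h, mul_zero, mul_eq_zero] at h3
    rcases h3 with h3 | h3
    · have : (1 - s.1 2 : ℝ) = 0 := Complex.ofReal_injective (by push_cast; exact h3)
      linarith
    · exact hne s h3 h
  let u := overDisc 1 (by norm_num)
  let l := overDisc (-1) (by norm_num)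
  have hu : Continuous u := continuous_overDisc _ _
  have hl : Continuous l := continuous_overDisc _ _
  have hu0 : ∀ ζ, η₁ (u ζ) ≠ 0 := fun ζ => hN _ (by
    simp only [u, overDisc]; simp)
  have hl0 : ∀ ζ, η₂ (l ζ) ≠ 0 := fun ζ => hS _ (by
    simp only [l, overDisc]; simp)
  -- This quotient is the clutching function. On the unit circle both lifts agree with the point of
  -- the equator, where the second relation reads η₂ = ζ η₁.
  obtain ⟨ζ, hζ, hG⟩ := exists_circle_ne_of_forall_ne_zero (G := fun ζ => η₂ (l ζ) / η₁ (u ζ))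
    ((hη₂.comp hl).div (hη₁.comp hu) hu0) (fun ζ => div_ne_zero (hl0 ζ) (hu0 ζ))
  have hr : retract ζ = ζ := by simp [retract, hζ]
  have hsq : ζ.re ^ 2 + ζ.im ^ 2 = 1 := by
    have := Complex.sq_norm ζ
    rw [hζ, Complex.normSq_apply] at this
    linarith
  have hul : l ζ = u ζ := by
    simp only [l, u, overDisc, hr, hsq]
    simp
  have h3 := h2 (u ζ)
  have e0 : (u ζ).1 0 = ζ.re := by simp only [u, overDisc, hr]; simp
  have e1 : (u ζ).1 1 = ζ.im := by simp only [u, overDisc, hr]; simp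
  have e2 : (u ζ).1 2 = 0 := by simp only [u, overDisc, hr, hsq]; simp
  rw [e0, e1, e2, Complex.re_add_im] at h3
  refine hG ?_
  simp only [hul]
  rw [div_eq_iff (hu0 ζ), ← h3]
  simp

end TwoSphere

/-! ### Matrices of size two -/

namespace FinMat

variable {A : Type*} [NonUnitalCStarAlgebra A]

/-- The matrix with upper left corner `[[a, b], [c, d]]` and all other entries zero. -/
def twoByTwo (a b c d : A) : FinMat A := lift 2 (CStarMatrix.ofMatrix !![a, b; c, d])

theorem suppIn_twoByTwo (a b c d : A) : SuppIn 2 (twoByTwo a b c d) := suppIn_lift 2 _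

@[simp] theorem entry_twoByTwo_zero_zero (a b c d : A) : (twoByTwo a b c d).entry 0 0 = a := rfl
@[simp] theorem entry_twoByTwo_zero_one (a b c d : A) : (twoByTwo a b c d).entry 0 1 = b := rfl
@[simp] theorem entry_twoByTwo_one_zero (a b c d : A) : (twoByTwo a b c d).entry 1 0 = c := rfl
@[simp] theorem entry_twoByTwo_one_one (a b c d : A) : (twoByTwo a b c d).entry 1 1 = d := rfl

theorem twoByTwo_mul (a b c d a' b' c' d' : A) :
    twoByTwo a b c d * twoByTwo a' b' c' d' =
      twoByTwo (a * a' + b * c') (a * b' + b * d') (c * a' + d * c') (c * b' + d * d') := by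
  rw [twoByTwo, twoByTwo, twoByTwo, ← lift_mul]
  congr 1
  ext i j
  fin_cases i <;> fin_cases j <;> simp [CStarMatrix.mul_apply, Fin.sum_univ_two]

theorem star_twoByTwo (a b c d : A) :
    star (twoByTwo a b c d) = twoByTwo (star a) (star c) (star b) (star d) := by
  rw [twoByTwo, twoByTwo, ← lift_star]
  congr 1
  ext i j
  fin_cases i <;> fin_cases j <;> simp [CStarMatrix.star_apply]

theorem twoByTwo_sub_smul (a b : A) (r : ℂ) :
    twoByTwo a 0 0 0 - r • twoByTwo b 0 0 0 = twoByTwo (a - r • b) 0 0 0 := by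
  rw [sub_eq_iff_eq_add, twoByTwo, twoByTwo, twoByTwo, ← lift_smul, ← lift_add]
  congr 1
  ext i j
  fin_cases i <;> fin_cases j <;> simp

theorem single_zero_zero (a : A) : single 0 0 a = twoByTwo a 0 0 0 := by
  ext i j
  rw [entry_single, twoByTwo, entry_lift]
  by_cases h : i < 2 ∧ j < 2
  · obtain ⟨hi, hj⟩ := h
    interval_cases i <;> interval_cases j <;> simp
  · rw [dif_neg h, if_neg (by omega)]

/-- Under the even-odd indexing, the places 0 of the two summands become the places 0 and 1. -/
theorem diag_twoByTwo (a b : A) :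
    diag (twoByTwo a 0 0 0) (twoByTwo b 0 0 0) = twoByTwo a 0 0 b := by
  rw [← single_zero_zero, ← single_zero_zero]
  refine ext_sum fun s t => ?_
  rw [entry_diag, twoByTwo, entry_lift]
  rcases s with i | i <;> rcases t with j | j
  · rcases i with _ | i <;> rcases j with _ | j <;> simp [entry_single] <;> intros <;> omega
  · rcases i with _ | i <;> rcases j with _ | j <;> simp
    intros; omega
  · rcases i with _ | i <;> rcases j with _ | j <;> simp
    intros; omega
  · rcases i with _ | i <;> rcases j with _ | j <;> simp [entry_single]

end FinMat

namespace Stabilization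

open CStarCompletion

section

variable {A : Type*} [NonUnitalCStarAlgebra A]

theorem entry_of_mul {n : ℕ} {x : FinMat A} (hx : FinMat.SuppIn n x) (y : Stabilization A)
    (i j : ℕ) : entry i j (of x * y) = ∑ k ∈ Finset.range n, x.entry i k * entry k j y := by
  induction y using induction_on with
  | hp =>
    exact isClosed_eq (by fun_prop)
      (continuous_finsetSum _ fun k _ => continuous_const.mul (continuous_entry k j))
  | ih y =>
    rw [← of_mul, entry_of, FinMat.entry_mul_of_suppIn hx]
    simp only [entry_of]

theorem entry_diag (x y : Stabilization A) (s t : ℕ ⊕ ℕ) :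
    entry (Equiv.natSumNatEquivNat s) (Equiv.natSumNatEquivNat t) (diag x y) =
      Matrix.fromBlocks (Matrix.of fun i j => entry i j x) 0 0 (Matrix.of fun i j => entry i j y)
        s t := by
  induction x, y using induction_on₂ with
  | hp =>
    refine isClosed_eq ((continuous_entry _ _).comp continuous_diag) ?_
    rcases s with s | s <;> rcases t with t | t
    · exact (continuous_entry _ _).comp continuous_fst
    · exact continuous_const
    · exact continuous_const
    · exact (continuous_entry _ _).comp continuous_snd
  | ih x y =>
    rw [diag_of, entry_of, FinMat.entry_diag]
    rcases s with s | s <;> rcases t with t | t <;> simp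

end

section Unital

variable {A : Type*} [CStarAlgebra A]

/-- The matrix unit `e₀₀`. -/
def unitZero (A : Type*) [CStarAlgebra A] : Stabilization A := of (FinMat.twoByTwo (1 : A) 0 0 0)

theorem star_unitZero : star (unitZero A) = unitZero A := by
  rw [unitZero, ← of_star, FinMat.star_twoByTwo, star_one, star_zero]

theorem unitZero_mul_self : unitZero A * unitZero A = unitZero A := by
  rw [unitZero, ← of_mul, FinMat.twoByTwo_mul]; simp

theorem unitZero_mul_mul_unitZero (y : Stabilization A) :
    unitZero A * y * unitZero A = of (FinMat.single 0 0 (entry 0 0 y)) := by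
  induction y using induction_on with
  | hp =>
    have hs : Continuous fun a : A => (of (FinMat.single 0 0 a) : Stabilization A) :=
      ((AddMonoidHomClass.isometry_of_norm (FinMat.singleHom (A := A) 0) fun a => by
        change ‖of _‖ = _
        rw [norm_of, FinMat.norm_single]).continuous :)
    exact isClosed_eq (by fun_prop) (hs.comp (by fun_prop))
  | ih y =>
    rw [unitZero, ← of_mul, ← of_mul, entry_of, ← FinMat.single_zero_zero]
    have h1 : ∀ i j, (FinMat.single 0 0 (1 : A) * y).entry i j =
        if i = 0 then y.entry 0 j else 0 := fun i j => by
      rw [FinMat.entry_mul, finsum_eq_single _ 0 fun k hk => by simp [FinMat.entry_single, hk]]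
      simp [FinMat.entry_single]
    congr 1
    rw [FinMat.mul_eq_single (n := 0) (x := FinMat.single 0 0 (1 : A) * y)
      (y := FinMat.single 0 0 (1 : A)) (fun i j hi => by rw [h1, if_neg hi])
      (fun i j hj => if_neg (by simp [hj])), FinMat.entry_mul, finsum_eq_single _ 0 fun k hk => by
        simp [FinMat.entry_single, hk], h1]
    simp [FinMat.entry_single]

end Unital

/-! ### Stabilizations of commutative C*-algebras -/

section Commutative

variable {X : Type*} [TopologicalSpace X] [CompactSpace X]

/-- All entries of `y` vanish at the point `s`. -/
def VanishesAt (s : X) (y : Stabilization C(X, ℂ)) : Prop := ∀ i j, entry i j y s = 0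

theorem VanishesAt.of_forall_dist {s : X} {y : Stabilization C(X, ℂ)}
    (h : ∀ ε > 0, ∃ z, ‖z - y‖ < ε ∧ VanishesAt s z) : VanishesAt s y := by
  intro i j
  by_contra hne
  obtain ⟨z, hz, hzs⟩ := h ‖entry i j y s‖ (norm_pos_iff.mpr hne)
  have h1 : ‖entry i j y s‖ ≤ ‖z - y‖ := by
    calc ‖entry i j y s‖ = ‖entry i j (z - y) s‖ := by
          rw [entry_sub, ContinuousMap.sub_apply, hzs i j, zero_sub, norm_neg]
      _ ≤ ‖entry i j (z - y)‖ := ContinuousMap.norm_coe_le_norm _ _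
      _ ≤ _ := norm_entry_le _ _ _
  exact absurd hz (not_lt.mpr h1)

/-- Clear for finite matrices on the left, and vanishing at a point survives limits. The elements
vanishing at `s` thus form a closed two-sided ideal, which serves as the kernel of evaluation at
`s`. -/
theorem VanishesAt.mul_left {s : X} {y : Stabilization C(X, ℂ)} (hy : VanishesAt s y)
    (x : Stabilization C(X, ℂ)) : VanishesAt s (x * y) := by
  refine VanishesAt.of_forall_dist fun ε hε => ?_
  have hc : Continuous fun x => x * y := by fun_prop
  obtain ⟨δ, hδ, h⟩ := Metric.continuousAt_iff.mp (hc.continuousAt (x := x)) ε hε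
  obtain ⟨x', hx'⟩ := (isDenseInducing_of (E := FinMat C(X, ℂ))).dense.exists_dist_lt x hδ
  refine ⟨of x' * y, by rw [← dist_eq_norm]; exact h (by rwa [dist_comm]), fun i j => ?_⟩
  obtain ⟨n, hn⟩ := x'.exists_suppIn
  rw [entry_of_mul hn, ContinuousMap.sum_apply]
  exact Finset.sum_eq_zero fun k _ => by rw [ContinuousMap.mul_apply, hy, mul_zero]

theorem VanishesAt.star {s : X} {y : Stabilization C(X, ℂ)} (hy : VanishesAt s y) :
    VanishesAt s (star y) := fun i j => by
  rw [entry_star, ContinuousMap.star_apply, hy, star_zero]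

theorem VanishesAt.mul_right {s : X} {y : Stabilization C(X, ℂ)} (hy : VanishesAt s y)
    (x : Stabilization C(X, ℂ)) : VanishesAt s (y * x) := by
  have := (hy.star.mul_left (Star.star x)).star
  rwa [star_mul, star_star, star_star] at this

theorem VanishesAt.diag {s : X} {x y : Stabilization C(X, ℂ)} (hx : VanishesAt s x)
    (hy : VanishesAt s y) : VanishesAt s (diag x y) := fun i j => by
  obtain ⟨i, rfl⟩ := Equiv.natSumNatEquivNat.surjective i
  obtain ⟨j, rfl⟩ := Equiv.natSumNatEquivNat.surjective j
  rw [entry_diag]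
  rcases i with i | i <;> rcases j with j | j
  · exact hx i j
  · rfl
  · rfl
  · exact hy i j

end Commutative

end Stabilization

/-- The closed right ideal of e² contains its square root e, hence everything in eB, hence also √e;
and e = √e (√e)*. -/
theorem cuntzLE_mul_self {B : Type*} [NonUnitalCStarAlgebra B] [PartialOrder B] [StarOrderedRing B]
    {e : B} (he : 0 ≤ e) : CuntzLE e (e * e) := by
  set t := CFC.sqrt e
  have hts : star t = t := (IsSelfAdjoint.of_nonneg (CFC.sqrt_nonneg e)).star_eq
  have htt : t * t = e := CFC.sqrt_mul_sqrt_self e he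
  have hee : 0 ≤ e * e := he.isSelfAdjoint.mul_self_nonneg
  have h1 : e ∈ closedRightIdeal (e * e) := by
    have := sqrt_mem_closedRightIdeal hee
    rwa [CFC.sqrt_mul_self e he] at this
  have h2 : t ∈ closedRightIdeal (e * e) := by
    refine closure_minimal ?_ (isClosed_closedRightIdeal (e * e)) (sqrt_mem_closedRightIdeal he)
    rintro _ ⟨k, rfl⟩
    exact mul_mem_closedRightIdeal h1 k
  have := cuntzLE_mul_star_of_mem_closedRightIdeal hee h2
  rwa [hts, htt] at this

/-! ### Cuntz comparison with the Bott projection -/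

namespace TwoSphere

open CStarCompletion Stabilization

/-- A real function, as a complex function. -/
def complexify (k : C(TwoSphere, ℝ)) : C(TwoSphere, ℂ) := ⟨fun s => (k s : ℂ), by fun_prop⟩

@[simp] theorem complexify_apply (k : C(TwoSphere, ℝ)) (s : TwoSphere) :
    complexify k s = (k s : ℂ) := rfl

/-- The matrix whose only nonzero entry is the real function `k`, at `(0, 0)`. -/
def corner (k : C(TwoSphere, ℝ)) : Stabilization C(TwoSphere, ℂ) :=
  of (FinMat.twoByTwo (complexify k) 0 0 0)

theorem corner_mul (k l : C(TwoSphere, ℝ)) : corner k * corner l = corner (k * l) := by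
  rw [corner, corner, corner, ← of_mul, FinMat.twoByTwo_mul]
  simp only [mul_zero, zero_mul, add_zero]
  congr 2
  ext s
  simp

theorem star_corner (k : C(TwoSphere, ℝ)) : star (corner k) = corner k := by
  rw [corner, ← of_star, FinMat.star_twoByTwo, star_zero]
  congr 2
  ext s
  simp

theorem corner_sub_smul (k l : C(TwoSphere, ℝ)) (r : ℝ) :
    corner k - r • corner l = corner (k - r • l) := by
  rw [← Complex.coe_smul, corner, corner, corner, ← of_smul, ← of_sub, FinMat.twoByTwo_sub_smul]
  congr 2
  ext s
  simp

theorem corner_one : corner 1 = unitZero C(TwoSphere, ℂ) := by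
  rw [corner, unitZero]
  congr 2

/-- The square root of a real function. -/
def sqrtFun (k : C(TwoSphere, ℝ)) : C(TwoSphere, ℝ) := ⟨fun s => Real.sqrt (k s), by fun_prop⟩

theorem sqrtFun_mul_self {k : C(TwoSphere, ℝ)} (hk : ∀ s, 0 ≤ k s) : sqrtFun k * sqrtFun k = k := by
  ext s
  exact Real.mul_self_sqrt (hk s)

theorem corner_nonneg {k : C(TwoSphere, ℝ)} (hk : ∀ s, 0 ≤ k s) : 0 ≤ corner k := by
  rw [← sqrtFun_mul_self hk, ← corner_mul]
  nth_rewrite 1 [← star_corner]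
  exact star_mul_self_nonneg _

theorem corner_cuntzLE_unitZero {k : C(TwoSphere, ℝ)} (hk : ∀ s, 0 ≤ k s) :
    CuntzLE (corner k) (unitZero C(TwoSphere, ℂ)) := by
  have := CuntzLE.conj (corner (sqrtFun k)) (unitZero C(TwoSphere, ℂ))
  rwa [star_corner, ← corner_one, corner_mul, corner_mul, mul_one, sqrtFun_mul_self hk] at this

/-- The function `(1 - z) / 2`. -/
def depth : C(TwoSphere, ℝ) := ⟨fun s => (1 - s.1 2) / 2, by fun_prop⟩

/-- The function `((1 - z) / 2 - 1 / 2)₊`. -/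
def depthCut : C(TwoSphere, ℝ) := ⟨fun s => max (depth s - 1 / 2) 0, by fun_prop⟩

theorem height_sq_le (s : TwoSphere) : s.1 2 ^ 2 ≤ 1 := by
  have := sq_add_sq_add_sq s
  nlinarith [sq_nonneg (s.1 0), sq_nonneg (s.1 1)]

theorem depth_nonneg (s : TwoSphere) : 0 ≤ depth s := by
  have := height_sq_le s
  change 0 ≤ (1 - s.1 2) / 2
  nlinarith

/-- The cube arises because, with g = `depthCut`, g · depth · g - g²/2 = g³. This is the form that
`CuntzLE.of_norm_sub_le` needs. -/
theorem depthCut_nonneg (s : TwoSphere) : 0 ≤ (depthCut ^ 3) s :=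
  pow_nonneg (le_max_right _ _) 3

/-- The Bott projection, as a finite matrix. -/
def bottMat : FinMat C(TwoSphere, ℂ) :=
  FinMat.twoByTwo ⟨fun s => (1 + s.1 2) / 2, by fun_prop⟩
    ⟨fun s => (s.1 0 - s.1 1 * Complex.I) / 2, by fun_prop⟩
    ⟨fun s => (s.1 0 + s.1 1 * Complex.I) / 2, by fun_prop⟩
    ⟨fun s => (1 - s.1 2) / 2, by fun_prop⟩

/-- The Bott projection. -/
def bott : Stabilization C(TwoSphere, ℂ) := of bottMat

theorem star_bottMat : star bottMat = bottMat := by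
  rw [bottMat, FinMat.star_twoByTwo]
  congr 1 <;> ext s <;> simp [sub_eq_add_neg]

theorem star_bott : star bott = bott := by
  rw [bott, ← of_star, star_bottMat]

theorem one_mul_bottMat : FinMat.twoByTwo (1 : C(TwoSphere, ℂ)) 0 0 1 * bottMat = bottMat := by
  rw [bottMat, FinMat.twoByTwo_mul]; simp

theorem scalar_mul_bottMat (k : C(TwoSphere, ℂ)) :
    bottMat * FinMat.twoByTwo k 0 0 k = FinMat.twoByTwo k 0 0 k * bottMat := by
  rw [bottMat, FinMat.twoByTwo_mul, FinMat.twoByTwo_mul]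
  simp [mul_comm]

theorem sq_eq (s : TwoSphere) : (s.1 0 : ℂ) ^ 2 = 1 - (s.1 1 : ℂ) ^ 2 - (s.1 2 : ℂ) ^ 2 := by
  have := sq_add_sq_add_sq s
  have h2 : s.1 0 ^ 2 = 1 - s.1 1 ^ 2 - s.1 2 ^ 2 := by linarith
  have h3 := congrArg (fun r : ℝ => (r : ℂ)) h2
  push_cast at h3
  exact h3

/-- `p D p = tr(p D) p` for the Bott projection `p` and diagonal matrices `D`. -/
theorem bott_mul_mul_bott (g : C(TwoSphere, ℂ)) :
    bottMat * FinMat.twoByTwo 1 0 0 g * bottMat =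
      FinMat.twoByTwo ⟨fun s => ((1 + s.1 2) / 2 + g s * ((1 - s.1 2) / 2)), by fun_prop⟩ 0 0
        ⟨fun s => ((1 + s.1 2) / 2 + g s * ((1 - s.1 2) / 2)), by fun_prop⟩ * bottMat := by
  rw [bottMat, FinMat.twoByTwo_mul, FinMat.twoByTwo_mul, FinMat.twoByTwo_mul]
  congr 1 <;> ext s <;> simp <;> have := sq_eq s <;> have h := Complex.I_sq <;> grind

theorem bott_mul_self : bott * bott = bott := by
  have h := bott_mul_mul_bott 1
  have h1 := one_mul_bottMat
  rw [mul_assoc, h1] at h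
  rw [bott, ← of_mul, h]
  congr 1
  conv_rhs => rw [← h1]
  congr 2 <;> ext s <;> simp <;> ring

theorem bott_nonneg : 0 ≤ bott := by
  rw [← bott_mul_self]
  nth_rewrite 1 [← star_bott]
  exact star_mul_self_nonneg _

/-- The first term vanishes only at the south pole, where the cube of `depthCut` equals 1/8. -/
theorem trace_pos (s : TwoSphere) :
    0 < (1 + s.1 2) / 2 + (depthCut ^ 3) s * ((1 - s.1 2) / 2) := by
  have h := height_sq_le s
  have h1 : -1 ≤ s.1 2 := by nlinarith
  have h2 : s.1 2 ≤ 1 := by nlinarith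
  have h3 := depthCut_nonneg s
  rcases h1.eq_or_lt with h4 | h4
  · have : (depthCut ^ 3) s = 1 / 8 := by
      change (max ((1 - s.1 2) / 2 - 1 / 2) 0) ^ 3 = 1 / 8
      rw [← h4]; norm_num
    rw [this, ← h4]; norm_num
  · have : 0 ≤ (depthCut ^ 3) s * ((1 - s.1 2) / 2) := mul_nonneg h3 (by linarith)
    linarith

/-- For D = diag(1, g) with g = `depthCut ^ 3`, the compression pDp equals τp with τ > 0. Hence
(τ^(-1/2) p) D (τ^(-1/2) p)* = p. -/
theorem bott_cuntzLE_diag :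
    CuntzLE bott (diag (unitZero C(TwoSphere, ℂ)) (corner (depthCut ^ 3))) := by
  let τ : TwoSphere → ℝ := fun s => (1 + s.1 2) / 2 + (depthCut ^ 3) s * ((1 - s.1 2) / 2)
  have hτ : Continuous τ := by fun_prop
  let k : C(TwoSphere, ℂ) := ⟨fun s => (((Real.sqrt (τ s))⁻¹ : ℝ) : ℂ),
    Complex.continuous_ofReal.comp ((Real.continuous_sqrt.comp hτ).inv₀ fun s =>
      (Real.sqrt_pos.mpr (trace_pos s)).ne')⟩
  have hk : star k = k := by ext s; simp [k]
  have hstar : star (FinMat.twoByTwo k 0 0 k * bottMat) = bottMat * FinMat.twoByTwo k 0 0 k := by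
    rw [star_mul, star_bottMat, FinMat.star_twoByTwo, hk, star_zero]
  have h1 := bott_mul_mul_bott (complexify (depthCut ^ 3))
  have key : FinMat.twoByTwo k 0 0 k * bottMat * FinMat.twoByTwo 1 0 0 (complexify (depthCut ^ 3)) *
      star (FinMat.twoByTwo k 0 0 k * bottMat) = bottMat := by
    rw [hstar, mul_assoc, mul_assoc, ← mul_assoc (FinMat.twoByTwo 1 0 0 _), ← mul_assoc bottMat,
      ← mul_assoc bottMat, h1, mul_assoc, scalar_mul_bottMat, ← mul_assoc, ← mul_assoc,
      FinMat.twoByTwo_mul, FinMat.twoByTwo_mul]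
    simp only [mul_zero, zero_mul, add_zero, zero_add]
    have : ∀ l : C(TwoSphere, ℂ), l = 1 → FinMat.twoByTwo l 0 0 l * bottMat = bottMat := by
      rintro l rfl
      exact one_mul_bottMat
    refine this _ ?_
    ext s
    have h2 : Real.sqrt (τ s) * Real.sqrt (τ s) = τ s := Real.mul_self_sqrt (trace_pos s).le
    have h3 : Real.sqrt (τ s) ≠ 0 := (Real.sqrt_pos.mpr (trace_pos s)).ne'
    have h4 : (Real.sqrt (τ s))⁻¹ * τ s * (Real.sqrt (τ s))⁻¹ = 1 := by
      have : ∀ x t : ℝ, x ≠ 0 → x * x = t → x⁻¹ * t * x⁻¹ = 1 := by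
        rintro x _ hx rfl
        field_simp
      exact this _ _ h3 h2
    have h5 := congrArg (fun r : ℝ => (r : ℂ)) h4
    simp only [τ] at h5
    push_cast at h5
    simp only [ContinuousMap.mul_apply, ContinuousMap.coe_mk, ContinuousMap.one_apply, k, τ,
      complexify_apply]
    push_cast
    exact h5
  have h := CuntzLE.conj (of (FinMat.twoByTwo k 0 0 k * bottMat))
    (diag (unitZero C(TwoSphere, ℂ)) (corner (depthCut ^ 3)))
  rw [unitZero, corner, diag_of, FinMat.diag_twoByTwo] at h ⊢
  rwa [← of_star, ← of_mul, ← of_mul, key] at h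

end TwoSphere

/-! ### The obstruction, and the failure of (O6+) for the sphere. -/

namespace TwoSphere

open CStarCompletion Stabilization

/-- The trace of the Bott projection is 1 at each point, so its two diagonal entries there cannot
both be smaller than 1/4. -/
theorem not_vanishesAt_of_norm_sub_bott {y : Stabilization C(TwoSphere, ℂ)}
    (h : dist y bott < 1 / 4) (s : TwoSphere) : ¬ VanishesAt s y := by
  intro hs
  have hb : ∀ i j, ‖bottMat.entry i j s‖ < 1 / 4 := by
    intro i j
    calc ‖bottMat.entry i j s‖ = ‖entry i j (y - bott) s‖ := by
          rw [entry_sub, ContinuousMap.sub_apply, hs i j, zero_sub, norm_neg, bott, entry_of]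
      _ ≤ ‖entry i j (y - bott)‖ := ContinuousMap.norm_coe_le_norm _ _
      _ ≤ ‖y - bott‖ := norm_entry_le _ _ _
      _ < 1 / 4 := by rwa [← dist_eq_norm]
  have h0 := hb 0 0
  have h1 := hb 1 1
  have h2 : bottMat.entry 0 0 s + bottMat.entry 1 1 s = 1 := by
    simp only [bottMat, FinMat.entry_twoByTwo_zero_zero, FinMat.entry_twoByTwo_one_one,
      ContinuousMap.coe_mk]
    ring
  have h3 := norm_add_le (bottMat.entry 0 0 s) (bottMat.entry 1 1 s)
  rw [h2, norm_one] at h3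
  linarith

theorem unitZero_eq_single {A : Type*} [CStarAlgebra A] :
    unitZero A = of (FinMat.single 0 0 (1 : A)) := by
  rw [FinMat.single_zero_zero, unitZero]

/-- Every section `bott * q` of the Bott bundle vanishes somewhere. -/
theorem exists_vanishesAt {q : Stabilization C(TwoSphere, ℂ)} (h1 : bott * q = q)
    (h2 : q * unitZero C(TwoSphere, ℂ) = q) : ∃ s, VanishesAt s q := by
  have hq : ∀ i j, entry i j q =
      bottMat.entry i 0 * entry 0 j q + bottMat.entry i 1 * entry 1 j q := fun i j => by
    conv_lhs => rw [← h1, bott, entry_of_mul (n := 2) (x := bottMat) (FinMat.suppIn_twoByTwo _ _ _ _)]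
    rw [Finset.sum_range_succ, Finset.sum_range_one]
  have h0 : ∀ i j, j ≠ 0 → entry i j q = 0 := fun i j hj => by
    have h3 : unitZero C(TwoSphere, ℂ) * star q = star q := by
      conv_rhs => rw [← h2, star_mul, star_unitZero]
    rw [← star_eq_zero, ← entry_star, ← h3, unitZero_eq_single,
      entry_of_mul (FinMat.suppIn_single Nat.one_pos Nat.one_pos _), Finset.sum_range_one,
      FinMat.entry_single, if_neg (by simp [hj]), zero_mul]
  obtain ⟨s, hs1, hs2⟩ := exists_eq_zero_of_section (entry 0 0 q).continuous
    (entry 1 0 q).continuous (fun s => by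
      have := congrArg (fun f : C(TwoSphere, ℂ) => f s) (hq 0 0)
      simp [bottMat] at this
      linear_combination 2 * this) (fun s => by
      have := congrArg (fun f : C(TwoSphere, ℂ) => f s) (hq 1 0)
      simp [bottMat] at this
      linear_combination 2 * this)
  refine ⟨s, fun i j => ?_⟩
  by_cases hj : j = 0
  · subst hj
    rw [hq, ContinuousMap.add_apply, ContinuousMap.mul_apply, ContinuousMap.mul_apply, hs1, hs2,
      mul_zero, mul_zero, add_zero]
  · rw [h0 i j hj, ContinuousMap.zero_apply]

/-- As e ≾ 1, e is close to r u r* with u = `unitZero`. For W = √e r u, WW* is close to e², while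
W*W has the single entry that is claimed to be nonzero. If it vanished at s, then so would (WW*)²,
and with it an element close to the Bott projection. -/
theorem exists_entry_ne_zero {e : Stabilization C(TwoSphere, ℂ)} (he : 0 ≤ e)
    (h : CuntzLE bott (diag e e)) (h1 : CuntzLE e (unitZero C(TwoSphere, ℂ))) :
    ∃ r : Stabilization C(TwoSphere, ℂ), ∀ s, entry 0 0 (star r * e * r) s ≠ 0 := by
  have hee : 0 ≤ e * e := he.isSelfAdjoint.mul_self_nonneg
  -- The fourth power e⁴ ≈ (WW*)² = W(W*W)W* contains W*W as a factor.
  have hed : CuntzLE e (e * e * (e * e)) := (cuntzLE_mul_self he).trans (cuntzLE_mul_self hee)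
  obtain ⟨R, hR⟩ := cuntzLE_iff.mp (h.trans (hed.diag hed)) (1 / 4) (by norm_num)
  set t := CFC.sqrt e
  set u := unitZero C(TwoSphere, ℂ)
  have hts : star t = t := (IsSelfAdjoint.of_nonneg (CFC.sqrt_nonneg e)).star_eq
  have htt : t * t = e := CFC.sqrt_mul_sqrt_self e he
  have hus : star u = u := star_unitZero
  have huu : ∀ x, u * (u * x) = u * x := fun x => by rw [← mul_assoc, unitZero_mul_self]
  let K : Stabilization C(TwoSphere, ℂ) → Stabilization C(TwoSphere, ℂ) := fun y =>
    R * diag (t * y * t * (t * y * t)) (t * y * t * (t * y * t)) * star R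
  have hK : Continuous K := by
    have : Continuous fun y => diag (t * y * t * (t * y * t)) (t * y * t * (t * y * t)) :=
      Stabilization.continuous_diag.comp (Continuous.prodMk (by fun_prop) (by fun_prop))
    exact (continuous_const.mul this).mul continuous_const
  have hKe : dist (K e) bott < 1 / 4 := by
    have : t * e * t = e * e := by
      rw [← htt]; simp only [mul_assoc]
    simpa only [K, this] using hR
  obtain ⟨δ, hδ, hKδ⟩ := Metric.eventually_nhds_iff.mp
    ((hK.dist continuous_const).continuousAt.eventually_lt_const hKe)
  obtain ⟨r, hr⟩ := cuntzLE_iff.mp h1 δ hδ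
  let W := t * r * u
  have hWW : t * (r * u * star r) * t = W * star W := by
    simp only [W, star_mul, hts, hus, mul_assoc, huu]
  refine ⟨r, fun s hs => ?_⟩
  have hWψ : star W * W = of (FinMat.single 0 0 (entry 0 0 (star r * e * r))) := by
    rw [← unitZero_mul_mul_unitZero]
    simp only [W, star_mul, hts, hus, mul_assoc, ← htt, u]
  have hv : VanishesAt s (star W * W) := fun i j => by
    rw [hWψ, entry_of, FinMat.entry_single]
    split_ifs
    · exact hs
    · rfl
  have hG : VanishesAt s (W * star W * (W * star W)) := by
    have : W * star W * (W * star W) = W * (star W * W) * star W := by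
      simp only [mul_assoc]
    rw [this]
    exact (hv.mul_left W).mul_right _
  refine not_vanishesAt_of_norm_sub_bott (hKδ hr) s ?_
  simp only [K, hWW]
  exact ((hG.diag hG).mul_left R).mul_right _

/-- Since e ≾ p, e is close to some l p l*. The section q = p l* r u of the Bott bundle has q*q with
single entry close to ψ, and |ψ| is bounded below by some m > 0; but q vanishes at some point. -/
theorem not_bott_cuntzLE_diag {e : Stabilization C(TwoSphere, ℂ)} (he : 0 ≤ e)
    (h0 : CuntzLE e bott) (h1 : CuntzLE e (unitZero C(TwoSphere, ℂ))) :
    ¬ CuntzLE bott (diag e e) := by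
  intro h
  obtain ⟨r, hψ⟩ := exists_entry_ne_zero he h h1
  set u := unitZero C(TwoSphere, ℂ)
  have hus : star u = u := star_unitZero
  set ψ := entry 0 0 (star r * e * r) with hψe
  obtain ⟨m, hm0, hm⟩ := isCompact_univ.exists_forall_le' (f := fun s => ‖ψ s‖) (a := 0)
    (by fun_prop) (fun s _ => norm_pos_iff.mpr (hψ s))
  have hE : Continuous fun y => entry 0 0 (star r * y * r) := by fun_prop
  obtain ⟨δ', hδ', hE'⟩ := Metric.continuousAt_iff.mp (hE.continuousAt (x := e)) m hm0
  obtain ⟨l, hl⟩ := cuntzLE_iff.mp h0 δ' hδ'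
  let q := bott * (star l * r * u)
  have hq1 : bott * q = q := by
    change bott * (bott * _) = bott * _
    rw [← mul_assoc, bott_mul_self]
  have hq2 : q * u = q := by
    simp only [q, mul_assoc, u, unitZero_mul_self]
  obtain ⟨s, hs⟩ := exists_vanishesAt hq1 hq2
  have hqq : star q * q = of (FinMat.single 0 0 (entry 0 0 (star r * (l * bott * star l) * r))) := by
    rw [← unitZero_mul_mul_unitZero]
    have : ∀ x, bott * (bott * x) = bott * x := fun x => by rw [← mul_assoc, bott_mul_self]
    simp only [q, star_mul, star_star, star_bott, hus, mul_assoc, this, u]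
  have hv := hs.mul_left (star q) 0 0
  rw [hqq, entry_of, FinMat.entry_single, if_pos ⟨rfl, rfl⟩] at hv
  have h3 := hE' hl
  rw [dist_eq_norm] at h3
  have h4 : ‖ψ s‖ ≤ ‖entry 0 0 (star r * (l * bott * star l) * r) - ψ‖ := by
    refine le_trans (le_of_eq ?_) (ContinuousMap.norm_coe_le_norm _ s)
    rw [ContinuousMap.sub_apply, hv, zero_sub, norm_neg]
  exact absurd (hm s (Set.mem_univ s)) (not_le.mpr (h4.trans_lt h3))

/-- Conjugation by the matrix unit e₀₁ moves the entry (1 - z)/2 of the Bott projection at (1, 1) to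
(0, 0). -/
theorem corner_depth_cuntzLE_bott : CuntzLE (corner depth) bott := by
  have h := CuntzLE.conj (of (FinMat.twoByTwo (0 : C(TwoSphere, ℂ)) 1 0 0)) bott
  convert h using 1
  rw [bott, bottMat, corner, ← of_star, FinMat.star_twoByTwo, ← of_mul, FinMat.twoByTwo_mul,
    ← of_mul, FinMat.twoByTwo_mul]
  congr 2 <;> simp
  ext s
  simp [depth]

/-- The Cuntz semigroup of `C(S²)` does not satisfy (O6+). -/
theorem not_strengthenedAlmostRiesz : ¬ StrengthenedAlmostRiesz (Cu C(TwoSphere, ℂ)) := by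
  intro H
  have hb : 0 ≤ unitZero C(TwoSphere, ℂ) := by
    rw [← corner_one]; exact corner_nonneg fun _ => zero_le_one
  have hc := corner_nonneg depthCut_nonneg
  have hx := corner_nonneg depth_nonneg
  have h0 : (0 : Stabilization C(TwoSphere, ℂ)) ≤ 0 := le_rfl
  have zero_le : ∀ b : Stabilization C(TwoSphere, ℂ), CuntzLE 0 b := fun b => by
    simpa using CuntzLE.conj 0 b
  obtain ⟨e, f, haef, ⟨hce, hea, heb⟩, -, -, hfc⟩ := H (Cu.mk bott bott_nonneg) (Cu.mk _ hb)
    (Cu.mk _ hc) (Cu.mk _ hc) (Cu.mk _ hx) (Cu.mk 0 h0) (Cu.mk 0 h0) bott_cuntzLE_diag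
    (Cu.wayBelow_mk (ε := 1 / 2) (by norm_num) fun y hy hyx =>
      CuntzLE.of_norm_sub_le (f := corner depthCut) hx.isSelfAdjoint hy.isSelfAdjoint hc (by
        rw [star_corner, corner_mul, corner_mul, corner_mul, corner_sub_smul]
        congr 1
        ext s
        simp only [ContinuousMap.sub_apply, ContinuousMap.mul_apply, ContinuousMap.smul_apply,
          ContinuousMap.pow_apply, smul_eq_mul]
        change (max (depth s - 1 / 2) 0) ^ 3 = max (depth s - 1 / 2) 0 * depth s *
          max (depth s - 1 / 2) 0 - 1 / 2 * (max (depth s - 1 / 2) 0 * max (depth s - 1 / 2) 0)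
        rcases max_cases (depth s - 1 / 2) 0 with h | h
        · rw [h.1]; ring
        · rw [h.1]; ring) hyx.le)
    corner_depth_cuntzLE_bott (corner_cuntzLE_unitZero depth_nonneg)
    (Cu.wayBelow_mk one_pos fun b _ _ => zero_le b) (zero_le _) (zero_le _)
  obtain ⟨e, he, rfl⟩ := Cu.exists_rep e
  obtain ⟨f, hf, rfl⟩ := Cu.exists_rep f
  have hce' : CuntzLE (corner (depthCut ^ 3)) e := by
    -- A constant sequence turns ≪ into ≤.
    obtain ⟨-, h⟩ := hce (fun _ => Cu.mk e he) (Cu.mk e he) monotone_const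
      (by rw [Set.range_const]; exact isLUB_singleton) le_rfl
    exact h
  have haef' : CuntzLE bott (diag e f) := haef
  have hfc' : CuntzLE f (corner (depthCut ^ 3)) := hfc
  -- Choosing c equal to x' gives f ≾ c ≾ e, so that e ⊕ f ≾ e ⊕ e.
  exact not_bott_cuntzLE_diag he hea heb
    (haef'.trans ((CuntzLE.refl e).diag (hfc'.trans hce')))

end TwoSphere

/-- The Cuntz semigroup of every C*-algebra of stable rank one satisfies strengthened almost Riesz
decomposition, whereas the Cuntz semigroup of `C(S²)` does not. -/
theorem theorem5p4 :
    (∀ (A : Type*) [NonUnitalCStarAlgebra A],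
      HasStableRankOne A → StrengthenedAlmostRiesz (Cu A)) ∧
    ¬ StrengthenedAlmostRiesz (Cu C(Metric.sphere (0 : EuclideanSpace ℝ (Fin 3)) 1, ℂ)) :=
  ⟨fun _ _ hA => hA.strengthenedAlmostRiesz, TwoSphere.not_strengthenedAlmostRiesz⟩
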